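/- **Proposition (transmitted correlation).** *Data.* Let $0<c_1<c_0$, $\mathbf k_0\in\mathbb R^2$ with $|\mathbf k_0|<1/c_0$, $0<z_{int}<z_{tr}$ and $\gamma\in(1/2,2]$. Put, for $j=0,1$ and with $\mathbf k_0^\perp=(-k_{0,2},k_{0,1})^T$, $$s_j=\frac{\sqrt{1-c_j^2|\mathbf k_0|^2}}{c_j},\quad A_j=\frac{1}{c_j^3s_j^3}\big(I_2-c_j^2\,\mathbf k_0^\perp\otimes\mathbf k_0^\perp\big),\quad \hat{\mathcal U}_j(\omega,\mathbf q,z)=e^{-i\omega z c_j\mathbf q^TA_j\mathbf q/2},\quad \mathcal T=\frac{2\sqrt{s_0s_1}}{s_0+s_1},$$ $$\mathbf x_{int}=\frac{z_{int}}{s_0}\mathbf k_0,\qquad \mathbf x_{obs}=\mathbf x_{int}+\frac{z_{tr}-z_{int}}{s_1}\mathbf k_0,\qquad t_{obs}=\frac{z_{int}}{c_0^2s_0}+\frac{z_{tr}-z_{int}}{c_1^2s_1}.$$ Let $V$ be a real, strictly stationary random field on $\mathbb R^2$ with continuous sample paths which is $\alpha$-mixing: $\sup|\mathbb P(A\cap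 B)-\mathbb P(A)\mathbb P(B)|\to0$ as $r\to\infty$, the supremum being over all nonempty $S,S'\subset\mathbb R^2$ at distance $>r$ and all $A\in\sigma(V(\mathbf x),\mathbf x\in S)$, $B\in\sigma(V(\mathbf x),\mathbf x\in S')$. Let $\Psi:\mathbb R\times\mathbb R^2\to\mathbb R$ be integrable, such that $\hat\Psi(\omega,\mathbf k)=\iint\Psi(t,\mathbf x)e^{i\omega(t-\mathbf k\cdot\mathbf x)}\,dt\,d\mathbf x$ is supported in $\{a\le|\omega|\le b,\ |\mathbf k|\le R\}$ for some $a>0$, $b$, $R$; put $|\hat\Psi|_2^2(\omega)=\frac{\omega^2}{(2\pi)^2}\int|\hat\Psi(\omega,\mathbf q)|^2d\mathbf q$. *Transmitted wave and speckle.* For $\varepsilon>0$ the (leading-order) wave transmitted through the rough interface $z=z_{int}+\varepsilon V(\mathbf x/\varepsilon^\gamma)$ and observed in the plane $z=z_{tr}$ is $$u^{\varepsilon,tr}(t,\mathbf x)=\frac{\mathcal T}{2(2\pi)^3}\sqrt{\frac{s_0}{s_1}}\iiint e^{-i\omega(t-s_0z_{int}-s_1(z_{tr}-z_{int})-\mathbf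 x\cdot\mathbf k_0)/\varepsilon}e^{i\omega\mathbf q\cdot(\mathbf x-\mathbf x_{obs})/\sqrt\varepsilon}K^\varepsilon(\omega,\mathbf q,\mathbf q')\,\hat{\mathcal U}_1(\omega,\mathbf q,z_{tr}-z_{int})\,\hat{\mathcal U}_0(\omega,\mathbf q',z_{int})\,\hat\Psi(\omega,\mathbf q')\,\omega^2\,d\omega\,d\mathbf q'\,d\mathbf q,$$ $$K^\varepsilon(\omega,\mathbf q,\mathbf q')=\frac{\omega^2}{\varepsilon(2\pi)^2}\int e^{i\omega(\mathbf q'-\mathbf q)\cdot(\mathbf x'-\mathbf x_{int})/\sqrt\varepsilon}\,e^{i\omega(s_0-s_1)V(\mathbf x'/\varepsilon^\gamma)}\,d\mathbf x',$$ where one integrates over $\mathbf q'$, then over $\mathbf x'$, then over $\mathbf q$ and $\omega$, the integral over $\mathbf q$ being the oscillatory integral obtained by inserting the factor $e^{-\delta|\mathbf q|^2}$ and letting $\delta\downarrow0$. The transmitted speckle profile is $$S^{\varepsilon,tr}(\bar s,\bar{\mathbf y},\mathbf y,\tilde s,\tilde{\mathbf y})=\varepsilon^{1-2\gamma}\,u^{\varepsilon,tr}\big(t_{obs}+\mathbf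 k_0\cdot(\varepsilon^{1-\gamma}\bar{\mathbf y}+\sqrt\varepsilon\,\mathbf y+\varepsilon^\gamma\tilde{\mathbf y})+\varepsilon^{2(1-\gamma)}\bar s+\varepsilon\tilde s,\ \mathbf x_{obs}+\varepsilon^{1-\gamma}\bar{\mathbf y}+\sqrt\varepsilon\,\mathbf y+\varepsilon^\gamma\tilde{\mathbf y}\big),$$ and its correlation function is $\mathcal C^{\varepsilon,tr}(\bar s,\bar{\mathbf y},\mathbf y,\tilde s_1,\tilde{\mathbf y}_1,\tilde s_2,\tilde{\mathbf y}_2)=S^{\varepsilon,tr}(\bar s,\bar{\mathbf y},\mathbf y,\tilde s_1,\tilde{\mathbf y}_1)\,S^{\varepsilon,tr}(\bar s,\bar{\mathbf y},\mathbf y,\tilde s_2,\tilde{\mathbf y}_2)$. *Limit.* Let $\mathcal A(v,\omega,d\mathbf p)=\int\mathbb E\big[e^{i\omega v(V(\mathbf y')-V(0))}\big]e^{-i\omega\mathbf p\cdot\mathbf y'}d\mathbf y'$ (a Fourier transform in the sense of tempered distributions in $\mathbf p$), $$\mathbf y^{tr}_{\mathbf p}=(z_{tr}-z_{int})c_1A_1\mathbf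 p,\qquad s^{tr}_{\mathbf p}=(z_{tr}-z_{int})c_1\,\mathbf p^TA_1\mathbf p/2,$$ $$\mathbf C^{tr}(\bar s,\bar{\mathbf y},\tilde s,\tilde{\mathbf y})=\frac{\mathcal T^2s_0}{4s_1(2\pi)^3}\iint e^{-i\omega(\tilde s-\mathbf p\cdot\tilde{\mathbf y})}\mathcal A(s_0-s_1,\omega,\mathbf p)\,|\hat\Psi|_2^2(\omega)\,\delta(\bar s-s^{tr}_{\mathbf p})\,\delta(\bar{\mathbf y}-\mathbf y^{tr}_{\mathbf p})\,\omega^2\,d\omega\,d\mathbf p.$$ *Conclusion.* The oscillatory integral defining $u^{\varepsilon,tr}$ converges for every $\varepsilon>0$, every realization of $V$ and all $(t,\mathbf x)$, $\mathcal C^{\varepsilon,tr}$ is integrable against every test function, $\mathbf C^{tr}(\bar s,\bar{\mathbf y},\tilde s_1-\tilde s_2,\tilde{\mathbf y}_1-\tilde{\mathbf y}_2)$ is a tempered distribution, and $$\lim_{\varepsilon\to0}\mathcal C^{\varepsilon,tr}(\bar s,\bar{\mathbf y},\mathbf y,\tilde s_1,\tilde{\mathbf y}_1,\tilde s_2,\tilde{\mathbf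 y}_2)=\mathbf C^{tr}(\bar s,\bar{\mathbf y},\tilde s_1-\tilde s_2,\tilde{\mathbf y}_1-\tilde{\mathbf y}_2)$$ in probability in $\mathcal S'\big((\mathbb R\times\mathbb R^2\times\mathbb R^2)\times(\mathbb R\times\mathbb R^2)\times(\mathbb R\times\mathbb R^2)\big)$, that is, in probability after pairing with any fixed Schwartz function (in particular with those supported away from $\bar{\mathbf y}=0$). Moreover $s^{tr}_{\mathbf p}\ge0$. *Generalized Snell law of refraction.* Let $\theta_{inc}=\arctan(|\mathbf k_0|/s_0)$ and $\theta^0_{tr}=\arctan(|\mathbf k_0|/s_1)$, and let $\theta^\varepsilon_{tr}(\mathbf p)=\arctan\big(|\mathbf x_{obs}-\mathbf x_{int}+\varepsilon^{1-\gamma}\mathbf y^{tr}_{\mathbf p}|/(z_{tr}-z_{int})\big)$ be the angle with the vertical at which the speckle of direction $\mathbf p$, located at $\bar{\mathbf y}=\mathbf y^{tr}_{\mathbf p}$, is transmitted. If $\mathbf k_0\ne0$, then for all $\varepsilon>0$ and $\mathbf p\in\mathbb R^2$, with $\xi_\varepsilon=\varepsilon^{1-\gamma}c_0^2/\sin^2\theta_{inc}$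 and $\Xi_\varepsilon(\mathbf p)=\big(1+\xi_\varepsilon\,\mathbf p\cdot\mathbf k_0/\cos^2\theta^0_{tr}\big)^2+\xi_\varepsilon^2(\mathbf p\cdot\mathbf k_0^\perp)^2$, $$\frac{\tan\theta^\varepsilon_{tr}(\mathbf p)}{\tan\theta^0_{tr}}=\frac{|\mathbf x_{obs}-\mathbf x_{int}+\varepsilon^{1-\gamma}\mathbf y^{tr}_{\mathbf p}|}{|\mathbf x_{obs}-\mathbf x_{int}|}=\sqrt{\Xi_\varepsilon(\mathbf p)},\qquad \frac{\sin\theta^\varepsilon_{tr}(\mathbf p)}{c_1}=\frac{\sin\theta_{inc}}{c_0}+|\mathbf k_0|\left(\sqrt{\frac{\Xi_\varepsilon(\mathbf p)}{1+\sin^2\theta^0_{tr}\,(\Xi_\varepsilon(\mathbf p)-1)}}-1\right);$$ if $\mathbf k_0=0$, then $\theta^\varepsilon_{tr}(\mathbf p)=\arctan(\varepsilon^{1-\gamma}c_1|\mathbf p|)$. -/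

import Mathlib

open MeasureTheory Filter Topology
open scoped SchwartzMap

namespace RoughInterface

noncomputable section

/-- The lateral plane. -/
abbrev Plane : Type := EuclideanSpace ℝ (Fin 2)

/-! ### The random interface profile -/

/-- Strict stationarity: the finite-dimensional laws are invariant under translations. -/
def IsStationaryField {Ω : Type*} [MeasurableSpace Ω] (P : Measure Ω) (V : Plane → Ω → ℝ) : Prop :=
  ∀ (n : ℕ) (x : Fin n → Plane) (h : Plane),
    P.map (fun o (i : Fin n) => V (x i + h) o) = P.map (fun o (i : Fin n) => V (x i) o)

/-- The sigma-field generated by `V x`, `x ∈ S`. -/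
@[reducible] def fieldSigma {Ω : Type*} (V : Plane → Ω → ℝ) (S : Set Plane) : MeasurableSpace Ω :=
  ⨆ x ∈ S, MeasurableSpace.comap (V x) inferInstance

/-- The distance `inf |s - s'|` between two sets, with values in `[0, ∞]`. -/
def setDist (S S' : Set Plane) : ENNReal := ⨅ s ∈ S, ⨅ s' ∈ S', edist s s'

/-- The `α`-mixing coefficient of the random field `V` at separation `r`. -/
def alphaCoeff {Ω : Type*} [MeasurableSpace Ω] (P : Measure Ω) (V : Plane → Ω → ℝ) (r : ℝ) : ℝ :=
  sSup {a : ℝ | ∃ S S' : Set Plane, S.Nonempty ∧ S'.Nonempty ∧ ENNReal.ofReal r < setDist S S' ∧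
    ∃ A B : Set Ω, MeasurableSet[fieldSigma V S] A ∧ MeasurableSet[fieldSigma V S'] B ∧
      a = |P.real (A ∩ B) - P.real A * P.real B|}

/-- `α`-mixing: `α(r) → 0` as `r → ∞`. -/
def IsAlphaMixing {Ω : Type*} [MeasurableSpace Ω] (P : Measure Ω) (V : Plane → Ω → ℝ) : Prop :=
  Tendsto (alphaCoeff P V) atTop (𝓝 0)

/-! ### The source -/

/-- `Ψ̂(ω,k) = ∬ Ψ(t,x) exp(iω(t - k·x)) dt dx`. -/
def sourceFT (Ψ : ℝ → Plane → ℝ) (ω : ℝ) (k : Plane) : ℂ :=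
  ∫ z : ℝ × Plane, (Ψ z.1 z.2 : ℂ) *
    Complex.exp (Complex.I * ((ω * (z.1 - inner ℝ k z.2) : ℝ) : ℂ))

/-- `|Ψ̂|²₂(ω) = ω²/(2π)² ∫ |Ψ̂(ω,q)|² dq`. -/
def sourceEnergy (Ψ : ℝ → Plane → ℝ) (ω : ℝ) : ℝ :=
  ω ^ 2 / (2 * Real.pi) ^ 2 * ∫ q : Plane, ‖sourceFT Ψ ω q‖ ^ 2

/-- `Ψ̂` has compact support in `(ω,k)`, at a positive distance from `ω = 0`. -/
def HasBandLimitedSpectrum (Ψ : ℝ → Plane → ℝ) : Prop :=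
  ∃ a b R : ℝ, 0 < a ∧ ∀ (ω : ℝ) (k : Plane), sourceFT Ψ ω k ≠ 0 → a ≤ |ω| ∧ |ω| ≤ b ∧ ‖k‖ ≤ R

/-! ### Deterministic geometry -/

/-- The deterministic data: wave speeds above (`c₀`) and below (`c₁`) the interface, lateral slowness
vector `k₀` of the source, mean depth `zInt` of the interface, depth `zTr` of the observation plane. -/
structure Config where
  c₀ : ℝ
  c₁ : ℝ
  k₀ : Plane
  zInt : ℝ
  zTr : ℝ

/-- The vertical slowness `√(1 - c²|k₀|²) / c`. -/
def slowness (c : ℝ) (k₀ : Plane) : ℝ := √(1 - c ^ 2 * ‖k₀‖ ^ 2) / c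

/-- `k^⊥ = (-k₂, k₁)`. -/
def perp (k : Plane) : Plane := !₂[-(k 1), k 0]

/-- The dispersion matrix `(c s)⁻³ (I - c² k₀^⊥ ⊗ k₀^⊥)`, as a map of the plane. -/
def dispersion (c : ℝ) (k₀ : Plane) (q : Plane) : Plane :=
  (1 / (c ^ 3 * slowness c k₀ ^ 3)) • (q - (c ^ 2 * inner ℝ (perp k₀) q) • perp k₀)

/-- The paraxial propagator `exp(-iω z c qᵀAq / 2)`. -/
def propagator (c : ℝ) (k₀ : Plane) (ω : ℝ) (q : Plane) (z : ℝ) : ℂ :=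
  Complex.exp (-Complex.I * ((ω * z * c * inner ℝ q (dispersion c k₀ q) / 2 : ℝ) : ℂ))

namespace Config

variable (D : Config)

/-- Vertical slowness above the interface. -/
def s₀ : ℝ := slowness D.c₀ D.k₀

/-- Vertical slowness below the interface. -/
def s₁ : ℝ := slowness D.c₁ D.k₀

/-- The transmission coefficient. -/
def transCoeff : ℝ := 2 * √(D.s₀ * D.s₁) / (D.s₀ + D.s₁)

/-- Lateral position at which the incident pulse impinges on the interface. -/
def xInt : Plane := (D.zInt / D.s₀) • D.k₀

/-- Lateral position of the specularly transmitted wave in the plane `z = zTr`. -/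
def xObs : Plane := D.xInt + ((D.zTr - D.zInt) / D.s₁) • D.k₀

/-- Travel time of the specularly transmitted wave. -/
def tObs : ℝ := D.zInt / (D.c₀ ^ 2 * D.s₀) + (D.zTr - D.zInt) / (D.c₁ ^ 2 * D.s₁)

/-- The speckle offset `y_p = (zTr - zInt) c₁ A₁ p`. -/
def yTr (p : Plane) : Plane := ((D.zTr - D.zInt) * D.c₁) • dispersion D.c₁ D.k₀ p

/-- The speckle time lag `s_p = (zTr - zInt) c₁ pᵀA₁p / 2`. -/
def sTr (p : Plane) : ℝ := (D.zTr - D.zInt) * D.c₁ * inner ℝ p (dispersion D.c₁ D.k₀ p) / 2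

/-- Incidence angle. -/
def thetaInc : ℝ := Real.arctan (‖D.k₀‖ / D.s₀)

/-- Specular transmission angle. -/
def thetaSpec : ℝ := Real.arctan (‖D.k₀‖ / D.s₁)

/-- Transmission angle of the speckle with scattered direction `p`: the angle with the vertical of the
ray from `(xInt, zInt)` to `(xObs + ε^(1-γ) y_p, zTr)`. -/
def thetaTr (γ ε : ℝ) (p : Plane) : ℝ :=
  Real.arctan (‖D.xObs - D.xInt + (ε ^ (1 - γ)) • D.yTr p‖ / (D.zTr - D.zInt))

/-- `ξ_ε = ε^(1-γ) c₀² / sin²(θ_inc)`. -/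
def xi (γ ε : ℝ) : ℝ := ε ^ (1 - γ) * D.c₀ ^ 2 / Real.sin D.thetaInc ^ 2

/-- `Ξ_ε(p) = (1 + ξ_ε p·k₀ / cos²θ⁰)² + ξ_ε² (p·k₀^⊥)²`. -/
def bigXi (γ ε : ℝ) (p : Plane) : ℝ :=
  (1 + D.xi γ ε * inner ℝ p D.k₀ / Real.cos D.thetaSpec ^ 2) ^ 2
    + D.xi γ ε ^ 2 * inner ℝ p (perp D.k₀) ^ 2

/-! ### The transmitted wave -/

/-- The scattering operator of the interface profile `v`, acting on a function `f` of `q'`: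
`(K f)(q) = ∫ K(τ,ω,q,q') f(q') dq'` with kernel
`ω²/(ε(2π)²) ∫ exp(iω(q'-q)·(x'-xInt)/√ε) exp(iωτ v(x'/ε^γ)) dx'`,
the integration over `q'` being performed before the one over `x'`. -/
def scatter (γ ε : ℝ) (v : Plane → ℝ) (τ ω : ℝ) (f : Plane → ℂ) (q : Plane) : ℂ :=
  ((ω ^ 2 / (ε * (2 * Real.pi) ^ 2) : ℝ) : ℂ) * ∫ x' : Plane,
    Complex.exp (-Complex.I * ((ω * inner ℝ q (x' - D.xInt) / √ε : ℝ) : ℂ))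
    * Complex.exp (Complex.I * ((ω * τ * v ((ε ^ γ)⁻¹ • x') : ℝ) : ℂ))
    * ∫ q' : Plane, Complex.exp (Complex.I * ((ω * inner ℝ q' (x' - D.xInt) / √ε : ℝ) : ℂ)) * f q'

/-- The transmitted wave in the plane `z = zTr`, with an additional convergence factor
`exp(-δ|q|²)` in the oscillatory integral over the outgoing direction `q`. -/
def transmittedReg (Ψ : ℝ → Plane → ℝ) (γ ε : ℝ) (v : Plane → ℝ) (t : ℝ) (x : Plane) (δ : ℝ) : ℂ :=
  ((D.transCoeff / (2 * (2 * Real.pi) ^ 3) * √(D.s₀ / D.s₁) : ℝ) : ℂ) *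
    ∫ ω : ℝ, ∫ q : Plane,
      ((Real.exp (-δ * ‖q‖ ^ 2) : ℝ) : ℂ)
      * Complex.exp (-Complex.I * ((ω * (t - D.s₀ * D.zInt - D.s₁ * (D.zTr - D.zInt)
          - inner ℝ x D.k₀) / ε : ℝ) : ℂ))
      * Complex.exp (Complex.I * ((ω * inner ℝ q (x - D.xObs) / √ε : ℝ) : ℂ))
      * propagator D.c₁ D.k₀ ω q (D.zTr - D.zInt)
      * D.scatter γ ε v (D.s₀ - D.s₁) ω
          (fun q' => propagator D.c₀ D.k₀ ω q' D.zInt * sourceFT Ψ ω q') q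
      * ((ω ^ 2 : ℝ) : ℂ)

/-- The (leading-order) transmitted wave in the plane `z = zTr`; the oscillatory integral over `q` is
the limit as the convergence factor tends to one. -/
def transmitted (Ψ : ℝ → Plane → ℝ) (γ ε : ℝ) (v : Plane → ℝ) (t : ℝ) (x : Plane) : ℂ :=
  limUnder (𝓝[>] (0 : ℝ)) (D.transmittedReg Ψ γ ε v t x)

/-- The transmitted speckle profile, a function of `(s̄, ȳ, y, s̃, ỹ)`. -/
def speckle (Ψ : ℝ → Plane → ℝ) (γ ε : ℝ) (v : Plane → ℝ)
    (sbar : ℝ) (ybar y : Plane) (stil : ℝ) (ytil : Plane) : ℂ :=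
  ((ε ^ (1 - 2 * γ) : ℝ) : ℂ) * D.transmitted Ψ γ ε v
    (D.tObs + ε ^ (1 - γ) * inner ℝ D.k₀ ybar + √ε * inner ℝ D.k₀ y + ε ^ γ * inner ℝ D.k₀ ytil
      + ε ^ (2 * (1 - γ)) * sbar + ε * stil)
    (D.xObs + (ε ^ (1 - γ)) • ybar + √ε • y + (ε ^ γ) • ytil)

end Config

/-- The space of the variables `((s̄, ȳ, y), (s̃₁, ỹ₁), (s̃₂, ỹ₂))`. -/
abbrev CorrSpace : Type := (ℝ × Plane × Plane) × (ℝ × Plane) × (ℝ × Plane)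

namespace Config

variable (D : Config)

/-- The correlation function of the transmitted speckle profile. -/
def correlation (Ψ : ℝ → Plane → ℝ) (γ ε : ℝ) (v : Plane → ℝ) (w : CorrSpace) : ℂ :=
  D.speckle Ψ γ ε v w.1.1 w.1.2.1 w.1.2.2 w.2.1.1 w.2.1.2
    * D.speckle Ψ γ ε v w.1.1 w.1.2.1 w.1.2.2 w.2.2.1 w.2.2.2

end Config

/-! ### The limit -/

/-- The scattering distribution `𝒜(v,ω,dp) = ∫ E[exp(iωv(V(y') - V(0)))] exp(-iω p·y') dy'`, the Fourier
transform of a bounded function, in its action on a rapidly decreasing smooth function `φ` of `p`. -/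
def scatteringDist {Ω : Type*} [MeasurableSpace Ω] (P : Measure Ω) (V : Plane → Ω → ℝ)
    (v ω : ℝ) (φ : Plane → ℂ) : ℂ :=
  ∫ y' : Plane, (∫ o, Complex.exp (Complex.I * ((ω * v * (V y' o - V 0 o) : ℝ) : ℂ)) ∂P)
    * ∫ p : Plane, Complex.exp (-Complex.I * ((ω * inner ℝ p y' : ℝ) : ℂ)) * φ p

/-- The action on a test function `Φ` of the distribution
`T² s₀ / (4 s₁ (2π)³) ∬ exp(-iω(s̃₁ - s̃₂ - p·(ỹ₁ - ỹ₂))) 𝒜(s₀ - s₁, ω, dp) |Ψ̂|²₂(ω)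
  δ(s̄ - s_p) δ(ȳ - y_p) ω² dω`. -/
def Config.limitPairing (D : Config) {Ω : Type*} [MeasurableSpace Ω] (P : Measure Ω)
    (V : Plane → Ω → ℝ) (Ψ : ℝ → Plane → ℝ) (Φ : CorrSpace → ℂ) : ℂ :=
  ((D.transCoeff ^ 2 * D.s₀ / (4 * D.s₁ * (2 * Real.pi) ^ 3) : ℝ) : ℂ) *
    ∫ ω : ℝ, ((sourceEnergy Ψ ω * ω ^ 2 : ℝ) : ℂ) *
      scatteringDist P V (D.s₀ - D.s₁) ω (fun p =>
        ∫ r : Plane × (ℝ × Plane) × (ℝ × Plane),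
          Complex.exp (-Complex.I *
            ((ω * (r.2.1.1 - r.2.2.1 - inner ℝ p (r.2.1.2 - r.2.2.2)) : ℝ) : ℂ))
          * Φ ((D.sTr p, D.yTr p, r.1), r.2.1, r.2.2))

end

end RoughInterface

open RoughInterface

/-!
The proof reduces the correlation function, paired with a test function, to the average of a deterministic
integrable kernel against phase increments of the interface profile `V`, and shows that these increments
average out by mixing.

*The transmitted wave.* The quadratic forms of the two propagators are positive definite, hence diagonal in
orthonormal bases (`exists_dispersion_eq_diagOp`). The oscillatory integral over `q` is then a product of
one-dimensional Gaussian integrals, bounded uniformly in the regularization and converging to the Fresnel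
kernel. The profile of the incident wave on the interface has an integrable majorant independent of the
frequency (`exists_integrable_bound_incProfile`), although `Ψ` is merely integrable: because of the band
limitation, the profile is an average, weighted by `Ψ`, of translates of one rapidly decaying kernel. So the
transmitted wave is an absolutely convergent integral `waveField` over the frequency `ω` and the scattering
point `X` (`Config.tendsto_transmittedReg`), in which `V` enters only through a unimodular factor. In the
speckle variables only the ratio `η = ε^(γ - 1/2)` is left, apart from the argument of `V`
(`Config.speckle_eq`).

*Mean and difference variables.* In the product of two waves with frequencies `ω₁`, `ω₂` and scattering points
`X₁`, `X₂`, put `ω₁ = ω`, `ω₂ = -ω + η²ν`, `X₂ = X` and `X₁ = -(ω₂/ω)X + ηY`. The Jacobian `η⁴` compensates the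
factors `η⁻²` of the two waves, and all negative powers of `η` disappear from the phase (`corrPhase_eq`). The
correlation function paired with `Φ` becomes `∫ corrKernel · exp(i(ω θ(X₁) + ω₂ θ(X)))`, where `θ` is the
dephasing by the interface (`integral_waveField_mul_waveField`). Integrations by parts in `s̄` and in `ȳ` give
decay of `corrKernel` in `ν` and in `Y`, uniformly in `η ∈ [0, 1]`, with a constant that is a continuous
seminorm of `Φ` (`exists_seminorm_corrPhase`, `exists_corrKernel_bound`).

*Self-averaging.* As `η → 0` the random phase tends to `ωτ(V(x + Y) - V(x))`, with `τ = s₀ - s₁` and a base point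
`x` that is `X/η` up to a translation. By stationarity the mean of its exponential does not depend on `x`. For
two different points `X` the base points separate, and the `α`-mixing property makes the fluctuations
asymptotically uncorrelated (`norm_covariance_osc_increment_le`, a consequence of the covariance inequality
`abs_integral_mul_le_of_abs_setIntegral_le`). Dominated convergence and Chebyshev's inequality then give
convergence in probability (`tendstoInMeasure_integral_mul`, `tendstoInMeasure_corrKernel`). Every `γ > 1/2`
is treated alike.

*The limit.* At `η = 0` the quadratic phases of the two scattering events cancel. Fourier inversion in `ν`
concentrates the kernel on the paraboloid formed by the points `(s_p, y_p)` (`integral_corrPhase_zero`), and the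
integral over `X` is the energy of the source at frequency `ω`, by the Plancherel identity
(`Config.integral_packet_mul_packet_neg`); this identifies the limit with `Config.limitPairing`
(`Config.integral_corrKernel_eq_limitPairing`). The seminorm bound makes it a tempered distribution
(`exists_temperedDistribution_corrKernel`).

*The Snell law* is a computation with the explicit offset `y_p = (zTr - zInt) c₁ A₁ p`, by means of
`c²s² = 1 - c²|k₀|²` (`Config.tan_thetaTr_div`, `Config.sin_thetaTr_div`, `Config.thetaTr_of_normal`).
-/


namespace RoughInterface

/-! ### Unimodular exponentials and oscillatory integrals -/

/-- The unimodular exponential `exp(i r)`. -/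
noncomputable def osc (r : ℝ) : ℂ := Complex.exp (Complex.I * (r : ℂ))

lemma norm_osc (r : ℝ) : ‖osc r‖ = 1 := by
  rw [osc, mul_comm]; exact Complex.norm_exp_ofReal_mul_I r

lemma osc_zero : osc 0 = 1 := by simp [osc]

lemma osc_add (r s : ℝ) : osc (r + s) = osc r * osc s := by
  simp only [osc, Complex.ofReal_add, mul_add, Complex.exp_add]

lemma exp_neg_I_mul (r : ℝ) : Complex.exp (-Complex.I * (r : ℂ)) = osc (-r) := by
  simp [osc]

lemma exp_I_mul (r : ℝ) : Complex.exp (Complex.I * (r : ℂ)) = osc r := rfl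

lemma conj_osc (r : ℝ) : (starRingEnd ℂ) (osc r) = osc (-r) := by
  simp [osc, ← Complex.exp_conj]

@[fun_prop]
lemma continuous_osc : Continuous osc := by unfold osc; fun_prop

@[fun_prop]
lemma measurable_osc : Measurable osc := continuous_osc.measurable

lemma hasDerivAt_osc (r : ℝ) : HasDerivAt osc (Complex.I * osc r) r := by
  have h1 : HasDerivAt (fun r : ℝ => Complex.I * (r : ℂ)) (Complex.I * 1) r :=
    (Complex.ofRealCLM.hasDerivAt (x := r)).const_mul Complex.I
  exact h1.cexp.congr_deriv (by simp [osc, mul_comm])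

lemma integrable_mul_osc {E : Type*} [MeasurableSpace E] {μ : Measure E} {f : E → ℂ}
    (hf : Integrable f μ) {φ : E → ℝ} (hφ : Measurable φ) :
    Integrable (fun w => f w * osc (φ w)) μ :=
  hf.mul_bdd (c := 1) (measurable_osc.comp hφ).aestronglyMeasurable
    (Eventually.of_forall fun _ => (norm_osc _).le)

lemma norm_integral_mul_osc_le {E : Type*} [MeasurableSpace E] {μ : Measure E} (f : E → ℂ)
    (φ : E → ℝ) : ‖∫ w, f w * osc (φ w) ∂μ‖ ≤ ∫ w, ‖f w‖ ∂μ := by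
  refine (norm_integral_le_integral_norm _).trans (le_of_eq ?_)
  simp [norm_osc]

section Oscillatory

variable {E : Type*} [NormedAddCommGroup E] [NormedSpace ℝ E] [FiniteDimensional ℝ E]
  [MeasurableSpace E] [BorelSpace E] {μ : Measure E} [μ.IsAddHaarMeasure]

open LineDeriv

lemma integrable_schwartz (Φ : 𝓢(E, ℂ)) : Integrable Φ μ := Φ.integrable

/-- Integration by parts in an oscillatory integral. -/
lemma integral_schwartz_mul_osc_lineDeriv (Φ : 𝓢(E, ℂ)) {φ φ' : E → ℝ} (hφ : Continuous φ) {v : E}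
    (hφ' : ∀ w, HasLineDerivAt ℝ φ (φ' w) w v)
    (hint : Integrable (fun w => Φ w * (φ' w : ℂ) * osc (φ w)) μ) :
    ∫ w, Φ w * (φ' w : ℂ) * osc (φ w) ∂μ
      = Complex.I * ∫ w, (∂_{v} Φ : 𝓢(E, ℂ)) w * osc (φ w) ∂μ := by
  have h := integral_bilinear_hasLineDerivAt_right_eq_neg_left_of_integrable (μ := μ)
    (f := Φ) (f' := (∂_{v} Φ : 𝓢(E, ℂ))) (g := fun w => osc (φ w))
    (g' := fun w => Complex.I * ((φ' w : ℂ) * osc (φ w))) (v := v)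
    (B := ContinuousLinearMap.mul ℝ ℂ) ?_ ?_ ?_ ?_ ?_
  · simp only [ContinuousLinearMap.mul_apply'] at h
    have h2 : ∫ w, Φ w * (Complex.I * ((φ' w : ℂ) * osc (φ w))) ∂μ
        = Complex.I * ∫ w, Φ w * (φ' w : ℂ) * osc (φ w) ∂μ := by
      rw [← integral_const_mul]; congr 1; ext w; ring
    rw [h2] at h
    linear_combination (-Complex.I) * h
      + (∫ w, Φ w * (φ' w : ℂ) * osc (φ w) ∂μ) * Complex.I_mul_I
  · exact integrable_mul_osc (∂_{v} Φ : 𝓢(E, ℂ)).integrable hφ.measurable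
  · refine (hint.const_mul Complex.I).congr (Eventually.of_forall fun w => ?_)
    simp only [ContinuousLinearMap.mul_apply']; ring
  · exact integrable_mul_osc Φ.integrable hφ.measurable
  · intro w _
    rw [SchwartzMap.lineDerivOp_apply]
    exact (Φ.differentiable w).lineDifferentiableAt.hasLineDerivAt
  · intro w _
    have h1 := (hφ' w)
    have h2 := HasDerivAt.scomp (0 : ℝ) (hasDerivAt_osc (φ (w + (0 : ℝ) • v))) h1
    refine HasDerivAt.congr_deriv h2 ?_
    simp; ring

/-- Integration by parts for a phase with constant derivative along `v`: a derivative of the test function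
replaces a power of that constant. -/
lemma mul_integral_schwartz_mul_osc (Φ : 𝓢(E, ℂ)) {φ : E → ℝ} (hφ : Continuous φ) {v : E} {c : ℝ}
    (hφ' : ∀ w, HasLineDerivAt ℝ φ c w v) :
    (c : ℂ) * ∫ w, Φ w * osc (φ w) ∂μ
      = Complex.I * ∫ w, (∂_{v} Φ : 𝓢(E, ℂ)) w * osc (φ w) ∂μ := by
  rw [← integral_schwartz_mul_osc_lineDeriv Φ hφ hφ', ← integral_const_mul]
  · congr 1; ext w; ring
  · refine ((integrable_mul_osc (μ := μ) Φ.integrable hφ.measurable).const_mul (c : ℂ)).congr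
      (Eventually.of_forall fun w => ?_)
    simp only; ring

/-- Multiplication of Schwartz functions by a linear functional. -/
noncomputable def mulFunctional (ℓ : E →L[ℝ] ℝ) : 𝓢(E, ℂ) →L[ℂ] 𝓢(E, ℂ) :=
  SchwartzMap.smulLeftCLM ℂ (fun w => ((ℓ w : ℝ) : ℂ))

omit [FiniteDimensional ℝ E] [MeasurableSpace E] [BorelSpace E] in
lemma mulFunctional_apply (ℓ : E →L[ℝ] ℝ) (Φ : 𝓢(E, ℂ)) (w : E) :
    mulFunctional ℓ Φ w = (ℓ w : ℂ) * Φ w := by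
  have h : Function.HasTemperateGrowth fun w => ((ℓ w : ℝ) : ℂ) :=
    (Complex.ofRealCLM.comp ℓ).hasTemperateGrowth
  simp [mulFunctional, SchwartzMap.smulLeftCLM_apply_apply h]

/-- Decay of oscillatory integrals, uniformly over a family of phases `φ i` whose derivative in a fixed
direction is `lam i` plus a combination of fixed linear functionals with coefficients at most `N i`:
each power of `lam i` costs one power of `N i`. -/
lemma exists_seminorm_pow_mul_osc_le {ι J : Type*} [Fintype J] (φ : ι → E → ℝ) (v : E) (lam N : ι → ℝ)
    (c : ι → J → ℝ) (ℓ : J → E →L[ℝ] ℝ) (hφ : ∀ i, Continuous (φ i))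
    (hφ' : ∀ i w, HasLineDerivAt ℝ (φ i) (lam i + ∑ j, c i j * ℓ j w) w v)
    (hN : ∀ i, 1 ≤ N i) (hc : ∀ i j, |c i j| ≤ N i) (k : ℕ) :
    ∃ p : Seminorm ℂ 𝓢(E, ℂ), Continuous p ∧ ∀ (i : ι) (Φ : 𝓢(E, ℂ)),
      |lam i| ^ k * ‖∫ w, Φ w * osc (φ i w) ∂μ‖ ≤ N i ^ k * p Φ := by
  induction k with
  | zero =>
    refine ⟨(normSeminorm ℂ (Lp ℂ 1 μ)).comp
      (SchwartzMap.toLpCLM ℂ ℂ 1 μ : 𝓢(E, ℂ) →L[ℂ] Lp ℂ 1 μ).toLinearMap, ?_, fun i Φ => ?_⟩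
    · exact continuous_norm.comp (SchwartzMap.toLpCLM ℂ ℂ 1 μ).continuous
    · simpa [SchwartzMap.norm_toLp_one] using norm_integral_mul_osc_le (μ := μ) Φ (φ i)
  | succ k ih =>
    obtain ⟨p, hp, hpb⟩ := ih
    let D : 𝓢(E, ℂ) →L[ℂ] 𝓢(E, ℂ) := lineDerivOpCLM ℂ 𝓢(E, ℂ) v
    refine ⟨p.comp D.toLinearMap + ∑ j, p.comp (mulFunctional (ℓ j)).toLinearMap, ?_, fun i Φ => ?_⟩
    · have : ⇑(p.comp D.toLinearMap + ∑ j, p.comp (mulFunctional (ℓ j)).toLinearMap)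
          = fun Φ => p (D Φ) + ∑ j, p (mulFunctional (ℓ j) Φ) := by
        ext Φ
        simp [sum_apply]
      rw [this]
      exact (hp.comp D.continuous).add
        (continuous_finsetSum _ fun j _ => hp.comp (mulFunctional (ℓ j)).continuous)
    · set K : 𝓢(E, ℂ) → ℂ := fun Φ => ∫ w, Φ w * osc (φ i w) ∂μ with hK
      have hintΦ : ∀ Φ : 𝓢(E, ℂ), Integrable (fun w => Φ w * osc (φ i w)) μ :=
        fun Φ => integrable_mul_osc Φ.integrable (hφ i).measurable
      have hexp : ∀ w, Φ w * ((lam i + ∑ j, c i j * ℓ j w : ℝ) : ℂ) * osc (φ i w)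
          = (lam i : ℂ) * (Φ w * osc (φ i w))
            + ∑ j, (c i j : ℂ) * (mulFunctional (ℓ j) Φ w * osc (φ i w)) := by
        intro w
        simp only [mulFunctional_apply]
        push_cast
        rw [mul_add, add_mul, Finset.mul_sum, Finset.sum_mul]
        congr 1
        · ring
        · exact Finset.sum_congr rfl fun j _ => by ring
      have hsum : Integrable (fun w => ∑ j, (c i j : ℂ) * (mulFunctional (ℓ j) Φ w * osc (φ i w))) μ :=
        integrable_finsetSum _ fun j _ => (hintΦ _).const_mul _
      have key : (lam i : ℂ) * K Φ = Complex.I * K (D Φ) - ∑ j, (c i j : ℂ) * K (mulFunctional (ℓ j) Φ) := by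
        have h := integral_schwartz_mul_osc_lineDeriv (μ := μ) Φ (hφ i) (hφ' i) ?_
        · simp_rw [hexp] at h
          rw [integral_add ((hintΦ Φ).const_mul _) hsum, integral_const_mul, integral_finsetSum] at h
          · simp_rw [integral_const_mul] at h
            rw [eq_sub_iff_add_eq]
            exact h
          · exact fun j _ => (hintΦ _).const_mul _
        · simp_rw [hexp]
          exact ((hintΦ Φ).const_mul _).add hsum
      have hNi : 0 ≤ N i := zero_le_one.trans (hN i)
      calc |lam i| ^ (k + 1) * ‖K Φ‖ = |lam i| ^ k * ‖(lam i : ℂ) * K Φ‖ := by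
            rw [norm_mul, Complex.norm_real, Real.norm_eq_abs]; ring
        _ ≤ |lam i| ^ k * (‖K (D Φ)‖ + ∑ j, N i * ‖K (mulFunctional (ℓ j) Φ)‖) := by
            gcongr
            rw [key]
            refine (norm_sub_le _ _).trans (add_le_add (by simp) ((norm_sum_le _ _).trans ?_))
            refine Finset.sum_le_sum fun j _ => ?_
            rw [norm_mul, Complex.norm_real, Real.norm_eq_abs]
            gcongr
            exact hc i j
        _ = |lam i| ^ k * ‖K (D Φ)‖ + ∑ j, N i * (|lam i| ^ k * ‖K (mulFunctional (ℓ j) Φ)‖) := by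
            rw [mul_add, Finset.mul_sum]
            congr 1
            exact Finset.sum_congr rfl fun j _ => by ring
        _ ≤ N i * (N i ^ k * p (D Φ)) + ∑ j, N i * (N i ^ k * p (mulFunctional (ℓ j) Φ)) := by
            refine add_le_add ((hpb i (D Φ)).trans (le_mul_of_one_le_left (by positivity) (hN i))) ?_
            exact Finset.sum_le_sum fun j _ => mul_le_mul_of_nonneg_left (hpb i _) hNi
        _ = N i ^ (k + 1) * (p.comp D.toLinearMap + ∑ j, p.comp (mulFunctional (ℓ j)).toLinearMap) Φ := by
            simp only [add_apply, sum_apply, Seminorm.comp_apply,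
              ContinuousLinearMap.coe_coe, mul_add, Finset.mul_sum]
            congr 1
            · ring
            · exact Finset.sum_congr rfl fun j _ => by ring

end Oscillatory

/-! ### Operators diagonal in an orthonormal basis of the plane -/

/-- The operator with eigenvectors `b i` and eigenvalues `l i`. -/
noncomputable def diagOp (b : OrthonormalBasis (Fin 2) ℝ Plane) (l : Fin 2 → ℝ) : Plane →L[ℝ] Plane :=
  ∑ i, l i • (innerSL ℝ (b i)).smulRight (b i)

section DiagOp

variable (b : OrthonormalBasis (Fin 2) ℝ Plane) (l : Fin 2 → ℝ)

lemma diagOp_apply (x : Plane) : diagOp b l x = ∑ i, (l i * inner ℝ (b i) x) • b i := by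
  simp [diagOp, smul_smul]

lemma inner_basis_diagOp (i : Fin 2) (x : Plane) :
    inner ℝ (b i) (diagOp b l x) = l i * inner ℝ (b i) x := by
  rw [diagOp_apply, inner_sum, Finset.sum_eq_single i]
  · simp [inner_smul_right]
  · intro j _ hj
    rw [inner_smul_right, b.inner_eq_zero hj.symm, mul_zero]
  · simp

lemma inner_diagOp (x y : Plane) :
    inner ℝ x (diagOp b l y) = ∑ i, l i * inner ℝ (b i) x * inner ℝ (b i) y := by
  rw [diagOp_apply, inner_sum]
  refine Finset.sum_congr rfl fun i _ => ?_
  rw [inner_smul_right, real_inner_comm x]; ring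

lemma inner_diagOp_comm (x y : Plane) : inner ℝ x (diagOp b l y) = inner ℝ y (diagOp b l x) := by
  rw [inner_diagOp, inner_diagOp]
  exact Finset.sum_congr rfl fun i _ => by ring

lemma diagOp_inv_apply {l : Fin 2 → ℝ} (hl : ∀ i, l i ≠ 0) (x : Plane) :
    diagOp b l⁻¹ (diagOp b l x) = x := by
  refine b.toBasis.ext_elem (fun i => ?_)
  rw [OrthonormalBasis.coe_toBasis_repr_apply, OrthonormalBasis.coe_toBasis_repr_apply,
    b.repr_apply_apply, b.repr_apply_apply, inner_basis_diagOp, inner_basis_diagOp, Pi.inv_apply,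
    ← mul_assoc, inv_mul_cancel₀ (hl i), one_mul]

lemma det_diagOp : LinearMap.det (diagOp b l).toLinearMap = l 0 * l 1 := by
  rw [← LinearMap.det_toMatrix b.toBasis]
  have : LinearMap.toMatrix b.toBasis b.toBasis (diagOp b l).toLinearMap = Matrix.diagonal l := by
    ext i j
    rw [LinearMap.toMatrix_apply, OrthonormalBasis.coe_toBasis_repr_apply, b.repr_apply_apply,
      OrthonormalBasis.coe_toBasis, ContinuousLinearMap.coe_coe, inner_basis_diagOp]
    by_cases h : i = j
    · subst h; simp
    · rw [b.inner_eq_zero h, Matrix.diagonal_apply_ne _ h, mul_zero]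
  rw [this, Matrix.det_diagonal, Fin.prod_univ_two]

lemma integral_comp_diagOp {l : Fin 2 → ℝ} (hl : ∀ i, 0 < l i) (f : Plane → ℂ) :
    ∫ x, f x = ((l 0 * l 1 : ℝ) : ℂ) * ∫ p, f (diagOp b l p) := by
  have hdet : LinearMap.det (diagOp b l).toLinearMap ≠ 0 := by
    rw [det_diagOp]; exact (mul_pos (hl 0) (hl 1)).ne'
  have hmap := Measure.map_linearMap_addHaar_eq_smul_addHaar (volume : Measure Plane) hdet
  have hl' : ∀ i, (l⁻¹) i ≠ 0 := fun i => inv_ne_zero (hl i).ne'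
  let e : Plane ≃L[ℝ] Plane := ContinuousLinearEquiv.equivOfInverse (diagOp b l) (diagOp b l⁻¹)
    (diagOp_inv_apply b fun i => (hl i).ne')
    (fun x => by simpa using diagOp_inv_apply b hl' x)
  have he : MeasurableEmbedding (diagOp b l).toLinearMap :=
    e.toHomeomorph.measurableEmbedding
  have h := he.integral_map (μ := volume) f
  rw [hmap, integral_smul_measure, det_diagOp, abs_of_pos (inv_pos.2 (mul_pos (hl 0) (hl 1))),
    ENNReal.toReal_ofReal (inv_pos.2 (mul_pos (hl 0) (hl 1))).le, Complex.real_smul] at h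
  simp only [ContinuousLinearMap.coe_coe] at h
  rw [← h, ← mul_assoc, ← Complex.ofReal_mul, mul_inv_cancel₀ (mul_pos (hl 0) (hl 1)).ne']
  simp

/-- A symmetric positive definite operator of the plane is diagonal in an orthonormal basis, with
positive eigenvalues. -/
lemma exists_eq_diagOp (T : Plane →ₗ[ℝ] Plane) (hT : T.IsSymmetric)
    (hpos : ∀ p, p ≠ 0 → 0 < inner ℝ p (T p)) :
    ∃ (b : OrthonormalBasis (Fin 2) ℝ Plane) (l : Fin 2 → ℝ), (∀ i, 0 < l i) ∧
      ∀ p, T p = diagOp b l p := by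
  have hn : Module.finrank ℝ Plane = 2 := by simp
  let b := hT.eigenvectorBasis hn
  let l := hT.eigenvalues hn
  have hb : ∀ i, T (b i) = l i • b i := fun i => hT.apply_eigenvectorBasis hn i
  refine ⟨b, l, fun i => ?_, fun p => ?_⟩
  · have h := hpos (b i) (b.orthonormal.ne_zero i)
    rw [hb, inner_smul_right, real_inner_self_eq_norm_sq, b.norm_eq_one] at h
    simpa using h
  · conv_lhs => rw [← b.sum_repr' p]
    rw [map_sum, diagOp_apply]
    refine Finset.sum_congr rfl fun i _ => ?_
    rw [map_smul, hb, smul_smul, mul_comm]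

end DiagOp

/-! ### The Fresnel kernel -/

/-- The regularized Fresnel integral `∫ exp(-δ|q|²) exp(iω(q·Z - q·Qq/2)) dq`. -/
noncomputable def fresnelReg (b : OrthonormalBasis (Fin 2) ℝ Plane) (l : Fin 2 → ℝ) (δ ω : ℝ) (Z : Plane) : ℂ :=
  ∫ q : Plane, ((Real.exp (-δ * ‖q‖ ^ 2) : ℝ) : ℂ) *
    osc (ω * inner ℝ q Z - ω * inner ℝ q (diagOp b l q) / 2)

/-- The Fresnel kernel `2π / (iω √det Q) · exp(iω Z·Q⁻¹Z / 2)`. -/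
noncomputable def fresnel (b : OrthonormalBasis (Fin 2) ℝ Plane) (l : Fin 2 → ℝ) (ω : ℝ) (Z : Plane) : ℂ :=
  (2 * Real.pi : ℂ) / (Complex.I * ω * (√(l 0 * l 1) : ℝ)) * osc (ω * inner ℝ Z (diagOp b l⁻¹ Z) / 2)

section Fresnel

variable (b : OrthonormalBasis (Fin 2) ℝ Plane) {l : Fin 2 → ℝ}

lemma fresnelReg_eq {δ : ℝ} (hδ : 0 < δ) (ω : ℝ) (Z : Plane) :
    fresnelReg b l δ ω Z = ∏ i, ((Real.pi : ℂ) / (δ + Complex.I * (ω * l i / 2 : ℝ))) ^ (1 / 2 : ℂ) *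
      Complex.exp ((Complex.I * (ω * inner ℝ (b i) Z : ℝ)) ^ 2 / (4 * (δ + Complex.I * (ω * l i / 2 : ℝ)))) := by
  have hb : ∀ i : Fin 2, 0 < ((δ : ℂ) + Complex.I * (ω * l i / 2 : ℝ)).re := by
    intro i
    simpa [-Complex.ofReal_div, -Complex.ofReal_mul] using hδ
  rw [← GaussianFourier.integral_cexp_neg_sum_mul_add hb, fresnelReg,
    ← (b.measurePreserving_repr_symm).integral_comp b.repr.symm.toHomeomorph.measurableEmbedding,
    ← (PiLp.volume_preserving_toLp (Fin 2)).integral_comp (MeasurableEquiv.toLp 2 _).measurableEmbedding]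
  congr 1; ext v
  have h1 : ∀ i, inner ℝ (b i) (b.repr.symm (WithLp.toLp 2 v)) = v i := by
    intro i
    rw [← b.repr_apply_apply]; simp
  have h2 : ‖b.repr.symm (WithLp.toLp 2 v)‖ ^ 2 = ∑ i, v i ^ 2 := by
    rw [LinearIsometryEquiv.norm_map, EuclideanSpace.norm_sq_eq]
    simp
  have h3 : inner ℝ (b.repr.symm (WithLp.toLp 2 v)) Z = ∑ i, v i * inner ℝ (b i) Z := by
    rw [← b.sum_inner_mul_inner]
    refine Finset.sum_congr rfl fun i _ => ?_
    rw [← h1 i, real_inner_comm]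
  rw [h2, inner_diagOp, h3, osc, Complex.ofReal_exp, ← Complex.exp_add]
  simp only [h1, Fin.sum_univ_two]
  congr 1
  push_cast
  ring

/-- The regularized Fresnel integral is bounded uniformly in `δ` and `Z`. -/
lemma norm_fresnelReg_le (hl : ∀ i, 0 < l i) {δ : ℝ} (hδ : 0 < δ) {ω : ℝ} (hω : ω ≠ 0) (Z : Plane) :
    ‖fresnelReg b l δ ω Z‖ ≤ ∏ i, (Real.pi / (|ω| * l i / 2)) ^ (1 / 2 : ℝ) := by
  rw [fresnelReg_eq b hδ, norm_prod]
  refine Finset.prod_le_prod (fun i _ => norm_nonneg _) fun i _ => ?_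
  set B : ℂ := δ + Complex.I * (ω * l i / 2 : ℝ) with hB
  have hBre : B.re = δ := by simp [hB, -Complex.ofReal_div, -Complex.ofReal_mul]
  have hBim : B.im = ω * l i / 2 := by simp [hB, -Complex.ofReal_div, -Complex.ofReal_mul]
  have hpos : 0 < |ω| * l i / 2 := by have := hl i; positivity
  have hBn : |ω| * l i / 2 ≤ ‖B‖ := by
    refine le_trans (le_of_eq ?_) (Complex.abs_im_le_norm B)
    rw [hBim, abs_div, abs_mul, abs_of_pos (hl i)]; simp
  have hB0 : B ≠ 0 := by intro h; rw [h, norm_zero] at hBn; linarith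
  rw [norm_mul, ← mul_one ((Real.pi / (|ω| * l i / 2)) ^ (1 / 2 : ℝ))]
  have e1 : (1 / 2 : ℂ) = ((1 / 2 : ℝ) : ℂ) := by push_cast; rfl
  refine mul_le_mul ?_ ?_ (norm_nonneg _) (by positivity)
  · rw [e1, Complex.norm_cpow_real, norm_div, Complex.norm_real, Real.norm_eq_abs, abs_of_pos Real.pi_pos]
    gcongr
  · rw [Complex.norm_exp, Real.exp_le_one_iff, mul_pow, Complex.I_sq, mul_comm (4 : ℂ) B, ← div_div,
      ← Complex.ofReal_pow, neg_one_mul, ← Complex.ofReal_neg]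
    have : ((((-(ω * inner ℝ (b i) Z) ^ 2 : ℝ) : ℂ)) / B / 4).re
        = -((ω * inner ℝ (b i) Z) ^ 2 * (δ / Complex.normSq B)) / 4 := by
      rw [show (4 : ℂ) = ((4 : ℝ) : ℂ) by simp, Complex.div_ofReal_re, div_eq_mul_inv _ B, Complex.re_ofReal_mul,
        Complex.inv_re, hBre]; ring
    rw [this]
    have := Complex.normSq_nonneg B
    have : 0 ≤ (ω * inner ℝ (b i) Z) ^ 2 * (δ / Complex.normSq B) := by positivity
    linarith

/-- Fresnel's formula, as a limit of Gaussian integrals with complex coefficients. -/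
lemma tendsto_fresnelReg (hl : ∀ i, 0 < l i) {ω : ℝ} (hω : ω ≠ 0) (Z : Plane) :
    Tendsto (fun δ => fresnelReg b l δ ω Z) (𝓝[>] 0) (𝓝 (fresnel b l ω Z)) := by
  have key : fresnel b l ω Z = ∏ i, ((Real.pi : ℂ) / (((0 : ℝ) : ℂ) + Complex.I * (ω * l i / 2 : ℝ))) ^ (1 / 2 : ℂ) *
      Complex.exp ((Complex.I * (ω * inner ℝ (b i) Z : ℝ)) ^ 2 / (4 * (((0 : ℝ) : ℂ) + Complex.I * (ω * l i / 2 : ℝ)))) := by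
    have hω' : (ω : ℂ) ≠ 0 := Complex.ofReal_ne_zero.2 hω
    have hl' : ∀ i, (l i : ℂ) ≠ 0 := fun i => Complex.ofReal_ne_zero.2 (hl i).ne'
    set u : ℂ := 1 / (Complex.I * ω) with hu
    have hu0 : u ≠ 0 := one_div_ne_zero (mul_ne_zero Complex.I_ne_zero hω')
    have hr : ∀ i, 0 < 2 * Real.pi / l i := fun i => div_pos (by positivity) (hl i)
    have e1 : ∀ i, (Real.pi : ℂ) / (((0 : ℝ) : ℂ) + Complex.I * (ω * l i / 2 : ℝ))
        = ((2 * Real.pi / l i : ℝ) : ℂ) * u := by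
      intro i
      have := hl' i
      rw [hu]; push_cast; field_simp; simpa [hω] using (hl i).ne'
    have e2 : ∀ i, (Complex.I * (ω * inner ℝ (b i) Z : ℝ)) ^ 2 /
          (4 * (((0 : ℝ) : ℂ) + Complex.I * (ω * l i / 2 : ℝ)))
        = Complex.I * ((ω * ((l i)⁻¹ * inner ℝ (b i) Z * inner ℝ (b i) Z) / 2 : ℝ) : ℂ) := by
      intro i
      have := hl' i
      push_cast; rw [zero_add]; field_simp; ring
    have e3 : ((√(l 0 * l 1) : ℝ) : ℂ) ≠ 0 :=
      Complex.ofReal_ne_zero.2 (Real.sqrt_pos.2 (mul_pos (hl 0) (hl 1))).ne'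
    -- the two square roots have the same argument, so their product has no branch ambiguity
    have e4 : (((2 * Real.pi / l 0 : ℝ) : ℂ) * u) ^ (1 / 2 : ℂ) * (((2 * Real.pi / l 1 : ℝ) : ℂ) * u) ^ (1 / 2 : ℂ)
        = (2 * Real.pi : ℂ) / (Complex.I * ω * (√(l 0 * l 1) : ℝ)) := by
      have hx : ∀ i, ((2 * Real.pi / l i : ℝ) : ℂ) * u ≠ 0 :=
        fun i => mul_ne_zero (Complex.ofReal_ne_zero.2 (hr i).ne') hu0
      rw [Complex.cpow_def_of_ne_zero (hx 0), Complex.cpow_def_of_ne_zero (hx 1), ← Complex.exp_add,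
        Complex.log_ofReal_mul (hr 0) hu0, Complex.log_ofReal_mul (hr 1) hu0]
      have : (((Real.log (2 * Real.pi / l 0) : ℝ) : ℂ) + Complex.log u) * (1 / 2)
          + (((Real.log (2 * Real.pi / l 1) : ℝ) : ℂ) + Complex.log u) * (1 / 2)
          = (((Real.log (2 * Real.pi / l 0) + Real.log (2 * Real.pi / l 1)) / 2 : ℝ) : ℂ) + Complex.log u := by
        push_cast; ring
      rw [this, Complex.exp_add, Complex.exp_log hu0, ← Complex.ofReal_exp,
        ← Real.log_mul (hr 0).ne' (hr 1).ne', ← Real.log_sqrt (mul_pos (hr 0) (hr 1)).le,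
        Real.exp_log (Real.sqrt_pos.2 (mul_pos (hr 0) (hr 1))), div_mul_div_comm,
        Real.sqrt_div' _ (mul_pos (hl 0) (hl 1)).le, Real.sqrt_mul_self (by positivity), hu]
      push_cast
      field_simp
    simp_rw [e1, e2, exp_I_mul]
    rw [Fin.prod_univ_two, mul_mul_mul_comm, e4, ← osc_add, fresnel, inner_diagOp, Fin.sum_univ_two]
    congr 2
    simp only [Pi.inv_apply]
    ring
  have h : Tendsto (fun δ : ℝ => ∏ i, ((Real.pi : ℂ) / (δ + Complex.I * (ω * l i / 2 : ℝ))) ^ (1 / 2 : ℂ) *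
      Complex.exp ((Complex.I * (ω * inner ℝ (b i) Z : ℝ)) ^ 2 / (4 * (δ + Complex.I * (ω * l i / 2 : ℝ)))))
      (𝓝[>] 0) (𝓝 (fresnel b l ω Z)) := by
    rw [key]
    refine tendsto_finsetProd _ fun i _ => ?_
    have hne : ((0 : ℝ) : ℂ) + Complex.I * (ω * l i / 2 : ℝ) ≠ 0 := by
      have := (hl i).ne'
      simp [hω, this]
    have hlin : ContinuousAt (fun δ : ℝ => (δ : ℂ) + Complex.I * (ω * l i / 2 : ℝ)) 0 := by fun_prop
    refine Tendsto.mono_left (ContinuousAt.tendsto (f := fun δ : ℝ => _) (x := (0 : ℝ)) ?_) nhdsWithin_le_nhds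
    refine ContinuousAt.mul ?_ ?_
    · refine ContinuousAt.cpow (continuousAt_const.div hlin hne) continuousAt_const ?_
      right
      have := (hl i).ne'
      simp [Complex.div_im, Real.pi_ne_zero, hω, this]
    · refine (continuousAt_const.div (continuousAt_const.mul hlin) (mul_ne_zero (by norm_num) hne)).cexp
  refine h.congr' ?_
  filter_upwards [self_mem_nhdsWithin] with δ hδ
  exact (fresnelReg_eq b hδ ω Z).symm

end Fresnel

/-! ### Fourier inversion and the Plancherel identity -/

section Fourier

open FourierTransform

variable {W : Type*} [NormedAddCommGroup W] [InnerProductSpace ℝ W] [FiniteDimensional ℝ W]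
  [MeasurableSpace W] [BorelSpace W]

lemma integral_osc_mul_eq_fourier (f : W → ℂ) (c : ℝ) (x : W) :
    ∫ q, osc (c * inner ℝ q x) * f q = 𝓕 f ((-(c / (2 * Real.pi))) • x) := by
  rw [Real.fourier_eq']
  congr 1; ext q
  rw [smul_eq_mul, osc, inner_smul_right]
  congr 2
  have := Real.pi_ne_zero
  rw [mul_comm]; congr 2
  field_simp

lemma integral_norm_sq_fourier_of_integrable {f : W → ℂ} (hf : Integrable f) (hc : Continuous f)
    (hF : Integrable (𝓕 f)) : ∫ w, ‖𝓕 f w‖ ^ 2 = ∫ q, ‖f q‖ ^ 2 := by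
  have h := VectorFourier.integral_sesq_fourierIntegral_eq_neg_flip (innerSL ℂ (E := ℂ))
    (L := innerₗ W) (μ := volume) (ν := volume) Real.continuous_fourierChar continuous_inner hf hF
  have h1 : VectorFourier.fourierIntegral Real.fourierChar volume (-(innerₗ W).flip) (𝓕 f) = f := by
    rw [flip_innerₗ]
    exact hc.fourierInv_fourier_eq hf hF
  rw [h1] at h
  change ∫ w, inner ℂ (𝓕 f w) (𝓕 f w) = ∫ q, inner ℂ (f q) (f q) at h
  simp_rw [inner_self_eq_norm_sq_to_K] at h
  apply Complex.ofRealLI.injective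
  simpa [← LinearIsometry.integral_comp_comm] using h

/-- Plancherel's identity for the Fourier transform `x ↦ ∫ exp(i c q·x) f(q) dq`. -/
lemma integral_norm_sq_integral_osc {f : W → ℂ} (hf : Integrable f) (hc : Continuous f) {c : ℝ} (hc0 : c ≠ 0)
    (hF : Integrable fun x => ∫ q, osc (c * inner ℝ q x) * f q) :
    ∫ x, ‖∫ q, osc (c * inner ℝ q x) * f q‖ ^ 2
      = (2 * Real.pi / |c|) ^ Module.finrank ℝ W * ∫ q, ‖f q‖ ^ 2 := by
  have hr : -(c / (2 * Real.pi)) ≠ 0 := neg_ne_zero.2 (div_ne_zero hc0 (by positivity))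
  simp_rw [integral_osc_mul_eq_fourier] at hF ⊢
  rw [integrable_comp_smul_iff volume _ hr] at hF
  rw [← integral_norm_sq_fourier_of_integrable hf hc hF,
    Measure.integral_comp_smul volume (fun w => ‖𝓕 f w‖ ^ 2), smul_eq_mul, abs_inv, abs_pow, ← inv_pow]
  congr 2
  rw [abs_neg, abs_div, abs_of_pos (by positivity : 0 < 2 * Real.pi), inv_div]

/-- Fourier inversion on the line. -/
lemma integral_osc_inversion {f : ℝ → ℂ} (hf : Integrable f) (hc : Continuous f)
    (hF : Integrable fun ν : ℝ => ∫ s, osc (-(ν * s)) * f s) (s₀ : ℝ) :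
    ∫ ν : ℝ, osc (ν * s₀) * ∫ s, osc (-(ν * s)) * f s = (2 * Real.pi : ℂ) * f s₀ := by
  have e : ∀ ν : ℝ, ∫ s, osc (-(ν * s)) * f s = 𝓕 f ((2 * Real.pi)⁻¹ * ν) := by
    intro ν
    have := integral_osc_mul_eq_fourier f (-1) ν
    simp only [smul_eq_mul] at this
    rw [show -(-1 / (2 * Real.pi)) * ν = (2 * Real.pi)⁻¹ * ν by ring] at this
    rw [← this]
    congr 1; ext s; simp [mul_comm]
  have hp : (2 * Real.pi)⁻¹ ≠ 0 := by positivity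
  simp_rw [e] at hF ⊢
  rw [integrable_comp_mul_left_iff _ hp] at hF
  have hinv := congrFun (hc.fourierInv_fourier_eq hf hF) s₀
  rw [Real.fourierInv_eq'] at hinv
  have h2 := Measure.integral_comp_mul_left (fun ν : ℝ => osc (2 * Real.pi * ν * s₀) * 𝓕 f ν) (2 * Real.pi)⁻¹
  rw [inv_inv, abs_of_pos (by positivity)] at h2
  have e2 : ∀ ν : ℝ, osc (2 * Real.pi * ((2 * Real.pi)⁻¹ * ν) * s₀) * 𝓕 f ((2 * Real.pi)⁻¹ * ν)
      = osc (ν * s₀) * 𝓕 f ((2 * Real.pi)⁻¹ * ν) := by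
    intro ν
    rw [mul_inv_cancel_left₀ (by positivity)]
  simp_rw [e2] at h2
  rw [h2, ← hinv, Complex.real_smul]
  push_cast
  congr 2; ext ν
  rw [smul_eq_mul, osc]
  congr 2
  rw [mul_comm]; congr 2
  simp; ring

end Fourier

/-! ### The incident wave in the plane of the interface -/

section Source

variable {Ψ : ℝ → Plane → ℝ}

lemma sourceFT_eq (Ψ : ℝ → Plane → ℝ) (ω : ℝ) (k : Plane) :
    sourceFT Ψ ω k = ∫ z : ℝ × Plane, (Ψ z.1 z.2 : ℂ) * osc (ω * (z.1 - inner ℝ k z.2)) := rfl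

lemma continuous_sourceFT (hΨ : Integrable (fun z : ℝ × Plane => Ψ z.1 z.2)) :
    Continuous (fun p : ℝ × Plane => sourceFT Ψ p.1 p.2) := by
  simp_rw [sourceFT_eq]
  refine continuous_of_dominated (bound := fun z => ‖Ψ z.1 z.2‖) (fun p => ?_) (fun p => ?_) hΨ.norm ?_
  · exact (integrable_mul_osc hΨ.ofReal (by fun_prop)).aestronglyMeasurable
  · exact Eventually.of_forall fun z => by simp [norm_osc]
  · exact Eventually.of_forall fun z => by fun_prop

lemma norm_sourceFT_le (Ψ : ℝ → Plane → ℝ) (ω : ℝ) (k : Plane) :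
    ‖sourceFT Ψ ω k‖ ≤ ∫ z : ℝ × Plane, ‖Ψ z.1 z.2‖ := by
  rw [sourceFT_eq]
  refine (norm_integral_mul_osc_le _ _).trans (le_of_eq ?_)
  simp

lemma conj_sourceFT (Ψ : ℝ → Plane → ℝ) (ω : ℝ) (k : Plane) :
    (starRingEnd ℂ) (sourceFT Ψ ω k) = sourceFT Ψ (-ω) k := by
  rw [sourceFT_eq, sourceFT_eq, ← integral_conj]
  simp [conj_osc]

/-- The angular spectrum of the incident wave, propagated down to the interface: the phase
`-ω q·Qq/2` is the one of the paraxial propagator. -/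
noncomputable def incSpectrum (b : OrthonormalBasis (Fin 2) ℝ Plane) (l : Fin 2 → ℝ) (Ψ : ℝ → Plane → ℝ)
    (ω : ℝ) (q : Plane) : ℂ :=
  osc (-(ω * inner ℝ q (diagOp b l q) / 2)) * sourceFT Ψ ω q

/-- The profile of the incident wave on the interface, at frequency `ω`. -/
noncomputable def incProfile (b : OrthonormalBasis (Fin 2) ℝ Plane) (l : Fin 2 → ℝ) (Ψ : ℝ → Plane → ℝ)
    (ω : ℝ) (X : Plane) : ℂ :=
  ∫ q, osc (ω * inner ℝ q X) * incSpectrum b l Ψ ω q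

variable (b : OrthonormalBasis (Fin 2) ℝ Plane) (l : Fin 2 → ℝ)

lemma continuous_incSpectrum (hΨ : Integrable (fun z : ℝ × Plane => Ψ z.1 z.2)) :
    Continuous (fun p : ℝ × Plane => incSpectrum b l Ψ p.1 p.2) := by
  have := continuous_sourceFT hΨ
  unfold incSpectrum
  fun_prop

lemma norm_incSpectrum (ω : ℝ) (q : Plane) : ‖incSpectrum b l Ψ ω q‖ = ‖sourceFT Ψ ω q‖ := by
  rw [incSpectrum, norm_mul, norm_osc, one_mul]

lemma conj_incProfile (ω : ℝ) (X : Plane) :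
    (starRingEnd ℂ) (incProfile b l Ψ ω X) = incProfile b l Ψ (-ω) X := by
  rw [incProfile, incProfile, ← integral_conj]
  congr 1; ext q
  rw [incSpectrum, incSpectrum, map_mul, map_mul, conj_osc, conj_osc, conj_sourceFT]
  congr 2 <;> ring_nf

variable {a β R : ℝ} (hband : ∀ (ω : ℝ) (k : Plane), sourceFT Ψ ω k ≠ 0 → a ≤ |ω| ∧ |ω| ≤ β ∧ ‖k‖ ≤ R)

include hband

lemma norm_incSpectrum_le (ω : ℝ) (q : Plane) :
    ‖incSpectrum b l Ψ ω q‖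
      ≤ (Metric.closedBall (0 : Plane) R).indicator (fun _ => ∫ z : ℝ × Plane, ‖Ψ z.1 z.2‖) q := by
  rw [norm_incSpectrum]
  by_cases hq : q ∈ Metric.closedBall (0 : Plane) R
  · rw [Set.indicator_of_mem hq]; exact norm_sourceFT_le Ψ ω q
  · rw [Set.indicator_of_notMem hq]
    by_contra h
    have h0 : sourceFT Ψ ω q ≠ 0 := by intro h0; simp [h0] at h
    exact hq (by simpa using (hband ω q h0).2.2)

omit hband in
lemma integrable_indicator_closedBall (c : ℝ) :
    Integrable ((Metric.closedBall (0 : Plane) R).indicator (fun _ : Plane => c)) :=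
  (integrableOn_const (measure_closedBall_lt_top).ne).integrable_indicator measurableSet_closedBall

lemma integrable_incSpectrum (hΨ : Integrable (fun z : ℝ × Plane => Ψ z.1 z.2)) (ω : ℝ) :
    Integrable (incSpectrum b l Ψ ω) := by
  refine Integrable.mono' (integrable_indicator_closedBall _) ?_
    (Eventually.of_forall fun q => norm_incSpectrum_le b l hband ω q)
  exact ((continuous_incSpectrum b l hΨ).comp (by fun_prop : Continuous fun q : Plane => (ω, q))).aestronglyMeasurable

lemma continuous_incProfile (hΨ : Integrable (fun z : ℝ × Plane => Ψ z.1 z.2)) :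
    Continuous (fun p : ℝ × Plane => incProfile b l Ψ p.1 p.2) := by
  have hcs := continuous_incSpectrum b l hΨ
  refine continuous_of_dominated (F := fun (p : ℝ × Plane) q => osc (p.1 * inner ℝ q p.2) * incSpectrum b l Ψ p.1 q)
    (fun p => ?_) (fun p => Eventually.of_forall fun q => ?_)
    (integrable_indicator_closedBall (R := R) (∫ z : ℝ × Plane, ‖Ψ z.1 z.2‖))
    (Eventually.of_forall fun q => ?_)
  · have : Continuous fun q : Plane => incSpectrum b l Ψ p.1 q := hcs.comp (by fun_prop : Continuous fun q : Plane => (p.1, q))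
    exact (by fun_prop : Continuous fun q : Plane => osc (p.1 * inner ℝ q p.2) * incSpectrum b l Ψ p.1 q).aestronglyMeasurable
  · rw [norm_mul, norm_osc, one_mul]; exact norm_incSpectrum_le b l hband _ q
  · have : Continuous fun p : ℝ × Plane => incSpectrum b l Ψ p.1 q :=
      hcs.comp (by fun_prop : Continuous fun p : ℝ × Plane => (p.1, q))
    fun_prop

lemma exists_norm_incProfile_le : ∃ M, 0 ≤ M ∧ ∀ ω X, ‖incProfile b l Ψ ω X‖ ≤ M := by
  refine ⟨∫ q, (Metric.closedBall (0 : Plane) R).indicator (fun _ => ∫ z : ℝ × Plane, ‖Ψ z.1 z.2‖) q, ?_,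
    fun ω X => ?_⟩
  · refine integral_nonneg fun q => Set.indicator_nonneg (fun _ _ => integral_nonneg fun _ => norm_nonneg _) _
  · refine norm_integral_le_of_norm_le (integrable_indicator_closedBall _) (Eventually.of_forall fun q => ?_)
    rw [norm_mul, norm_osc, one_mul]; exact norm_incSpectrum_le b l hband _ q

lemma band_of_incProfile_ne_zero {ω : ℝ} {X : Plane} (h : incProfile b l Ψ ω X ≠ 0) : a ≤ |ω| ∧ |ω| ≤ β := by
  by_contra hω
  refine h ?_
  have : ∀ q, sourceFT Ψ ω q = 0 := by
    intro q
    by_contra h0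
    exact hω ⟨(hband ω q h0).1, (hband ω q h0).2.1⟩
  simp [incProfile, incSpectrum, this]

end Source

/-! ### Uniform integrability of the incident profile -/

lemma norm_pow_four_le (b : OrthonormalBasis (Fin 2) ℝ Plane) (Z : Plane) :
    ‖Z‖ ^ 4 ≤ 2 * ∑ i, |inner ℝ (b i) Z| ^ 4 := by
  have h : ‖Z‖ ^ 2 = ∑ i, |inner ℝ (b i) Z| ^ 2 := by
    rw [← b.sum_sq_norm_inner_right Z]; simp
  rw [show ‖Z‖ ^ 4 = (‖Z‖ ^ 2) ^ 2 by ring, h, Fin.sum_univ_two, Fin.sum_univ_two]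
  nlinarith [sq_nonneg (|inner ℝ (b 0) Z| ^ 2 - |inner ℝ (b 1) Z| ^ 2)]

lemma one_add_pow_four_le (r : ℝ) : (1 + r) ^ 4 ≤ 8 * (1 + r ^ 4) := by
  nlinarith [sq_nonneg (r - 1), sq_nonneg (r ^ 2 - 1), sq_nonneg (r * (r - 1)), sq_nonneg ((r - 1) ^ 2)]

lemma integrable_one_add_norm_plane : Integrable (fun Z : Plane => (1 + ‖Z‖) ^ (-4 : ℝ)) :=
  integrable_one_add_norm (by simp; norm_num)

lemma rpow_neg_four {r : ℝ} (hr : 0 ≤ r) : (1 + r) ^ (-4 : ℝ) = ((1 + r) ^ 4)⁻¹ := by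
  rw [Real.rpow_neg (by positivity)]
  norm_cast

/-- Propagated smooth cutoffs are rapidly decaying, uniformly over the frequency band. -/
lemma exists_cutoff_kernel_bound (b : OrthonormalBasis (Fin 2) ℝ Plane) (l : Fin 2 → ℝ) (χ : 𝓢(Plane, ℂ))
    {a : ℝ} (ha : 0 < a) (β : ℝ) :
    ∃ C, 0 ≤ C ∧ ∀ ω : ℝ, a ≤ |ω| → |ω| ≤ β → ∀ Z : Plane,
      ‖∫ q, χ q * osc (ω * inner ℝ q Z - ω * inner ℝ q (diagOp b l q) / 2)‖ ≤ C * (1 + ‖Z‖) ^ (-4 : ℝ) := by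
  have main : ∀ i : Fin 2, ∃ C, 0 ≤ C ∧ ∀ ω : ℝ, |ω| ≤ β → ∀ Z : Plane,
      |ω * inner ℝ (b i) Z| ^ 4 *
        ‖∫ q, χ q * osc (ω * inner ℝ q Z - ω * inner ℝ q (diagOp b l q) / 2)‖ ≤ C := by
    intro i
    have hline : ∀ (j : {ω : ℝ // |ω| ≤ β} × Plane) (q : Plane),
        HasLineDerivAt ℝ (fun q : Plane => j.1.1 * inner ℝ q j.2 - j.1.1 * inner ℝ q (diagOp b l q) / 2)
          (j.1.1 * inner ℝ (b i) j.2 + ∑ _u : Unit, -(j.1.1 * l i) * innerSL ℝ (b i) q) q (b i) := by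
      intro j q
      have h : HasDerivAt (fun t : ℝ => j.1.1 * (inner ℝ q j.2 + t * inner ℝ (b i) j.2)
          - j.1.1 * (inner ℝ q (diagOp b l q) + t * (2 * (l i * inner ℝ (b i) q)) + t * t * l i) / 2)
          (j.1.1 * (0 + 1 * inner ℝ (b i) j.2)
          - j.1.1 * (0 + 1 * (2 * (l i * inner ℝ (b i) q)) + (1 * 0 + 0 * 1) * l i) / 2) 0 := by
        have ht := hasDerivAt_id (0 : ℝ)
        exact ((((hasDerivAt_const _ _).add (ht.mul_const _)).const_mul _)).sub
          (((((hasDerivAt_const _ _).add (ht.mul_const _)).add ((ht.mul ht).mul_const _)).const_mul _).div_const _)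
      refine HasDerivAt.congr_of_eventuallyEq (h.congr_deriv ?_) (Eventually.of_forall fun t => ?_)
      · simp
        ring
      · have e1 : inner ℝ q (diagOp b l (b i)) = l i * inner ℝ (b i) q := by
          rw [inner_diagOp_comm, inner_basis_diagOp]
        have e2 : inner ℝ (b i) (diagOp b l (b i)) = l i := by
          rw [inner_basis_diagOp, real_inner_self_eq_norm_sq, b.norm_eq_one]; simp
        simp only [map_add, map_smul, inner_add_left, inner_add_right, inner_smul_left, inner_smul_right,
          inner_basis_diagOp, e1, e2, RCLike.conj_to_real]
        ring
    obtain ⟨p, -, hp⟩ := exists_seminorm_pow_mul_osc_le (μ := (volume : Measure Plane))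
      (ι := {ω : ℝ // |ω| ≤ β} × Plane) (J := Unit)
      (fun j q => j.1.1 * inner ℝ q j.2 - j.1.1 * inner ℝ q (diagOp b l q) / 2) (b i)
      (fun j => j.1.1 * inner ℝ (b i) j.2) (fun _ => 1 + |β| * |l i|) (fun j _ => -(j.1.1 * l i))
      (fun _ => innerSL ℝ (b i)) (fun j => by fun_prop) hline
      (fun _ => le_add_of_nonneg_right (by positivity)) (fun j _ => by
        rw [abs_neg, abs_mul]
        have := mul_le_mul_of_nonneg_right (j.1.2.trans (le_abs_self β)) (abs_nonneg (l i))
        linarith) 4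
    exact ⟨(1 + |β| * |l i|) ^ 4 * p χ, by positivity, fun ω hω Z => hp (⟨ω, hω⟩, Z) χ⟩
  obtain ⟨C₀, hC₀, h₀⟩ := main 0
  obtain ⟨C₁, hC₁, h₁⟩ := main 1
  refine ⟨8 * ((∫ q, ‖χ q‖) + 2 * (C₀ + C₁) / a ^ 4), ?_, fun ω hωa hωβ Z => ?_⟩
  · have : 0 ≤ ∫ q, ‖χ q‖ := integral_nonneg fun _ => norm_nonneg _
    positivity
  · set κ := ‖∫ q, χ q * osc (ω * inner ℝ q Z - ω * inner ℝ q (diagOp b l q) / 2)‖ with hκ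
    have hk : κ ≤ ∫ q, ‖χ q‖ := norm_integral_mul_osc_le _ _
    have hk0 : 0 ≤ κ := norm_nonneg _
    have h0 := h₀ ω hωβ Z
    have h1 := h₁ ω hωβ Z
    rw [abs_mul, mul_pow] at h0 h1
    have ha4 : a ^ 4 ≤ |ω| ^ 4 := by gcongr
    have e : a ^ 4 * (‖Z‖ ^ 4 * κ) ≤ 2 * (C₀ + C₁) := by
      calc a ^ 4 * (‖Z‖ ^ 4 * κ) ≤ |ω| ^ 4 * ((2 * ∑ i, |inner ℝ (b i) Z| ^ 4) * κ) := by
            gcongr; exact norm_pow_four_le b Z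
        _ = 2 * (|ω| ^ 4 * |inner ℝ (b 0) Z| ^ 4 * κ + |ω| ^ 4 * |inner ℝ (b 1) Z| ^ 4 * κ) := by
            rw [Fin.sum_univ_two]; ring
        _ ≤ _ := by gcongr
    have e' : ‖Z‖ ^ 4 * κ ≤ 2 * (C₀ + C₁) / a ^ 4 := by
      rw [le_div_iff₀ (by positivity)]; linarith
    rw [rpow_neg_four (norm_nonneg Z), ← div_eq_mul_inv, le_div_iff₀ (by positivity)]
    calc κ * (1 + ‖Z‖) ^ 4 ≤ κ * (8 * (1 + ‖Z‖ ^ 4)) := by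
          gcongr; exact one_add_pow_four_le _
      _ = 8 * (κ + ‖Z‖ ^ 4 * κ) := by ring
      _ ≤ _ := by gcongr

section Source

variable {Ψ : ℝ → Plane → ℝ} (b : OrthonormalBasis (Fin 2) ℝ Plane) (l : Fin 2 → ℝ)
  {a β R : ℝ} (hband : ∀ (ω : ℝ) (k : Plane), sourceFT Ψ ω k ≠ 0 → a ≤ |ω| ∧ |ω| ≤ β ∧ ‖k‖ ≤ R)

include hband in
/-- The profiles `X ↦ incProfile ω X` have a common integrable majorant: each of them is the
convolution of (a modulation of) the integrable source with the kernel of a propagated smooth cutoff. -/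
lemma exists_integrable_bound_incProfile (hΨ : Integrable (fun z : ℝ × Plane => Ψ z.1 z.2)) (ha : 0 < a) :
    ∃ G : Plane → ℝ, Integrable G ∧ ∀ ω X, ‖incProfile b l Ψ ω X‖ ≤ G X := by
  -- a smooth cutoff `χ`, equal to one on the spectrum of the source
  let f : ContDiffBump (0 : Plane) := ⟨|R| + 1, |R| + 2, by positivity, by linarith⟩
  let χ : 𝓢(Plane, ℂ) := HasCompactSupport.toSchwartzMap (f := fun q => ((f q : ℝ) : ℂ))
    (f.hasCompactSupport.comp_left Complex.ofReal_zero)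
    (Complex.ofRealCLM.contDiff.comp f.contDiff)
  have hχ : ∀ ω q, χ q * sourceFT Ψ ω q = sourceFT Ψ ω q := by
    intro ω q
    by_cases h : sourceFT Ψ ω q = 0
    · simp [h]
    · have hq := (hband ω q h).2.2
      have : f q = 1 := f.one_of_mem_closedBall (by
        simp only [Metric.mem_closedBall, dist_zero_right, f]
        linarith [le_abs_self R])
      change ((f q : ℝ) : ℂ) * _ = _
      rw [this]; simp
  obtain ⟨C, hC, hk⟩ := exists_cutoff_kernel_bound b l χ ha β
  have hmeas : AEStronglyMeasurable (fun p : Plane × (ℝ × Plane) => ‖Ψ p.2.1 p.2.2‖ * (C * (1 + ‖p.1 - p.2.2‖) ^ (-4 : ℝ)))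
      (volume.prod volume) := by
    refine (hΨ.norm.aestronglyMeasurable.comp_snd).mul (Continuous.aestronglyMeasurable ?_)
    refine continuous_const.mul (Continuous.rpow_const (by fun_prop) fun p => Or.inl ?_)
    positivity
  have hint : Integrable (fun p : Plane × (ℝ × Plane) => ‖Ψ p.2.1 p.2.2‖ * (C * (1 + ‖p.1 - p.2.2‖) ^ (-4 : ℝ)))
      (volume.prod volume) := by
    rw [integrable_prod_iff' hmeas]
    refine ⟨Eventually.of_forall fun z => ?_, ?_⟩
    · exact Integrable.const_mul ((integrable_one_add_norm_plane.comp_sub_right z.2).const_mul C) ‖Ψ z.1 z.2‖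
    · have : ∀ z : ℝ × Plane, ∫ X : Plane, ‖‖Ψ z.1 z.2‖ * (C * (1 + ‖X - z.2‖) ^ (-4 : ℝ))‖
          = ‖Ψ z.1 z.2‖ * (C * ∫ X : Plane, (1 + ‖X‖) ^ (-4 : ℝ)) := by
        intro z
        have : ∀ X : Plane, ‖‖Ψ z.1 z.2‖ * (C * (1 + ‖X - z.2‖) ^ (-4 : ℝ))‖
            = ‖Ψ z.1 z.2‖ * (C * (1 + ‖X - z.2‖) ^ (-4 : ℝ)) := fun X => by
          rw [Real.norm_eq_abs, abs_of_nonneg (by positivity)]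
        simp_rw [this]
        rw [integral_const_mul, integral_const_mul,
          integral_sub_right_eq_self (fun X : Plane => (1 + ‖X‖) ^ (-4 : ℝ)) z.2]
      simp_rw [this]
      exact hΨ.norm.mul_const _
  refine ⟨_, hint.integral_prod_left, fun ω X => ?_⟩
  by_cases h0 : incProfile b l Ψ ω X = 0
  · rw [h0, norm_zero]; exact integral_nonneg fun z => by positivity
  obtain ⟨hωa, hωβ⟩ := band_of_incProfile_ne_zero b l hband h0
  -- exchange the integrals over the direction and over the source variables
  have hrepr : incProfile b l Ψ ω X = ∫ z : ℝ × Plane, ((Ψ z.1 z.2 : ℂ) * osc (ω * z.1)) *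
      ∫ q, χ q * osc (ω * inner ℝ q (X - z.2) - ω * inner ℝ q (diagOp b l q) / 2) := by
    have hF : Integrable (fun p : Plane × (ℝ × Plane) => (χ p.1 * (Ψ p.2.1 p.2.2 : ℂ)) *
        osc (ω * p.2.1 + (ω * inner ℝ p.1 (X - p.2.2) - ω * inner ℝ p.1 (diagOp b l p.1) / 2)))
        (volume.prod volume) :=
      integrable_mul_osc (χ.integrable.mul_prod hΨ.ofReal) (by fun_prop)
    have hswap := integral_integral_swap (f := fun (q : Plane) (z : ℝ × Plane) => (χ q * (Ψ z.1 z.2 : ℂ)) *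
        osc (ω * z.1 + (ω * inner ℝ q (X - z.2) - ω * inner ℝ q (diagOp b l q) / 2))) hF
    calc incProfile b l Ψ ω X = ∫ q, ∫ z : ℝ × Plane, (χ q * (Ψ z.1 z.2 : ℂ)) *
        osc (ω * z.1 + (ω * inner ℝ q (X - z.2) - ω * inner ℝ q (diagOp b l q) / 2)) := by
          rw [incProfile]
          congr 1; ext q
          rw [incSpectrum, ← hχ, sourceFT_eq, ← mul_assoc, ← mul_assoc, ← osc_add, ← integral_const_mul]
          congr 1; ext z
          have : osc (ω * z.1 + (ω * inner ℝ q (X - z.2) - ω * inner ℝ q (diagOp b l q) / 2))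
              = osc (ω * inner ℝ q X + -(ω * inner ℝ q (diagOp b l q) / 2))
                * osc (ω * (z.1 - inner ℝ q z.2)) := by
            rw [← osc_add, inner_sub_right]; congr 1; ring
          rw [this]; ring
      _ = _ := by
          rw [hswap]
          congr 1; ext z
          rw [← integral_const_mul]
          congr 1; ext q
          rw [osc_add]; ring
  rw [hrepr]
  refine (norm_integral_le_integral_norm _).trans (integral_mono_of_nonneg
    (Eventually.of_forall fun _ => norm_nonneg _) ?_ (Eventually.of_forall fun z => ?_))
  · refine hΨ.norm.mul_bdd (c := C * 1) (Continuous.aestronglyMeasurable ?_) (Eventually.of_forall fun z => ?_)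
    · refine continuous_const.mul (Continuous.rpow_const (by fun_prop) fun p => Or.inl ?_)
      positivity
    · rw [Real.norm_eq_abs, abs_of_nonneg (by positivity)]
      gcongr
      exact Real.rpow_le_one_of_one_le_of_nonpos (by simp) (by norm_num)
  · simp only
    rw [norm_mul, norm_mul, norm_osc, mul_one, Complex.norm_real]
    gcongr
    exact hk ω hωa hωβ _

end Source

/-! ### The transmitted wave as an absolutely convergent integral -/

/-- Band-limited amplitudes `w ω X`, continuous, bounded and dominated, uniformly in the frequency `ω`,
by an integrable function of the lateral variable `X`. -/
structure IsWavePacket (w : ℝ → Plane → ℂ) (a β M : ℝ) (G : Plane → ℝ) : Prop where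
  pos : 0 < a
  cont : Continuous fun p : ℝ × Plane => w p.1 p.2
  band : ∀ ω X, w ω X ≠ 0 → a ≤ |ω| ∧ |ω| ≤ β
  bdd : ∀ ω X, ‖w ω X‖ ≤ M
  dom : ∀ ω X, ‖w ω X‖ ≤ G X
  int : Integrable G

namespace IsWavePacket

variable {w : ℝ → Plane → ℂ} {a β M : ℝ} {G : Plane → ℝ} (hw : IsWavePacket w a β M G)
include hw

lemma nonneg (X : Plane) : 0 ≤ G X := (norm_nonneg _).trans (hw.dom 0 X)

lemma nonneg_bdd : 0 ≤ M := (norm_nonneg _).trans (hw.bdd 0 0)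

lemma zero (X : Plane) : w 0 X = 0 := by
  by_contra h
  have := (hw.band 0 X h).1
  rw [abs_zero] at this
  exact absurd hw.pos (not_lt.2 this)

lemma norm_le_indicator (ω : ℝ) (X : Plane) :
    ‖w ω X‖ ≤ (Set.Icc (-β) β).indicator (fun _ => 1) ω * G X := by
  by_cases h : w ω X = 0
  · rw [h, norm_zero]
    exact mul_nonneg (Set.indicator_nonneg (fun _ _ => zero_le_one) _) (hw.nonneg X)
  · have hω : ω ∈ Set.Icc (-β) β := abs_le.1 (hw.band ω X h).2
    rw [Set.indicator_of_mem hω, one_mul]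
    exact hw.dom ω X

lemma continuous_apply (ω : ℝ) : Continuous (w ω) :=
  hw.cont.comp (by fun_prop : Continuous fun X : Plane => (ω, X))

lemma integrable_apply (ω : ℝ) : Integrable (w ω) :=
  hw.int.mono' (hw.continuous_apply ω).aestronglyMeasurable (Eventually.of_forall (hw.dom ω))

lemma integrable : Integrable (fun p : ℝ × Plane => w p.1 p.2) := by
  refine Integrable.mono' (g := fun p : ℝ × Plane => (Set.Icc (-β) β).indicator (fun _ => (1 : ℝ)) p.1 * G p.2)
    ?_ hw.cont.aestronglyMeasurable (Eventually.of_forall fun p => hw.norm_le_indicator p.1 p.2)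
  refine Integrable.mul_prod ?_ hw.int
  exact (integrableOn_const (measure_Icc_lt_top).ne).integrable_indicator measurableSet_Icc

end IsWavePacket

/-- The wave of amplitude `w`, dephased by `exp(iωθ(X))` and diffracted by the Fresnel phase. -/
noncomputable def waveField (b : OrthonormalBasis (Fin 2) ℝ Plane) (l : Fin 2 → ℝ) (w : ℝ → Plane → ℂ)
    (θ : Plane → ℝ) (s : ℝ) (Y : Plane) : ℂ :=
  ∫ ω : ℝ, osc (-(ω * s)) * ∫ X, w ω X * osc (ω * θ X + ω * inner ℝ (Y - X) (diagOp b l⁻¹ (Y - X)) / 2)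

section Reg

variable (b : OrthonormalBasis (Fin 2) ℝ Plane) {l : Fin 2 → ℝ}

lemma integrable_exp_neg_mul_norm_sq {δ : ℝ} (hδ : 0 < δ) :
    Integrable (fun q : Plane => ((Real.exp (-δ * ‖q‖ ^ 2) : ℝ) : ℂ)) := by
  have h := GaussianFourier.integrable_cexp_neg_mul_sq_norm_add_of_euclideanSpace (ι := Fin 2) (b := (δ : ℂ))
    (by simpa using hδ) 0 (0 : Plane)
  refine h.congr (Eventually.of_forall fun q => ?_)
  simp

lemma continuous_fresnelReg {δ : ℝ} (hδ : 0 < δ) :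
    Continuous (fun p : ℝ × Plane => fresnelReg b l δ p.1 p.2) := by
  unfold fresnelReg
  refine continuous_of_dominated (bound := fun q => ‖((Real.exp (-δ * ‖q‖ ^ 2) : ℝ) : ℂ)‖)
    (fun p => ?_) (fun p => ?_) (integrable_exp_neg_mul_norm_sq hδ).norm ?_
  · exact (integrable_mul_osc (integrable_exp_neg_mul_norm_sq hδ) (by fun_prop)).aestronglyMeasurable
  · exact Eventually.of_forall fun q => by rw [norm_mul, norm_osc, mul_one]
  · exact Eventually.of_forall fun q => by fun_prop

/-- The angular-spectrum representation of a regularized diffracted wave. -/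
lemma integral_angular_spectrum (f : Plane → ℂ) (hf : Integrable f) {δ : ℝ} (hδ : 0 < δ) (ω : ℝ) (Y : Plane) :
    ∫ q : Plane, ((Real.exp (-δ * ‖q‖ ^ 2) : ℝ) : ℂ) * osc (ω * inner ℝ q Y - ω * inner ℝ q (diagOp b l q) / 2)
        * ∫ X, osc (-(ω * inner ℝ q X)) * f X
      = ∫ X, f X * fresnelReg b l δ ω (Y - X) := by
  have hF : Integrable (fun p : Plane × Plane => (((Real.exp (-δ * ‖p.1‖ ^ 2) : ℝ) : ℂ) * f p.2) *
      osc (ω * inner ℝ p.1 (Y - p.2) - ω * inner ℝ p.1 (diagOp b l p.1) / 2)) (volume.prod volume) :=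
    integrable_mul_osc ((integrable_exp_neg_mul_norm_sq hδ).mul_prod hf) (by fun_prop)
  have hswap := integral_integral_swap (f := fun q X => (((Real.exp (-δ * ‖q‖ ^ 2) : ℝ) : ℂ) * f X) *
      osc (ω * inner ℝ q (Y - X) - ω * inner ℝ q (diagOp b l q) / 2)) hF
  calc _ = ∫ q : Plane, ∫ X, (((Real.exp (-δ * ‖q‖ ^ 2) : ℝ) : ℂ) * f X) *
      osc (ω * inner ℝ q (Y - X) - ω * inner ℝ q (diagOp b l q) / 2) := by
        congr 1; ext q
        rw [← integral_const_mul]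
        congr 1; ext X
        have : osc (ω * inner ℝ q (Y - X) - ω * inner ℝ q (diagOp b l q) / 2)
            = osc (ω * inner ℝ q Y - ω * inner ℝ q (diagOp b l q) / 2) * osc (-(ω * inner ℝ q X)) := by
          rw [← osc_add, inner_sub_right]; congr 1; ring
        rw [this]; ring
    _ = _ := by
        rw [hswap]
        congr 1; ext X
        rw [fresnelReg, ← integral_const_mul]
        congr 1; ext q
        ring

variable {g : ℝ → Plane → ℂ} {a β M : ℝ} {G : Plane → ℝ}

lemma tendsto_integral_mul_fresnelReg (hg : IsWavePacket g a β M G) (hl : ∀ i, 0 < l i) {θ : Plane → ℝ}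
    (hθ : Continuous θ) (c : ℝ → ℂ) (hc : Continuous c) (Y : Plane) :
    Tendsto (fun δ => ∫ ω : ℝ, c ω * ∫ X, (g ω X * osc (ω * θ X)) * fresnelReg b l δ ω (Y - X)) (𝓝[>] 0)
      (𝓝 (∫ ω : ℝ, c ω * ∫ X, (g ω X * osc (ω * θ X)) * fresnel b l ω (Y - X))) := by
  have hpi := Real.pi_pos
  set F : ℝ → ℝ := fun r => ∏ i, (Real.pi / (r * l i / 2)) ^ (1 / 2 : ℝ) with hF
  have hFa : ∀ ω : ℝ, a ≤ |ω| → F |ω| ≤ F a := by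
    intro ω hω
    have ha := hg.pos
    refine Finset.prod_le_prod (fun i _ => ?_) fun i _ => ?_
    · have := hl i; positivity
    · have := hl i; gcongr
  have hFa0 : 0 ≤ F a := Finset.prod_nonneg fun i _ => by have := hl i; have := hg.pos; positivity
  have hbound : ∀ δ > 0, ∀ ω X, ‖(g ω X * osc (ω * θ X)) * fresnelReg b l δ ω (Y - X)‖ ≤ F a * ‖g ω X‖ := by
    intro δ hδ ω X
    rw [norm_mul, norm_mul, norm_osc, mul_one, mul_comm]
    by_cases h : g ω X = 0
    · simp [h]
    · have hω := (hg.band ω X h).1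
      have hω0 : ω ≠ 0 := by rintro rfl; rw [abs_zero] at hω; exact absurd hg.pos (not_lt.2 hω)
      gcongr
      exact (norm_fresnelReg_le b hl hδ hω0 _).trans (hFa ω hω)
  have hcont : ∀ δ > 0, Continuous fun p : ℝ × Plane => (g p.1 p.2 * osc (p.1 * θ p.2)) * fresnelReg b l δ p.1 (Y - p.2) := by
    intro δ hδ
    have h1 := hg.cont
    have h2 : Continuous fun p : ℝ × Plane => fresnelReg b l δ p.1 (Y - p.2) :=
      (continuous_fresnelReg b (l := l) hδ).comp (by fun_prop : Continuous fun p : ℝ × Plane => (p.1, Y - p.2))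
    fun_prop
  clear_value F
  have hpos : ∀ᶠ δ : ℝ in 𝓝[>] 0, 0 < δ := self_mem_nhdsWithin
  refine tendsto_integral_filter_of_dominated_convergence
    (bound := fun ω => (Set.Icc (-β) β).indicator (fun ω => ‖c ω‖) ω * (F a * ∫ X, G X)) ?_ ?_ ?_ ?_
  · filter_upwards [hpos] with δ hδ
    exact hc.aestronglyMeasurable.mul
      ((hcont δ hδ).stronglyMeasurable.integral_prod_right (ν := volume)).aestronglyMeasurable
  · filter_upwards [hpos] with δ hδ
    refine Eventually.of_forall fun ω => ?_
    by_cases hω : ω ∈ Set.Icc (-β) β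
    · rw [norm_mul, Set.indicator_of_mem hω]
      have h1 : ‖∫ X, (g ω X * osc (ω * θ X)) * fresnelReg b l δ ω (Y - X)‖ ≤ ∫ X, F a * G X :=
        norm_integral_le_of_norm_le (hg.int.const_mul _) (Eventually.of_forall fun X =>
          (hbound δ hδ ω X).trans (mul_le_mul_of_nonneg_left (hg.dom ω X) hFa0))
      rw [integral_const_mul] at h1
      exact mul_le_mul_of_nonneg_left h1 (norm_nonneg _)
    · have h0 : ∀ X, g ω X = 0 := fun X => by
        by_contra h; exact hω (abs_le.1 (hg.band ω X h).2)
      simp [h0, Set.indicator_of_notMem hω]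
  · refine Integrable.mul_const ?_ _
    exact (hc.norm.continuousOn.integrableOn_compact isCompact_Icc).integrable_indicator measurableSet_Icc
  · refine Eventually.of_forall fun ω => Tendsto.const_mul _ ?_
    by_cases hω : ω = 0
    · subst hω; simp [hg.zero]
    refine tendsto_integral_filter_of_dominated_convergence (bound := fun X => F a * G X) ?_ ?_
      (hg.int.const_mul _) ?_
    · filter_upwards [hpos] with δ hδ
      exact ((hcont δ hδ).comp (by fun_prop : Continuous fun X : Plane => (ω, X))).aestronglyMeasurable
    · filter_upwards [hpos] with δ hδ
      exact Eventually.of_forall fun X => (hbound δ hδ ω X).trans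
        (mul_le_mul_of_nonneg_left (hg.dom ω X) hFa0)
    · exact Eventually.of_forall fun X => (tendsto_fresnelReg b hl hω _).const_mul _

end Reg

/-! ### Crossing of the rough interface -/

lemma propagator_eq_osc {c z : ℝ} {k : Plane} {b : OrthonormalBasis (Fin 2) ℝ Plane} {l : Fin 2 → ℝ}
    (h : ∀ q, (z * c) • dispersion c k q = diagOp b l q) (ω : ℝ) (q : Plane) :
    propagator c k ω q z = osc (-(ω * inner ℝ q (diagOp b l q) / 2)) := by
  rw [propagator, exp_neg_I_mul, ← h, inner_smul_right]
  congr 1; ring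

namespace Config

variable (D : Config)

/-- The dephasing of the transmitted wave by the rough interface, per unit frequency. -/
noncomputable def roughPhase (γ ε : ℝ) (v : Plane → ℝ) (X : Plane) : ℝ :=
  (D.s₀ - D.s₁) * v ((ε ^ γ)⁻¹ • (D.xInt + √ε • X))

/-- The amplitude of the transmitted wave: the incident profile multiplied by the transmission
coefficients and the amplitude of the Fresnel kernel. -/
noncomputable def packet (b₀ : OrthonormalBasis (Fin 2) ℝ Plane) (l₀ l : Fin 2 → ℝ) (Ψ : ℝ → Plane → ℝ)
    (ω : ℝ) (X : Plane) : ℂ :=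
  ((D.transCoeff / (2 * (2 * Real.pi) ^ 3) * √(D.s₀ / D.s₁) : ℝ) : ℂ) *
    ((ω : ℂ) ^ 3 / (2 * Real.pi * Complex.I * (√(l 0 * l 1) : ℝ))) * incProfile b₀ l₀ Ψ ω X

variable {Ψ : ℝ → Plane → ℝ} (b₀ b : OrthonormalBasis (Fin 2) ℝ Plane) {l₀ l : Fin 2 → ℝ}

lemma exists_isWavePacket_incProfile (hΨ : Integrable (fun z : ℝ × Plane => Ψ z.1 z.2))
    (hband : HasBandLimitedSpectrum Ψ) : ∃ a β M G, IsWavePacket (incProfile b₀ l₀ Ψ) a β M G := by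
  obtain ⟨a, β, R, ha, h⟩ := hband
  obtain ⟨M, -, hM⟩ := exists_norm_incProfile_le b₀ l₀ h
  obtain ⟨G, hG, hGb⟩ := exists_integrable_bound_incProfile b₀ l₀ h hΨ ha
  exact ⟨a, β, M, G, ha, continuous_incProfile b₀ l₀ h hΨ, fun ω X => band_of_incProfile_ne_zero b₀ l₀ h,
    hM, hGb, hG⟩

lemma exists_isWavePacket_packet (hΨ : Integrable (fun z : ℝ × Plane => Ψ z.1 z.2))
    (hband : HasBandLimitedSpectrum Ψ) : ∃ a β M G, IsWavePacket (D.packet b₀ l₀ l Ψ) a β M G := by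
  obtain ⟨a, β, M, G, h⟩ := exists_isWavePacket_incProfile b₀ (l₀ := l₀) hΨ hband
  set C : ℝ := ‖((D.transCoeff / (2 * (2 * Real.pi) ^ 3) * √(D.s₀ / D.s₁) : ℝ) : ℂ)‖ *
    (|β| ^ 3 / ‖2 * Real.pi * Complex.I * (√(l 0 * l 1) : ℝ)‖) with hC
  have hle : ∀ ω X, ‖D.packet b₀ l₀ l Ψ ω X‖ ≤ C * ‖incProfile b₀ l₀ Ψ ω X‖ := by
    intro ω X
    by_cases h0 : incProfile b₀ l₀ Ψ ω X = 0
    · simp [packet, h0]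
    · rw [packet, norm_mul, norm_mul, norm_div, norm_pow, Complex.norm_real ω, Real.norm_eq_abs ω]
      have : |ω| ≤ |β| := (h.band ω X h0).2.trans (le_abs_self β)
      rw [hC]
      gcongr
  have hC0 : 0 ≤ C := by positivity
  refine ⟨a, β, C * M, fun X => C * G X, h.pos, ?_, fun ω X hne => h.band ω X fun h0 => hne (by simp [packet, h0]),
    fun ω X => (hle ω X).trans (mul_le_mul_of_nonneg_left (h.bdd ω X) hC0),
    fun ω X => (hle ω X).trans (mul_le_mul_of_nonneg_left (h.dom ω X) hC0), h.int.const_mul C⟩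
  have := h.cont
  unfold packet
  fun_prop

/-- The substitution `x' = xInt + √ε X` shows that the scattering operator multiplies the incident profile by
`exp(iωθ(X))`, where `θ` is the dephasing, and goes back to the directions `q`. -/
lemma scatter_eq (hQ₀ : ∀ q, (D.zInt * D.c₀) • dispersion D.c₀ D.k₀ q = diagOp b₀ l₀ q) {ε : ℝ} (hε : 0 < ε)
    (γ : ℝ) (v : Plane → ℝ) (ω : ℝ) (q : Plane) :
    D.scatter γ ε v (D.s₀ - D.s₁) ω (fun q' => propagator D.c₀ D.k₀ ω q' D.zInt * sourceFT Ψ ω q') q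
      = ((ω : ℂ) ^ 2 / (2 * Real.pi) ^ 2) *
        ∫ X, osc (-(ω * inner ℝ q X)) * (incProfile b₀ l₀ Ψ ω X * osc (ω * D.roughPhase γ ε v X)) := by
  have hs : 0 < √ε := Real.sqrt_pos.2 hε
  have hss : √ε * √ε = ε := Real.mul_self_sqrt hε.le
  set h : Plane → ℂ := fun x' =>
    Complex.exp (-Complex.I * ((ω * inner ℝ q (x' - D.xInt) / √ε : ℝ) : ℂ))
    * Complex.exp (Complex.I * ((ω * (D.s₀ - D.s₁) * v ((ε ^ γ)⁻¹ • x') : ℝ) : ℂ))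
    * ∫ q' : Plane, Complex.exp (Complex.I * ((ω * inner ℝ q' (x' - D.xInt) / √ε : ℝ) : ℂ)) *
      (propagator D.c₀ D.k₀ ω q' D.zInt * sourceFT Ψ ω q') with hh
  have h1 : ∫ x', h x' = (ε : ℂ) * ∫ X : Plane, h (D.xInt + √ε • X) := by
    have h2 := Measure.integral_comp_smul volume (fun x => h (D.xInt + x)) (√ε)
    rw [integral_add_left_eq_self h D.xInt] at h2
    rw [h2, finrank_euclideanSpace_fin, sq, hss, abs_of_pos (inv_pos.2 hε), Complex.real_smul, ← mul_assoc,
      ← Complex.ofReal_mul, mul_inv_cancel₀ hε.ne']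
    simp
  have h3 : ∀ X : Plane, h (D.xInt + √ε • X)
      = osc (-(ω * inner ℝ q X)) * (incProfile b₀ l₀ Ψ ω X * osc (ω * D.roughPhase γ ε v X)) := by
    intro X
    have e : ∀ q : Plane, ω * inner ℝ q (D.xInt + √ε • X - D.xInt) / √ε = ω * inner ℝ q X := by
      intro q
      rw [add_sub_cancel_left, inner_smul_right]; field_simp
    simp only [hh, e, exp_neg_I_mul, exp_I_mul, propagator_eq_osc hQ₀]
    rw [incProfile, roughPhase, mul_assoc, mul_assoc ω]
    congr 1
    rw [mul_comm]
    rfl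
  have hε' : (ε : ℂ) ≠ 0 := Complex.ofReal_ne_zero.2 hε.ne'
  have hpi : (Real.pi : ℂ) ≠ 0 := Complex.ofReal_ne_zero.2 Real.pi_ne_zero
  rw [scatter, h1]
  simp_rw [h3]
  rw [← mul_assoc]
  congr 1
  push_cast
  field_simp

/-- After exchange of the integrals over `q` and over the scattering point `X`, the convergence factor acts on
the Fresnel kernel alone. -/
lemma transmittedReg_eq (hQ₀ : ∀ q, (D.zInt * D.c₀) • dispersion D.c₀ D.k₀ q = diagOp b₀ l₀ q)
    (hQ : ∀ p, D.yTr p = diagOp b l p) (hΨ : Integrable (fun z : ℝ × Plane => Ψ z.1 z.2))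
    (hband : HasBandLimitedSpectrum Ψ)
    {ε : ℝ} (hε : 0 < ε) (γ : ℝ) {v : Plane → ℝ} (hv : Continuous v) (t : ℝ) (x : Plane) {δ : ℝ} (hδ : 0 < δ) :
    D.transmittedReg Ψ γ ε v t x δ = ((D.transCoeff / (2 * (2 * Real.pi) ^ 3) * √(D.s₀ / D.s₁) : ℝ) : ℂ) *
      ∫ ω : ℝ, (osc (-(ω * ((t - D.s₀ * D.zInt - D.s₁ * (D.zTr - D.zInt) - inner ℝ x D.k₀) / ε)))
          * ((ω : ℂ) ^ 4 / (2 * Real.pi) ^ 2)) *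
        ∫ X, (incProfile b₀ l₀ Ψ ω X * osc (ω * D.roughPhase γ ε v X)) *
          fresnelReg b l δ ω ((√ε)⁻¹ • (x - D.xObs) - X) := by
  obtain ⟨a, β, M, G, h⟩ := exists_isWavePacket_incProfile b₀ (l₀ := l₀) hΨ hband
  rw [transmittedReg]
  congr 2; ext ω
  have hθ : Continuous (D.roughPhase γ ε v) := by unfold roughPhase; fun_prop
  rw [← integral_angular_spectrum b _ (integrable_mul_osc (h.integrable_apply ω)
    (by fun_prop : Continuous fun X => ω * D.roughPhase γ ε v X).measurable) hδ, ← integral_const_mul]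
  congr 1; ext q
  have hQ' : ∀ q, ((D.zTr - D.zInt) * D.c₁) • dispersion D.c₁ D.k₀ q = diagOp b l q := hQ
  rw [D.scatter_eq b₀ hQ₀ hε, propagator_eq_osc hQ', exp_neg_I_mul, exp_I_mul]
  have e1 : -(ω * (t - D.s₀ * D.zInt - D.s₁ * (D.zTr - D.zInt) - inner ℝ x D.k₀) / ε)
      = -(ω * ((t - D.s₀ * D.zInt - D.s₁ * (D.zTr - D.zInt) - inner ℝ x D.k₀) / ε)) := by ring
  have e2 : osc (ω * inner ℝ q ((√ε)⁻¹ • (x - D.xObs)) - ω * inner ℝ q (diagOp b l q) / 2)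
      = osc (ω * inner ℝ q (x - D.xObs) / √ε) * osc (-(ω * inner ℝ q (diagOp b l q) / 2)) := by
    rw [← osc_add, inner_smul_right]; congr 1; ring
  rw [e1, e2]
  push_cast
  ring

/-- The oscillatory integral defining the transmitted wave converges, and its value is an absolutely
convergent integral. -/
lemma tendsto_transmittedReg (hQ₀ : ∀ q, (D.zInt * D.c₀) • dispersion D.c₀ D.k₀ q = diagOp b₀ l₀ q)
    (hQ : ∀ p, D.yTr p = diagOp b l p) (hl : ∀ i, 0 < l i) (hΨ : Integrable (fun z : ℝ × Plane => Ψ z.1 z.2))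
    (hband : HasBandLimitedSpectrum Ψ)
    {ε : ℝ} (hε : 0 < ε) (γ : ℝ) {v : Plane → ℝ} (hv : Continuous v) (t : ℝ) (x : Plane) :
    Tendsto (D.transmittedReg Ψ γ ε v t x) (𝓝[>] 0)
      (𝓝 (waveField b l (D.packet b₀ l₀ l Ψ) (D.roughPhase γ ε v)
        ((t - D.s₀ * D.zInt - D.s₁ * (D.zTr - D.zInt) - inner ℝ x D.k₀) / ε) ((√ε)⁻¹ • (x - D.xObs)))) := by
  obtain ⟨a, β, M, G, h⟩ := exists_isWavePacket_incProfile b₀ (l₀ := l₀) hΨ hband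
  set T := (t - D.s₀ * D.zInt - D.s₁ * (D.zTr - D.zInt) - inner ℝ x D.k₀) / ε with hT
  set Y := (√ε)⁻¹ • (x - D.xObs) with hY
  have hθ : Continuous (D.roughPhase γ ε v) := by unfold roughPhase; fun_prop
  have key := (tendsto_integral_mul_fresnelReg b h hl hθ
    (fun ω : ℝ => osc (-(ω * T)) * ((ω : ℂ) ^ 4 / (2 * Real.pi) ^ 2)) (by fun_prop) Y).const_mul
    ((D.transCoeff / (2 * (2 * Real.pi) ^ 3) * √(D.s₀ / D.s₁) : ℝ) : ℂ)
  have hlim : ((D.transCoeff / (2 * (2 * Real.pi) ^ 3) * √(D.s₀ / D.s₁) : ℝ) : ℂ) *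
      ∫ ω : ℝ, (osc (-(ω * T)) * ((ω : ℂ) ^ 4 / (2 * Real.pi) ^ 2)) *
        ∫ X, (incProfile b₀ l₀ Ψ ω X * osc (ω * D.roughPhase γ ε v X)) * fresnel b l ω (Y - X)
      = waveField b l (D.packet b₀ l₀ l Ψ) (D.roughPhase γ ε v) T Y := by
    rw [waveField, ← integral_const_mul]
    congr 1; ext ω
    rw [← integral_const_mul, ← integral_const_mul, ← integral_const_mul]
    congr 1; ext X
    by_cases hω : ω = 0
    · subst hω; simp [h.zero, packet]
    have hω' : (ω : ℂ) ≠ 0 := Complex.ofReal_ne_zero.2 hω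
    have hpi : (Real.pi : ℂ) ≠ 0 := Complex.ofReal_ne_zero.2 Real.pi_ne_zero
    have hsq : ((√(l 0 * l 1) : ℝ) : ℂ) ≠ 0 :=
      Complex.ofReal_ne_zero.2 (Real.sqrt_pos.2 (mul_pos (hl 0) (hl 1))).ne'
    have hI := Complex.I_ne_zero
    rw [packet, fresnel, osc_add]
    generalize ((D.transCoeff / (2 * (2 * Real.pi) ^ 3) * √(D.s₀ / D.s₁) : ℝ) : ℂ) = c
    field_simp
  rw [hlim] at key
  refine key.congr' ?_
  filter_upwards [self_mem_nhdsWithin] with δ hδ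
  exact (D.transmittedReg_eq b₀ b hQ₀ hQ hΨ hband hε γ hv t x hδ).symm

end Config

/-! ### Geometry of the paraxial rays -/

section Slowness

variable {c : ℝ} {k : Plane}

lemma one_sub_pos (hc : 0 < c) (hk : ‖k‖ < 1 / c) : 0 < 1 - c ^ 2 * ‖k‖ ^ 2 := by
  have h : c * ‖k‖ < 1 := by rwa [lt_div_iff₀ hc, mul_comm] at hk
  have h0 : 0 ≤ c * ‖k‖ := by positivity
  nlinarith

lemma slowness_pos (hc : 0 < c) (hk : ‖k‖ < 1 / c) : 0 < slowness c k :=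
  div_pos (Real.sqrt_pos.2 (one_sub_pos hc hk)) hc

lemma sq_mul_slowness_sq (hc : 0 < c) (hk : ‖k‖ < 1 / c) :
    c ^ 2 * slowness c k ^ 2 = 1 - c ^ 2 * ‖k‖ ^ 2 := by
  rw [slowness, div_pow, Real.sq_sqrt (one_sub_pos hc hk).le]
  field_simp

lemma norm_sq_plane (p : Plane) : ‖p‖ ^ 2 = p 0 ^ 2 + p 1 ^ 2 := by
  rw [EuclideanSpace.norm_sq_eq]; simp

lemma inner_plane (p q : Plane) : inner ℝ p q = p 0 * q 0 + p 1 * q 1 := by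
  simp [PiLp.inner_apply, mul_comm]

lemma perp_zero (k : Plane) : perp k 0 = -(k 1) := rfl

lemma perp_one (k : Plane) : perp k 1 = k 0 := rfl

lemma dispersion_coord (c : ℝ) (k q : Plane) (i : Fin 2) :
    dispersion c k q i = (1 / (c ^ 3 * slowness c k ^ 3)) *
      (q i - (c ^ 2 * (-(k 1) * q 0 + k 0 * q 1)) * perp k i) := by
  simp [dispersion, inner_plane, perp_zero, perp_one]

/-- The quadratic form of the dispersion matrix, as a sum of squares. -/
lemma inner_dispersion (c : ℝ) (k q : Plane) :
    inner ℝ q (dispersion c k q) = (1 / (c ^ 3 * slowness c k ^ 3)) *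
      ((1 - c ^ 2 * ‖k‖ ^ 2) * ‖q‖ ^ 2 + c ^ 2 * inner ℝ k q ^ 2) := by
  rw [inner_plane, dispersion_coord, dispersion_coord, perp_zero, perp_one, norm_sq_plane, norm_sq_plane,
    inner_plane]
  ring

lemma inner_dispersion_pos (hc : 0 < c) (hk : ‖k‖ < 1 / c) {q : Plane} (hq : q ≠ 0) :
    0 < inner ℝ q (dispersion c k q) := by
  have h1 := one_sub_pos hc hk
  have h2 := slowness_pos hc hk
  have h3 : 0 < ‖q‖ := norm_pos_iff.2 hq
  rw [inner_dispersion]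
  positivity

lemma exists_dispersion_eq_diagOp (hc : 0 < c) (hk : ‖k‖ < 1 / c) {r : ℝ} (hr : 0 < r) :
    ∃ (b : OrthonormalBasis (Fin 2) ℝ Plane) (l : Fin 2 → ℝ), (∀ i, 0 < l i) ∧
      ∀ q, r • dispersion c k q = diagOp b l q := by
  have hcoord : ∀ q i, (r • dispersion c k q) i = r * dispersion c k q i := fun q i => by simp
  let T : Plane →ₗ[ℝ] Plane :=
    { toFun := fun q => r • dispersion c k q
      map_add' := fun x y => by
        ext i
        simp only [hcoord, dispersion_coord, PiLp.add_apply]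
        ring
      map_smul' := fun t x => by
        ext i
        simp only [hcoord, dispersion_coord, PiLp.smul_apply, smul_eq_mul, RingHom.id_apply]
        ring }
  refine exists_eq_diagOp T (fun x y => ?_) (fun p hp => ?_)
  · change inner ℝ (r • dispersion c k x) y = inner ℝ x (r • dispersion c k y)
    simp only [inner_plane, hcoord, dispersion_coord, perp_zero, perp_one]
    ring
  · change 0 < inner ℝ p (r • dispersion c k p)
    rw [inner_smul_right]
    exact mul_pos hr (inner_dispersion_pos hc hk hp)

end Slowness

namespace Config

variable {D : Config} (hc₁ : 0 < D.c₁) (hc : D.c₁ < D.c₀) (hk₀ : ‖D.k₀‖ < 1 / D.c₀)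
  (hzInt : 0 < D.zInt) (hzTr : D.zInt < D.zTr)

include hc₁ hc hk₀

lemma norm_k₀_lt : ‖D.k₀‖ < 1 / D.c₁ := hk₀.trans (one_div_lt_one_div_of_lt hc₁ hc)

lemma s₀_pos : 0 < D.s₀ := slowness_pos (hc₁.trans hc) hk₀

lemma s₁_pos : 0 < D.s₁ := slowness_pos hc₁ (norm_k₀_lt hc₁ hc hk₀)

lemma sq_s₀ : D.c₀ ^ 2 * D.s₀ ^ 2 = 1 - D.c₀ ^ 2 * ‖D.k₀‖ ^ 2 := sq_mul_slowness_sq (hc₁.trans hc) hk₀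

lemma sq_s₁ : D.c₁ ^ 2 * D.s₁ ^ 2 = 1 - D.c₁ ^ 2 * ‖D.k₀‖ ^ 2 :=
  sq_mul_slowness_sq hc₁ (norm_k₀_lt hc₁ hc hk₀)

/-- The phase of the specular ray vanishes at its travel time. -/
lemma tObs_eq : D.tObs = D.s₀ * D.zInt + D.s₁ * (D.zTr - D.zInt) + inner ℝ D.xObs D.k₀ := by
  have h0 := s₀_pos hc₁ hc hk₀
  have h1 := s₁_pos hc₁ hc hk₀
  have e0 := sq_s₀ hc₁ hc hk₀
  have e1 := sq_s₁ hc₁ hc hk₀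
  have hc₀ : 0 < D.c₀ := hc₁.trans hc
  rw [tObs, xObs, xInt, inner_add_left, inner_smul_left, inner_smul_left, real_inner_self_eq_norm_sq]
  simp only [conj_trivial]
  have f0 : D.zInt / (D.c₀ ^ 2 * D.s₀) = D.s₀ * D.zInt + D.zInt / D.s₀ * ‖D.k₀‖ ^ 2 := by
    field_simp
    linear_combination (-D.zInt) * e0
  have f1 : (D.zTr - D.zInt) / (D.c₁ ^ 2 * D.s₁)
      = D.s₁ * (D.zTr - D.zInt) + (D.zTr - D.zInt) / D.s₁ * ‖D.k₀‖ ^ 2 := by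
    field_simp
    linear_combination (-(D.zTr - D.zInt)) * e1
  rw [f0, f1]; ring

include hzTr in
lemma sTr_nonneg (p : Plane) : 0 ≤ D.sTr p := by
  have hk := norm_k₀_lt hc₁ hc hk₀
  have h : 0 ≤ inner ℝ p (dispersion D.c₁ D.k₀ p) := by
    by_cases hp : p = 0
    · simp [hp]
    · exact (inner_dispersion_pos hc₁ hk hp).le
  have := sub_pos.2 hzTr
  rw [sTr]; positivity

/-! ### The generalized Snell law -/

lemma norm_ray_sq_of_ne (hk : D.k₀ ≠ 0) (r : ℝ) (p : Plane) :
    ‖((D.zTr - D.zInt) / D.s₁) • D.k₀ + r • D.yTr p‖ ^ 2 =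
      ((D.zTr - D.zInt) / D.s₁ * ‖D.k₀‖) ^ 2 *
        ((1 + r / ‖D.k₀‖ ^ 2 * inner ℝ p D.k₀ / (D.c₁ ^ 2 * D.s₁ ^ 2)) ^ 2
          + (r / ‖D.k₀‖ ^ 2) ^ 2 * inner ℝ p (perp D.k₀) ^ 2) := by
  have h1 := s₁_pos hc₁ hc hk₀
  have e1 := sq_s₁ hc₁ hc hk₀
  have hn : 0 < ‖D.k₀‖ := norm_pos_iff.2 hk
  have hn2 : 0 < D.k₀ 0 ^ 2 + D.k₀ 1 ^ 2 := by rw [← norm_sq_plane]; positivity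
  have hs : slowness D.c₁ D.k₀ = D.s₁ := rfl
  have hcoord : ∀ i, (((D.zTr - D.zInt) / D.s₁) • D.k₀ + r • D.yTr p) i
      = (D.zTr - D.zInt) / D.s₁ * (D.k₀ i + r / (D.c₁ ^ 2 * D.s₁ ^ 2) *
        (p i - (D.c₁ ^ 2 * (-(D.k₀ 1) * p 0 + D.k₀ 0 * p 1)) * perp D.k₀ i)) := by
    intro i
    simp only [PiLp.add_apply, PiLp.smul_apply, smul_eq_mul, yTr, dispersion_coord, hs]
    field_simp
  rw [norm_sq_plane] at e1
  rw [mul_pow, norm_sq_plane D.k₀, norm_sq_plane, hcoord, hcoord, inner_plane, inner_plane, perp_zero, perp_one]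
  have hr : r = r / (D.c₁ ^ 2 * D.s₁ ^ 2) * (1 - D.c₁ ^ 2 * (D.k₀ 0 ^ 2 + D.k₀ 1 ^ 2)) := by
    rw [← e1]; field_simp
  have e2 : r / (D.k₀ 0 ^ 2 + D.k₀ 1 ^ 2) * (p 0 * D.k₀ 0 + p 1 * D.k₀ 1) / (D.c₁ ^ 2 * D.s₁ ^ 2)
      = r / (D.c₁ ^ 2 * D.s₁ ^ 2) * (p 0 * D.k₀ 0 + p 1 * D.k₀ 1) / (D.k₀ 0 ^ 2 + D.k₀ 1 ^ 2) := by ring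
  rw [e2]
  generalize hu : r / (D.c₁ ^ 2 * D.s₁ ^ 2) = u at hr ⊢
  rw [hr]
  field_simp
  ring

lemma sin_thetaInc_sq : Real.sin D.thetaInc ^ 2 = D.c₀ ^ 2 * ‖D.k₀‖ ^ 2 := by
  have h0 := s₀_pos hc₁ hc hk₀
  have e0 := sq_s₀ hc₁ hc hk₀
  have hc₀ : 0 < D.c₀ := hc₁.trans hc
  rw [thetaInc, Real.sin_sq_arctan]
  field_simp
  linear_combination (-‖D.k₀‖ ^ 2) * e0

lemma sin_thetaInc : Real.sin D.thetaInc = D.c₀ * ‖D.k₀‖ := by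
  have h0 := s₀_pos hc₁ hc hk₀
  have hc₀ : 0 < D.c₀ := hc₁.trans hc
  have h : 0 ≤ Real.sin D.thetaInc := by
    rw [thetaInc, Real.sin_arctan]; positivity
  rw [← Real.sqrt_sq h, sin_thetaInc_sq hc₁ hc hk₀, ← mul_pow, Real.sqrt_sq (by positivity)]

lemma cos_thetaSpec_sq : Real.cos D.thetaSpec ^ 2 = D.c₁ ^ 2 * D.s₁ ^ 2 := by
  have h1 := s₁_pos hc₁ hc hk₀
  have e1 := sq_s₁ hc₁ hc hk₀
  rw [thetaSpec, Real.cos_sq_arctan]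
  field_simp
  linear_combination (-1) * e1

lemma sin_thetaSpec_sq : Real.sin D.thetaSpec ^ 2 = D.c₁ ^ 2 * ‖D.k₀‖ ^ 2 := by
  rw [Real.sin_sq, cos_thetaSpec_sq hc₁ hc hk₀, sq_s₁ hc₁ hc hk₀]; ring

omit hc₁ hc hk₀ in
lemma xObs_sub_xInt : D.xObs - D.xInt = ((D.zTr - D.zInt) / D.s₁) • D.k₀ := by
  rw [xObs, add_sub_cancel_left]

include hzTr

/-- Length of the lateral offset of a transmitted speckle, relative to the specular ray. -/
lemma norm_ray_eq (hk : D.k₀ ≠ 0) (γ ε : ℝ) (p : Plane) :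
    ‖D.xObs - D.xInt + (ε ^ (1 - γ)) • D.yTr p‖ =
      (D.zTr - D.zInt) / D.s₁ * ‖D.k₀‖ * √(D.bigXi γ ε p) := by
  have h1 := s₁_pos hc₁ hc hk₀
  have hz := sub_pos.2 hzTr
  have hc₀ : 0 < D.c₀ := hc₁.trans hc
  have hn : 0 < ‖D.k₀‖ := norm_pos_iff.2 hk
  have hxi : D.xi γ ε = ε ^ (1 - γ) / ‖D.k₀‖ ^ 2 := by
    rw [xi, sin_thetaInc_sq hc₁ hc hk₀]; field_simp
  rw [xObs_sub_xInt, bigXi, hxi, cos_thetaSpec_sq hc₁ hc hk₀, ← Real.sqrt_sq (norm_nonneg _),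
    norm_ray_sq_of_ne hc₁ hc hk₀ hk, Real.sqrt_mul (by positivity), Real.sqrt_sq (by positivity)]

lemma tan_thetaTr_div (hk : D.k₀ ≠ 0) (γ ε : ℝ) (p : Plane) :
    Real.tan (D.thetaTr γ ε p) / Real.tan D.thetaSpec
      = ‖D.xObs - D.xInt + (ε ^ (1 - γ)) • D.yTr p‖ / ‖D.xObs - D.xInt‖ ∧
    Real.tan (D.thetaTr γ ε p) / Real.tan D.thetaSpec = √(D.bigXi γ ε p) := by
  have h1 := s₁_pos hc₁ hc hk₀
  have hz := sub_pos.2 hzTr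
  have hn : 0 < ‖D.k₀‖ := norm_pos_iff.2 hk
  have e : ‖D.xObs - D.xInt‖ = (D.zTr - D.zInt) / D.s₁ * ‖D.k₀‖ := by
    rw [xObs_sub_xInt, norm_smul, Real.norm_eq_abs, abs_of_pos (div_pos hz h1)]
  rw [thetaTr, thetaSpec, Real.tan_arctan, Real.tan_arctan, e, norm_ray_eq hc₁ hc hk₀ hzTr hk]
  constructor <;> field_simp

lemma sin_thetaTr_div (hk : D.k₀ ≠ 0) (γ ε : ℝ) (p : Plane) :
    Real.sin (D.thetaTr γ ε p) / D.c₁ = Real.sin D.thetaInc / D.c₀ + ‖D.k₀‖ *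
      (√(D.bigXi γ ε p / (1 + Real.sin D.thetaSpec ^ 2 * (D.bigXi γ ε p - 1))) - 1) := by
  have h1 := s₁_pos hc₁ hc hk₀
  have hz := sub_pos.2 hzTr
  have e1 := sq_s₁ hc₁ hc hk₀
  have hc₀ : 0 < D.c₀ := hc₁.trans hc
  have hn : 0 < ‖D.k₀‖ := norm_pos_iff.2 hk
  have hX : 0 ≤ D.bigXi γ ε p := by rw [bigXi]; positivity
  rw [thetaTr, norm_ray_eq hc₁ hc hk₀ hzTr hk, sin_thetaInc hc₁ hc hk₀, sin_thetaSpec_sq hc₁ hc hk₀, Real.sin_arctan]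
  generalize D.bigXi γ ε p = Ξ at hX ⊢
  have ex : (D.zTr - D.zInt) / D.s₁ * ‖D.k₀‖ * √Ξ / (D.zTr - D.zInt) = ‖D.k₀‖ * √Ξ / D.s₁ := by
    field_simp
  have ey : 1 + (‖D.k₀‖ * √Ξ / D.s₁) ^ 2
      = (1 + D.c₁ ^ 2 * ‖D.k₀‖ ^ 2 * (Ξ - 1)) / (D.c₁ * D.s₁) ^ 2 := by
    rw [div_pow, mul_pow, Real.sq_sqrt hX]
    field_simp
    linear_combination e1
  have hden : 0 < 1 + D.c₁ ^ 2 * ‖D.k₀‖ ^ 2 * (Ξ - 1) := by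
    have h2 : 0 ≤ D.c₁ ^ 2 * ‖D.k₀‖ ^ 2 * Ξ := by positivity
    have h3 : 0 < D.c₁ ^ 2 * D.s₁ ^ 2 := by positivity
    linarith
  rw [ex, ey, Real.sqrt_div' _ (by positivity), Real.sqrt_sq (by positivity), Real.sqrt_div hX]
  have := Real.sqrt_pos.2 hden
  field_simp
  ring

lemma thetaTr_of_normal (hk : D.k₀ = 0) {γ ε : ℝ} (hε : 0 < ε) (p : Plane) :
    D.thetaTr γ ε p = Real.arctan (ε ^ (1 - γ) * D.c₁ * ‖p‖) := by
  have h1 := s₁_pos hc₁ hc hk₀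
  have hz := sub_pos.2 hzTr
  have e1 := sq_s₁ hc₁ hc hk₀
  rw [hk, norm_zero] at e1
  have hcs : D.c₁ * D.s₁ = 1 := by
    have h : (D.c₁ * D.s₁) ^ 2 = 1 := by rw [mul_pow, e1]; ring
    have h0 : 0 < D.c₁ * D.s₁ := by positivity
    nlinarith
  have hs : slowness D.c₁ D.k₀ = D.s₁ := rfl
  have hp : perp D.k₀ = 0 := by rw [hk]; ext i; fin_cases i <;> simp [perp]
  have hy : D.yTr p = ((D.zTr - D.zInt) * D.c₁) • p := by
    rw [yTr, dispersion, hs, hp, ← mul_pow, hcs]; simp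
  have hx : D.xObs - D.xInt = 0 := by rw [xObs_sub_xInt, hk, smul_zero]
  have he : 0 < ε ^ (1 - γ) := Real.rpow_pos_of_pos hε _
  rw [thetaTr, hx, hy, zero_add, smul_smul, norm_smul, Real.norm_eq_abs, abs_of_pos (by positivity)]
  congr 1
  field_simp

end Config

/-! ### The speckle profile -/

namespace Config

variable (D : Config) {Ψ : ℝ → Plane → ℝ} (b₀ b : OrthonormalBasis (Fin 2) ℝ Plane) {l₀ l : Fin 2 → ℝ}

/-- In the speckle variables the transmitted wave depends on `ε` only through `η = ε^(γ - 1/2)`, apart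
from a translation of the medium. -/
lemma speckle_eq (hc₁ : 0 < D.c₁) (hc : D.c₁ < D.c₀) (hk₀ : ‖D.k₀‖ < 1 / D.c₀)
    (hQ₀ : ∀ q, (D.zInt * D.c₀) • dispersion D.c₀ D.k₀ q = diagOp b₀ l₀ q)
    (hQ : ∀ p, D.yTr p = diagOp b l p) (hl : ∀ i, 0 < l i) (hΨ : Integrable (fun z : ℝ × Plane => Ψ z.1 z.2))
    (hband : HasBandLimitedSpectrum Ψ)
    {ε : ℝ} (hε : 0 < ε) (γ : ℝ) {v : Plane → ℝ} (hv : Continuous v) (sbar : ℝ) (ybar y : Plane) (stil : ℝ)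
    (ytil : Plane) {η : ℝ} (hη : η = ε ^ (γ - 1 / 2)) :
    D.speckle Ψ γ ε v sbar ybar y stil ytil = ((η⁻¹ ^ 2 : ℝ) : ℂ) *
      waveField b l (D.packet b₀ l₀ l Ψ) (fun X => (D.s₀ - D.s₁) * v ((ε ^ γ)⁻¹ • D.xInt + η⁻¹ • X))
        (η⁻¹ ^ 2 * sbar + stil) (η⁻¹ • ybar + y + η • ytil) := by
  have hη0 : 0 < η := hη ▸ Real.rpow_pos_of_pos hε _
  have hs : √ε = ε ^ (1 / 2 : ℝ) := Real.sqrt_eq_rpow ε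
  have hη1 : η⁻¹ = ε ^ (1 / 2 - γ) := by rw [hη, ← Real.rpow_neg hε.le]; congr 1; ring
  have hη2 : η⁻¹ ^ 2 = ε ^ (1 - 2 * γ) := by
    rw [hη1, ← Real.rpow_natCast, ← Real.rpow_mul hε.le]; congr 1; push_cast; ring
  have e1 : (√ε)⁻¹ * ε ^ (1 - γ) = η⁻¹ := by
    rw [hs, hη1, ← Real.rpow_neg hε.le, ← Real.rpow_add hε]; congr 1; ring
  have e2 : (√ε)⁻¹ * ε ^ γ = η := by
    rw [hs, hη, ← Real.rpow_neg hε.le, ← Real.rpow_add hε]; congr 1; ring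
  have e3 : (ε ^ γ)⁻¹ * √ε = η⁻¹ := by
    rw [hs, hη1, ← Real.rpow_neg hε.le, ← Real.rpow_add hε]; congr 1; ring
  have e4 : ε ^ (2 * (1 - γ)) / ε = η⁻¹ ^ 2 := by
    rw [hη2, ← Real.rpow_sub_one hε.ne']; congr 1; ring
  have hsq : (√ε)⁻¹ * √ε = 1 := inv_mul_cancel₀ (Real.sqrt_pos.2 hε).ne'
  rw [speckle, transmitted, (D.tendsto_transmittedReg b₀ b hQ₀ hQ hl hΨ hband hε γ hv _ _).limUnder_eq, hη2]
  congr 2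
  · ext X
    rw [roughPhase, smul_add, smul_smul, e3]
  · rw [tObs_eq hc₁ hc hk₀, ← hη2, ← e4, inner_add_left, inner_add_left, inner_add_left, inner_smul_left,
      inner_smul_left, inner_smul_left, real_inner_comm ybar, real_inner_comm y, real_inner_comm ytil]
    simp only [conj_trivial]
    field_simp
    ring
  · rw [show D.xObs + (ε ^ (1 - γ)) • ybar + √ε • y + (ε ^ γ) • ytil - D.xObs
      = (ε ^ (1 - γ)) • ybar + √ε • y + (ε ^ γ) • ytil by abel, smul_add, smul_add, smul_smul, smul_smul, smul_smul,
      e1, e2, hsq, one_smul]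

end Config

/-! ### The phase of the correlation function -/

/-- The joint phase of the two speckles after rescaling, `ω₁`, `ω₂` being the two frequencies, `X₁`, `X₂`
the two scattering points, `ν = (ω₁ + ω₂) / η²` and `ω₁ η Y = ω₁ X₁ + ω₂ X₂`. It makes sense for `η = 0`. -/
noncomputable def corrPhase (b : OrthonormalBasis (Fin 2) ℝ Plane) (l : Fin 2 → ℝ) (η ω₁ ω₂ ν : ℝ)
    (X₁ X₂ Y : Plane) (c : CorrSpace) : ℝ :=
  -(ν * c.1.1) - ω₁ * c.2.1.1 - ω₂ * c.2.2.1 + ν * inner ℝ c.1.2.1 (diagOp b l⁻¹ c.1.2.1) / 2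
    + inner ℝ ((η * ν) • c.1.2.2 + ω₁ • c.2.1.2 + ω₂ • c.2.2.2 - ω₁ • Y) (diagOp b l⁻¹ c.1.2.1)
    + ω₁ * inner ℝ (c.1.2.2 + η • c.2.1.2 - X₁) (diagOp b l⁻¹ (c.1.2.2 + η • c.2.1.2 - X₁)) / 2
    + ω₂ * inner ℝ (c.1.2.2 + η • c.2.2.2 - X₂) (diagOp b l⁻¹ (c.1.2.2 + η • c.2.2.2 - X₂)) / 2

/-- For `η > 0` the rescaled phase is the sum of the phases of the two waves. -/
lemma corrPhase_eq (b : OrthonormalBasis (Fin 2) ℝ Plane) (l : Fin 2 → ℝ) {η ω₁ ω₂ ν : ℝ} (hη : η ≠ 0)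
    {X₁ X₂ Y : Plane} (hν : ω₁ + ω₂ = η ^ 2 * ν) (hY : ω₁ • X₁ + ω₂ • X₂ = (ω₁ * η) • Y) (c : CorrSpace) :
    corrPhase b l η ω₁ ω₂ ν X₁ X₂ Y c =
      (-(ω₁ * (η⁻¹ ^ 2 * c.1.1 + c.2.1.1)) +
        ω₁ * inner ℝ (η⁻¹ • c.1.2.1 + c.1.2.2 + η • c.2.1.2 - X₁)
          (diagOp b l⁻¹ (η⁻¹ • c.1.2.1 + c.1.2.2 + η • c.2.1.2 - X₁)) / 2) +
      (-(ω₂ * (η⁻¹ ^ 2 * c.1.1 + c.2.2.1)) +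
        ω₂ * inner ℝ (η⁻¹ • c.1.2.1 + c.1.2.2 + η • c.2.2.2 - X₂)
          (diagOp b l⁻¹ (η⁻¹ • c.1.2.1 + c.1.2.2 + η • c.2.2.2 - X₂)) / 2) := by
  obtain ⟨⟨sb, yb, y⟩, ⟨s1, y1⟩, s2, y2⟩ := c
  have hexp : ∀ Z : Plane, inner ℝ (η⁻¹ • yb + Z) (diagOp b l⁻¹ (η⁻¹ • yb + Z))
      = η⁻¹ ^ 2 * inner ℝ yb (diagOp b l⁻¹ yb) + 2 * (η⁻¹ * inner ℝ Z (diagOp b l⁻¹ yb))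
        + inner ℝ Z (diagOp b l⁻¹ Z) := by
    intro Z
    simp only [map_add, map_smul, inner_add_left, inner_add_right, inner_smul_left, inner_smul_right,
      conj_trivial, inner_diagOp_comm b l⁻¹ yb Z]
    ring
  have a1 : η⁻¹ • yb + y + η • y1 - X₁ = η⁻¹ • yb + (y + η • y1 - X₁) := by abel
  have a2 : η⁻¹ • yb + y + η • y2 - X₂ = η⁻¹ • yb + (y + η • y2 - X₂) := by abel
  have hlin : (η * ν) • y + ω₁ • y1 + ω₂ • y2 - ω₁ • Y
      = (ω₁ * η⁻¹) • (y + η • y1 - X₁) + (ω₂ * η⁻¹) • (y + η • y2 - X₂) := by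
    have h1 : ω₁ • Y = η⁻¹ • (ω₁ • X₁ + ω₂ • X₂) := by
      rw [hY, smul_smul]; congr 1; field_simp
    have h2 : η * ν = (ω₁ + ω₂) * η⁻¹ := by rw [hν]; field_simp
    rw [h1, h2]
    simp only [smul_add, smul_sub, smul_smul, mul_assoc, inv_mul_cancel₀ hη, mul_one, add_mul, add_smul, mul_comm η⁻¹]
    abel
  simp only [corrPhase]
  rw [hlin, a1, a2, hexp, hexp, inner_add_left, inner_smul_left, inner_smul_left]
  simp only [conj_trivial]
  have h3 : ν = (ω₁ + ω₂) * η⁻¹ ^ 2 := by rw [hν]; field_simp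
  rw [h3]
  ring

lemma continuous_corrPhase (b : OrthonormalBasis (Fin 2) ℝ Plane) (l : Fin 2 → ℝ) :
    Continuous fun p : (ℝ × ℝ × ℝ × ℝ × Plane × Plane × Plane) × CorrSpace =>
      corrPhase b l p.1.1 p.1.2.1 p.1.2.2.1 p.1.2.2.2.1 p.1.2.2.2.2.1 p.1.2.2.2.2.2.1 p.1.2.2.2.2.2.2 p.2 := by
  unfold corrPhase
  fun_prop

lemma continuous_corrPhase_apply (b : OrthonormalBasis (Fin 2) ℝ Plane) (l : Fin 2 → ℝ) (η ω₁ ω₂ ν : ℝ)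
    (X₁ X₂ Y : Plane) : Continuous (corrPhase b l η ω₁ ω₂ ν X₁ X₂ Y) := by
  unfold corrPhase
  fun_prop

lemma hasLineDerivAt_corrPhase_time (b : OrthonormalBasis (Fin 2) ℝ Plane) (l : Fin 2 → ℝ) (η ω₁ ω₂ ν : ℝ)
    (X₁ X₂ Y : Plane) (c : CorrSpace) :
    HasLineDerivAt ℝ (corrPhase b l η ω₁ ω₂ ν X₁ X₂ Y) (-ν) c ((1, 0, 0), 0, 0) := by
  have h : HasDerivAt (fun t : ℝ => corrPhase b l η ω₁ ω₂ ν X₁ X₂ Y c + t * (-ν)) (0 + 1 * (-ν)) 0 :=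
    (hasDerivAt_const _ _).add ((hasDerivAt_id (0 : ℝ)).mul_const _)
  refine (h.congr_deriv (by ring)).congr_of_eventuallyEq (Eventually.of_forall fun t => ?_)
  simp [corrPhase]
  ring

/-- The coordinate functionals occurring in the `ȳ`-derivative of the phase. -/
noncomputable def corrFunctional (e : Plane) : Fin 4 → CorrSpace →L[ℝ] ℝ :=
  ![(innerSL ℝ e).comp ((ContinuousLinearMap.fst ℝ Plane Plane).comp
      ((ContinuousLinearMap.snd ℝ ℝ (Plane × Plane)).comp (ContinuousLinearMap.fst ℝ _ _))),
    (innerSL ℝ e).comp ((ContinuousLinearMap.snd ℝ Plane Plane).comp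
      ((ContinuousLinearMap.snd ℝ ℝ (Plane × Plane)).comp (ContinuousLinearMap.fst ℝ _ _))),
    (innerSL ℝ e).comp ((ContinuousLinearMap.snd ℝ ℝ Plane).comp
      ((ContinuousLinearMap.fst ℝ (ℝ × Plane) (ℝ × Plane)).comp (ContinuousLinearMap.snd ℝ _ _))),
    (innerSL ℝ e).comp ((ContinuousLinearMap.snd ℝ ℝ Plane).comp
      ((ContinuousLinearMap.snd ℝ (ℝ × Plane) (ℝ × Plane)).comp (ContinuousLinearMap.snd ℝ _ _)))]

lemma hasLineDerivAt_corrPhase_space (b : OrthonormalBasis (Fin 2) ℝ Plane) {l : Fin 2 → ℝ} (hl : ∀ i, l i ≠ 0)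
    (i : Fin 2) (η ω₁ ω₂ ν : ℝ) (X₁ X₂ Y : Plane) (c : CorrSpace) :
    HasLineDerivAt ℝ (corrPhase b l η ω₁ ω₂ ν X₁ X₂ Y)
      (-(ω₁ * inner ℝ (b i) Y) + ∑ j, (![ν, η * ν, ω₁, ω₂] : Fin 4 → ℝ) j * corrFunctional (b i) j c) c
      ((0, l i • b i, 0), 0, 0) := by
  set Z := (η * ν) • c.1.2.2 + ω₁ • c.2.1.2 + ω₂ • c.2.2.2 - ω₁ • Y with hZ
  have h : HasDerivAt (fun t : ℝ => corrPhase b l η ω₁ ω₂ ν X₁ X₂ Y c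
      + t * (ν * inner ℝ (b i) c.1.2.1 + inner ℝ (b i) Z) + t * t * (ν * l i / 2))
      (0 + 1 * (ν * inner ℝ (b i) c.1.2.1 + inner ℝ (b i) Z) + (1 * 0 + 0 * 1) * (ν * l i / 2)) 0 := by
    have ht := hasDerivAt_id (0 : ℝ)
    exact ((hasDerivAt_const _ _).add (ht.mul_const _)).add ((ht.mul ht).mul_const _)
  have e0 : ∀ x : Plane, inner ℝ x (diagOp b l⁻¹ (b i)) = (l i)⁻¹ * inner ℝ (b i) x := by
    intro x; rw [inner_diagOp_comm, inner_basis_diagOp]; rfl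
  have e1 : inner ℝ (b i) (b i) = (1 : ℝ) := by rw [real_inner_self_eq_norm_sq, b.norm_eq_one]; norm_num
  refine (h.congr_deriv ?_).congr_of_eventuallyEq (Eventually.of_forall fun t => ?_)
  · simp [hZ, corrFunctional, Fin.sum_univ_four, inner_add_right, inner_sub_right, inner_smul_right]
    ring
  · have hi := hl i
    simp only [corrPhase, Prod.fst_add, Prod.snd_add, Prod.smul_fst, Prod.smul_snd, smul_zero, add_zero, ← hZ,
      map_add, map_smul, inner_add_right, inner_add_left, inner_smul_left, inner_smul_right, e0, e1, conj_trivial,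
      inner_basis_diagOp, Pi.inv_apply]
    field_simp
    ring

/-! ### Uniform bounds for the correlation kernel -/

instance isAddHaarMeasure_corrSpace : (volume : Measure CorrSpace).IsAddHaarMeasure := by
  have h1 : (volume : Measure (Plane × Plane)).IsAddHaarMeasure := Measure.prod.instIsAddHaarMeasure _ _
  have h2 : (volume : Measure (ℝ × Plane × Plane)).IsAddHaarMeasure := Measure.prod.instIsAddHaarMeasure _ _
  have h3 : (volume : Measure (ℝ × Plane)).IsAddHaarMeasure := Measure.prod.instIsAddHaarMeasure _ _
  have h4 : (volume : Measure ((ℝ × Plane) × (ℝ × Plane))).IsAddHaarMeasure := Measure.prod.instIsAddHaarMeasure _ _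
  exact Measure.prod.instIsAddHaarMeasure _ _

open LineDeriv in
/-- Decay of the pairing of a test function with the rescaled phase, in the difference frequency `ν` (by
integrations by parts in `s̄`) and in the separation `Y` (by integrations by parts in `ȳ`), uniformly in
`η ∈ [0,1]`. -/
lemma exists_seminorm_corrPhase (b : OrthonormalBasis (Fin 2) ℝ Plane) {l : Fin 2 → ℝ} (hl : ∀ i, 0 < l i) (β : ℝ) :
    ∃ p : Seminorm ℂ 𝓢(CorrSpace, ℂ), Continuous p ∧ ∀ (Φ : 𝓢(CorrSpace, ℂ)) (η ω₁ ω₂ ν : ℝ) (X₁ X₂ Y : Plane),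
      0 ≤ η → η ≤ 1 → |ω₁| ≤ β → |ω₂| ≤ β →
      (1 + ν ^ 2) * (1 + (|ω₁| * ‖Y‖) ^ 4) * ‖∫ c, Φ c * osc (corrPhase b l η ω₁ ω₂ ν X₁ X₂ Y c)‖ ≤ p Φ := by
  -- the admissible parameters
  let ι := {q : ℝ × ℝ × ℝ × ℝ × Plane × Plane × Plane // 0 ≤ q.1 ∧ q.1 ≤ 1 ∧ |q.2.1| ≤ β ∧ |q.2.2.1| ≤ β}
  let φ : ι → CorrSpace → ℝ := fun q => corrPhase b l q.1.1 q.1.2.1 q.1.2.2.1 q.1.2.2.2.1 q.1.2.2.2.2.1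
    q.1.2.2.2.2.2.1 q.1.2.2.2.2.2.2
  have hφ : ∀ q, Continuous (φ q) := fun q => continuous_corrPhase_apply b l _ _ _ _ _ _ _
  let N : ι → ℝ := fun q => (1 + |β|) * (1 + |q.1.2.2.2.1|)
  have hN : ∀ q, 1 ≤ N q := fun q => by
    have h1 := abs_nonneg β; have h2 := abs_nonneg q.1.2.2.2.1
    simp only [N]; nlinarith [mul_nonneg h1 h2]
  have key : ∀ (i : Fin 2) (k : ℕ), ∃ p : Seminorm ℂ 𝓢(CorrSpace, ℂ), Continuous p ∧ ∀ (q : ι) (Φ : 𝓢(CorrSpace, ℂ)),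
      |-(q.1.2.1 * inner ℝ (b i) q.1.2.2.2.2.2.2)| ^ k * ‖∫ c, Φ c * osc (φ q c)‖ ≤ N q ^ k * p Φ := by
    intro i k
    have hc : ∀ (q : ι) (j : Fin 4), |(![q.1.2.2.2.1, q.1.1 * q.1.2.2.2.1, q.1.2.1, q.1.2.2.1] : Fin 4 → ℝ) j| ≤ N q := by
      intro q j
      have h1 := abs_nonneg β; have h2 := abs_nonneg q.1.2.2.2.1
      have h12 := mul_nonneg h1 h2
      obtain ⟨q, hη0, hη1, hω₁, hω₂⟩ := q
      have hβ := le_abs_self β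
      simp only [N] at *
      fin_cases j
      · simp; nlinarith
      · simp only [Fin.mk_one, Fin.isValue, Matrix.cons_val_one, Matrix.cons_val_zero]
        rw [abs_mul, abs_of_nonneg hη0]
        nlinarith [mul_le_mul_of_nonneg_right hη1 h2]
      · simp; nlinarith
      · simp; nlinarith
    exact exists_seminorm_pow_mul_osc_le (μ := (volume : Measure CorrSpace)) φ ((0, l i • b i, 0), 0, 0)
      (fun q => -(q.1.2.1 * inner ℝ (b i) q.1.2.2.2.2.2.2)) N
      (fun q => ![q.1.2.2.2.1, q.1.1 * q.1.2.2.2.1, q.1.2.1, q.1.2.2.1]) (corrFunctional (b i)) hφ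
      (fun q c => hasLineDerivAt_corrPhase_space b (fun j => (hl j).ne') i _ _ _ _ _ _ _ c) hN hc k
  obtain ⟨p₀, hp₀, h₀⟩ := key 0 0
  obtain ⟨p₁, hp₁, h₁⟩ := key 0 4
  obtain ⟨p₂, hp₂, h₂⟩ := key 1 4
  let D : 𝓢(CorrSpace, ℂ) →L[ℂ] 𝓢(CorrSpace, ℂ) := lineDerivOpCLM ℂ 𝓢(CorrSpace, ℂ) (((1, 0, 0), 0, 0) : CorrSpace)
  have hD : ∀ (q : ι) (Φ : 𝓢(CorrSpace, ℂ)),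
      |q.1.2.2.2.1| * ‖∫ c, Φ c * osc (φ q c)‖ = ‖∫ c, (D Φ) c * osc (φ q c)‖ := by
    intro q Φ
    have h := mul_integral_schwartz_mul_osc (μ := (volume : Measure CorrSpace)) Φ (hφ q) (c := -q.1.2.2.2.1)
      (fun c => hasLineDerivAt_corrPhase_time b l _ _ _ _ _ _ _ c)
    have h' := congrArg norm h
    rw [norm_mul, norm_mul, Complex.norm_I, one_mul, Complex.norm_real, norm_neg, Real.norm_eq_abs] at h'
    exact h'
  have hD6 : ∀ (q : ι) (Φ : 𝓢(CorrSpace, ℂ)),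
      |q.1.2.2.2.1| ^ 6 * ‖∫ c, Φ c * osc (φ q c)‖ = ‖∫ c, (D (D (D (D (D (D Φ)))))) c * osc (φ q c)‖ := by
    intro q Φ
    rw [← hD, ← hD, ← hD, ← hD, ← hD, ← hD]; ring
  let D6 : 𝓢(CorrSpace, ℂ) →L[ℂ] 𝓢(CorrSpace, ℂ) := D.comp (D.comp (D.comp (D.comp (D.comp D))))
  have hD6' : ∀ (q : ι) (Φ : 𝓢(CorrSpace, ℂ)),
      |q.1.2.2.2.1| ^ 6 * ‖∫ c, Φ c * osc (φ q c)‖ = ‖∫ c, (D6 Φ) c * osc (φ q c)‖ := hD6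
  let C : NNReal := ⟨24 * (1 + |β|) ^ 4, by positivity⟩
  let P : Seminorm ℂ 𝓢(CorrSpace, ℂ) := p₀ + ((2 : NNReal) • p₁ + (2 : NNReal) • p₂)
  have hPv : ∀ Φ, P Φ = p₀ Φ + (2 * p₁ Φ + 2 * p₂ Φ) := fun Φ => rfl
  have hPc : Continuous P := by
    have : ⇑P = fun Φ => p₀ Φ + (2 * p₁ Φ + 2 * p₂ Φ) := funext hPv
    rw [this]; fun_prop
  have hQv : ∀ Φ, (C • (P + P.comp D6.toLinearMap)) Φ = 24 * (1 + |β|) ^ 4 * (P Φ + P (D6 Φ)) := fun Φ => rfl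
  refine ⟨C • (P + P.comp D6.toLinearMap), ?_, fun Φ η ω₁ ω₂ ν X₁ X₂ Y hη0 hη1 hω₁ hω₂ => ?_⟩
  · have : ⇑(C • (P + P.comp D6.toLinearMap)) = fun Φ => 24 * (1 + |β|) ^ 4 * (P Φ + P (D6 Φ)) := funext hQv
    rw [this]
    exact continuous_const.mul (hPc.add (hPc.comp D6.continuous))
  · let q : ι := ⟨(η, ω₁, ω₂, ν, X₁, X₂, Y), hη0, hη1, hω₁, hω₂⟩
    have hβ : 1 ≤ 1 + |β| := by linarith [abs_nonneg β]
    have hν : 1 ≤ 1 + |ν| := by linarith [abs_nonneg ν]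
    -- decay in `Y`, at the cost of a power of `ν`
    have hY : ∀ Φ, (1 + (|ω₁| * ‖Y‖) ^ 4) * ‖∫ c, Φ c * osc (φ q c)‖ ≤ ((1 + |β|) * (1 + |ν|)) ^ 4 * P Φ := by
      intro Φ
      have e0 := h₀ q Φ
      have e1 := h₁ q Φ
      have e2 := h₂ q Φ
      have hNq : N q = (1 + |β|) * (1 + |ν|) := rfl
      simp only [pow_zero, one_mul, hNq, abs_neg, abs_mul, mul_pow |_| |_|] at e0 e1 e2
      change _ ≤ _ at e0
      have hone : 1 ≤ ((1 + |β|) * (1 + |ν|)) ^ 4 := one_le_pow₀ (one_le_mul_of_one_le_of_one_le hβ hν)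
      have hp0 : 0 ≤ p₀ Φ := apply_nonneg _ _
      have e3 : (|ω₁| * ‖Y‖) ^ 4 ≤ |ω₁| ^ 4 * (2 * ∑ i, |inner ℝ (b i) Y| ^ 4) := by
        rw [mul_pow]; gcongr; exact norm_pow_four_le b Y
      set K := ‖∫ c, Φ c * osc (φ q c)‖ with hK
      have hK0 : 0 ≤ K := norm_nonneg _
      calc (1 + (|ω₁| * ‖Y‖) ^ 4) * K ≤ (1 + |ω₁| ^ 4 * (2 * ∑ i, |inner ℝ (b i) Y| ^ 4)) * K := by gcongr
        _ = K + (2 * (|ω₁| ^ 4 * |inner ℝ (b 0) Y| ^ 4 * K) + 2 * (|ω₁| ^ 4 * |inner ℝ (b 1) Y| ^ 4 * K)) := by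
            rw [Fin.sum_univ_two]; ring
        _ ≤ p₀ Φ + (2 * (((1 + |β|) * (1 + |ν|)) ^ 4 * p₁ Φ) + 2 * (((1 + |β|) * (1 + |ν|)) ^ 4 * p₂ Φ)) := by
            rw [mul_pow (1 + |β|)] at *
            gcongr
        _ ≤ _ := by rw [hPv]; nlinarith [mul_le_mul_of_nonneg_right hone hp0]
    have hY1 := hY Φ
    have hY2 := hY (D6 Φ)
    have hd : |ν| ^ 6 * ‖∫ c, Φ c * osc (φ q c)‖ = ‖∫ c, (D6 Φ) c * osc (φ q c)‖ := hD6' q Φ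
    rw [← hd] at hY2
    change (1 + ν ^ 2) * (1 + (|ω₁| * ‖Y‖) ^ 4) * ‖∫ c, Φ c * osc (φ q c)‖ ≤ _
    rw [hQv]
    set K := ‖∫ c, Φ c * osc (φ q c)‖ with hK
    have hK0 : 0 ≤ K := norm_nonneg _
    set A := (1 + (|ω₁| * ‖Y‖) ^ 4) * K with hA
    have hA0 : 0 ≤ A := by positivity
    have hsum : (1 + |ν| ^ 6) * A ≤ ((1 + |β|) * (1 + |ν|)) ^ 4 * (P Φ + P (D6 Φ)) := by
      have : (1 + (|ω₁| * ‖Y‖) ^ 4) * (|ν| ^ 6 * K) = |ν| ^ 6 * A := by rw [hA]; ring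
      rw [this] at hY2
      linarith
    have hpoly : (1 + ν ^ 2) * (1 + |ν|) ^ 4 ≤ 24 * (1 + |ν| ^ 6) := by
      rw [← sq_abs ν]
      have h4 := one_add_pow_four_le |ν|
      have h0 := abs_nonneg ν
      generalize |ν| = x at *
      have h6 : (1 + x ^ 2) * (1 + x ^ 4) ≤ 3 * (1 + x ^ 6) := by
        nlinarith [sq_nonneg (x ^ 2 - 1), sq_nonneg (x * (x ^ 2 - 1)), sq_nonneg x]
      have := mul_le_mul_of_nonneg_left h4 (by positivity : 0 ≤ 1 + x ^ 2)
      linarith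
    have hPs : 0 ≤ P Φ + P (D6 Φ) := add_nonneg (apply_nonneg _ _) (apply_nonneg _ _)
    have hpos : 0 < 1 + |ν| ^ 6 := by positivity
    rw [mul_assoc, ← hA]
    refine le_of_mul_le_mul_left ?_ hpos
    calc (1 + |ν| ^ 6) * ((1 + ν ^ 2) * A) = (1 + ν ^ 2) * ((1 + |ν| ^ 6) * A) := by ring
      _ ≤ (1 + ν ^ 2) * (((1 + |β|) * (1 + |ν|)) ^ 4 * (P Φ + P (D6 Φ))) := by gcongr
      _ = ((1 + ν ^ 2) * (1 + |ν|) ^ 4) * ((1 + |β|) ^ 4 * (P Φ + P (D6 Φ))) := by ring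
      _ ≤ (24 * (1 + |ν| ^ 6)) * ((1 + |β|) ^ 4 * (P Φ + P (D6 Φ))) := by gcongr
      _ = _ := by ring

/-- The deterministic kernel of the correlation function, in the variables `((ω, ν), (X, Y))`: the two
frequencies are `ω` and `ω₂ = -ω + η²ν`, the two scattering points `-(ω₂/ω)X + ηY` and `X`. The value at
`ω = 0`, where the quotient is meaningless, is zero for amplitudes that vanish at low frequency. -/
noncomputable def corrKernel (b : OrthonormalBasis (Fin 2) ℝ Plane) (l : Fin 2 → ℝ) (w : ℝ → Plane → ℂ)
    (Φ : CorrSpace → ℂ) (η : ℝ) (ζ : (ℝ × ℝ) × (Plane × Plane)) : ℂ :=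
  w ζ.1.1 (-((-ζ.1.1 + η ^ 2 * ζ.1.2) / ζ.1.1) • ζ.2.1 + η • ζ.2.2) * w (-ζ.1.1 + η ^ 2 * ζ.1.2) ζ.2.1 *
    ∫ c, Φ c * osc (corrPhase b l η ζ.1.1 (-ζ.1.1 + η ^ 2 * ζ.1.2) ζ.1.2
      (-((-ζ.1.1 + η ^ 2 * ζ.1.2) / ζ.1.1) • ζ.2.1 + η • ζ.2.2) ζ.2.1 ζ.2.2 c)

section Kernel

variable (b : OrthonormalBasis (Fin 2) ℝ Plane) {l : Fin 2 → ℝ} {w : ℝ → Plane → ℂ} {a β M : ℝ} {G : Plane → ℝ}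
  (hw : IsWavePacket w a β M G)
include hw

/-- An integrable majorant of the correlation kernel, uniform in `η ∈ [0,1]`: the decay in `ν` and `Y` comes
from the phase, the decay in `X` from the amplitude, and `ω` ranges over a bounded band. -/
lemma exists_corrKernel_bound (hl : ∀ i, 0 < l i) :
    ∃ p : Seminorm ℂ 𝓢(CorrSpace, ℂ), Continuous p ∧ ∃ H : (ℝ × ℝ) × (Plane × Plane) → ℝ, Integrable H ∧ (∀ ζ, 0 ≤ H ζ) ∧
      ∀ (Φ : 𝓢(CorrSpace, ℂ)) (η : ℝ), 0 ≤ η → η ≤ 1 → ∀ ζ, ‖corrKernel b l w Φ η ζ‖ ≤ p Φ * H ζ := by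
  obtain ⟨p, hp, hpb⟩ := exists_seminorm_corrPhase b hl β
  set m := min 1 (a ^ 4) with hm
  have ha := hw.pos
  have hm0 : 0 < m := lt_min one_pos (by positivity)
  have hM := hw.nonneg_bdd
  refine ⟨p, hp, fun ζ => ((Set.Icc (-β) β).indicator (fun _ => 1) ζ.1.1 * (1 + ζ.1.2 ^ 2)⁻¹) *
    ((M * G ζ.2.1) * (8 / m * (1 + ‖ζ.2.2‖) ^ (-4 : ℝ))), ?_, fun ζ => ?_, fun Φ η hη0 hη1 ζ => ?_⟩
  · refine Integrable.mul_prod (Integrable.mul_prod ?_ integrable_inv_one_add_sq)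
      (Integrable.mul_prod (hw.int.const_mul M) (integrable_one_add_norm_plane.const_mul _))
    exact (integrableOn_const (measure_Icc_lt_top).ne).integrable_indicator measurableSet_Icc
  · have := hw.nonneg ζ.2.1
    have : 0 ≤ (Set.Icc (-β) β).indicator (fun _ => (1 : ℝ)) ζ.1.1 := Set.indicator_nonneg (fun _ _ => zero_le_one) _
    positivity
  · obtain ⟨⟨ω, ν⟩, X, Y⟩ := ζ
    rw [corrKernel]
    simp only
    set ω₂ := -ω + η ^ 2 * ν with hω₂
    set X₁ := -(ω₂ / ω) • X + η • Y with hX₁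
    have hG := hw.nonneg X
    have hp0 : 0 ≤ p Φ := apply_nonneg _ _
    have hind : 0 ≤ (Set.Icc (-β) β).indicator (fun _ => (1 : ℝ)) ω := Set.indicator_nonneg (fun _ _ => zero_le_one) _
    by_cases h1 : w ω X₁ = 0
    · rw [h1]; simp only [zero_mul, norm_zero]; positivity
    by_cases h2 : w ω₂ X = 0
    · rw [h2]; simp only [zero_mul, mul_zero, norm_zero]; positivity
    obtain ⟨hωa, hωβ⟩ := hw.band _ _ h1
    obtain ⟨-, hω₂β⟩ := hw.band _ _ h2
    have hmem : ω ∈ Set.Icc (-β) β := abs_le.1 hωβ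
    rw [Set.indicator_of_mem hmem, one_mul]
    have hK := hpb Φ η ω ω₂ ν X₁ X Y hη0 hη1 hωβ hω₂β
    set K := ‖∫ c, Φ c * osc (corrPhase b l η ω ω₂ ν X₁ X Y c)‖ with hKdef
    have hK0 : 0 ≤ K := norm_nonneg _
    have hden : m / 8 * (1 + ‖Y‖) ^ 4 ≤ 1 + (|ω| * ‖Y‖) ^ 4 := by
      have h4 := one_add_pow_four_le ‖Y‖
      have h5 : a ^ 4 * ‖Y‖ ^ 4 ≤ (|ω| * ‖Y‖) ^ 4 := by rw [mul_pow]; gcongr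
      have h6 : m ≤ 1 := min_le_left _ _
      have h7 : m * ‖Y‖ ^ 4 ≤ a ^ 4 * ‖Y‖ ^ 4 := by gcongr; exact min_le_right _ _
      nlinarith
    have hKle : K ≤ p Φ * ((1 + ν ^ 2)⁻¹ * (8 / m * (1 + ‖Y‖) ^ (-4 : ℝ))) := by
      rw [rpow_neg_four (norm_nonneg Y)]
      have e : (1 + ν ^ 2)⁻¹ * (8 / m * ((1 + ‖Y‖) ^ 4)⁻¹) = ((1 + ν ^ 2) * (m / 8 * (1 + ‖Y‖) ^ 4))⁻¹ := by
        field_simp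
      rw [e, ← div_eq_mul_inv, le_div_iff₀ (by positivity)]
      refine le_trans ?_ hK
      rw [mul_comm]
      gcongr
    calc ‖w ω X₁ * w ω₂ X * ∫ c, Φ c * osc (corrPhase b l η ω ω₂ ν X₁ X Y c)‖
        = ‖w ω X₁‖ * ‖w ω₂ X‖ * K := by rw [norm_mul, norm_mul]
      _ ≤ M * G X * (p Φ * ((1 + ν ^ 2)⁻¹ * (8 / m * (1 + ‖Y‖) ^ (-4 : ℝ)))) := by
          gcongr
          · exact hw.bdd _ _
          · exact hw.dom _ _
      _ = _ := by ring

lemma measurable_corrKernel (Φ : 𝓢(CorrSpace, ℂ)) (η : ℝ) : StronglyMeasurable (corrKernel b l w Φ η) := by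
  have hX₁ : Measurable fun ζ : (ℝ × ℝ) × (Plane × Plane) =>
      -((-ζ.1.1 + η ^ 2 * ζ.1.2) / ζ.1.1) • ζ.2.1 + η • ζ.2.2 := by fun_prop
  have hc := hw.cont.measurable
  have h1 : Measurable fun ζ : (ℝ × ℝ) × (Plane × Plane) =>
      w ζ.1.1 (-((-ζ.1.1 + η ^ 2 * ζ.1.2) / ζ.1.1) • ζ.2.1 + η • ζ.2.2) :=
    hc.comp (by fun_prop : Measurable fun ζ : (ℝ × ℝ) × (Plane × Plane) =>
      (ζ.1.1, -((-ζ.1.1 + η ^ 2 * ζ.1.2) / ζ.1.1) • ζ.2.1 + η • ζ.2.2))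
  have h2 : Measurable fun ζ : (ℝ × ℝ) × (Plane × Plane) => w (-ζ.1.1 + η ^ 2 * ζ.1.2) ζ.2.1 :=
    hc.comp (by fun_prop : Measurable fun ζ : (ℝ × ℝ) × (Plane × Plane) => (-ζ.1.1 + η ^ 2 * ζ.1.2, ζ.2.1))
  have h3 : Measurable fun q : ((ℝ × ℝ) × (Plane × Plane)) × CorrSpace =>
      corrPhase b l η q.1.1.1 (-q.1.1.1 + η ^ 2 * q.1.1.2) q.1.1.2
      (-((-q.1.1.1 + η ^ 2 * q.1.1.2) / q.1.1.1) • q.1.2.1 + η • q.1.2.2) q.1.2.1 q.1.2.2 q.2 :=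
    by unfold corrPhase; fun_prop
  have h4 : StronglyMeasurable fun q : ((ℝ × ℝ) × (Plane × Plane)) × CorrSpace => Φ q.2 * osc (
      corrPhase b l η q.1.1.1 (-q.1.1.1 + η ^ 2 * q.1.1.2) q.1.1.2
      (-((-q.1.1.1 + η ^ 2 * q.1.1.2) / q.1.1.1) • q.1.2.1 + η • q.1.2.2) q.1.2.1 q.1.2.2 q.2) :=
    ((Φ.continuous.measurable.comp measurable_snd).mul (measurable_osc.comp h3)).stronglyMeasurable
  exact (h1.mul h2).stronglyMeasurable.mul (h4.integral_prod_right (ν := (volume : Measure CorrSpace)))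

lemma continuous_corrKernel (Φ : 𝓢(CorrSpace, ℂ)) (ζ : (ℝ × ℝ) × (Plane × Plane)) :
    Continuous fun η => corrKernel b l w Φ η ζ := by
  have hX₁ : Continuous fun η : ℝ => -((-ζ.1.1 + η ^ 2 * ζ.1.2) / ζ.1.1) • ζ.2.1 + η • ζ.2.2 := by fun_prop
  have h1 : Continuous fun η : ℝ => w ζ.1.1 (-((-ζ.1.1 + η ^ 2 * ζ.1.2) / ζ.1.1) • ζ.2.1 + η • ζ.2.2) :=
    hw.cont.comp (by fun_prop : Continuous fun η : ℝ =>
      (ζ.1.1, -((-ζ.1.1 + η ^ 2 * ζ.1.2) / ζ.1.1) • ζ.2.1 + η • ζ.2.2))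
  have h2 : Continuous fun η : ℝ => w (-ζ.1.1 + η ^ 2 * ζ.1.2) ζ.2.1 :=
    hw.cont.comp (by fun_prop : Continuous fun η : ℝ => (-ζ.1.1 + η ^ 2 * ζ.1.2, ζ.2.1))
  have h3 : ∀ η, Continuous fun c => corrPhase b l η ζ.1.1 (-ζ.1.1 + η ^ 2 * ζ.1.2) ζ.1.2
      (-((-ζ.1.1 + η ^ 2 * ζ.1.2) / ζ.1.1) • ζ.2.1 + η • ζ.2.2) ζ.2.1 ζ.2.2 c := fun η =>
    (continuous_corrPhase b l).comp (by fun_prop : Continuous fun c : CorrSpace =>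
      ((η, ζ.1.1, (-ζ.1.1 + η ^ 2 * ζ.1.2), ζ.1.2,
      (-((-ζ.1.1 + η ^ 2 * ζ.1.2) / ζ.1.1) • ζ.2.1 + η • ζ.2.2), ζ.2.1, ζ.2.2), c))
  have h4 : ∀ c, Continuous fun η => corrPhase b l η ζ.1.1 (-ζ.1.1 + η ^ 2 * ζ.1.2) ζ.1.2
      (-((-ζ.1.1 + η ^ 2 * ζ.1.2) / ζ.1.1) • ζ.2.1 + η • ζ.2.2) ζ.2.1 ζ.2.2 c := fun c =>
    (continuous_corrPhase b l).comp (by fun_prop : Continuous fun η : ℝ =>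
      ((η, ζ.1.1, (-ζ.1.1 + η ^ 2 * ζ.1.2), ζ.1.2,
      (-((-ζ.1.1 + η ^ 2 * ζ.1.2) / ζ.1.1) • ζ.2.1 + η • ζ.2.2), ζ.2.1, ζ.2.2), c))
  refine (h1.mul h2).mul (continuous_of_dominated (bound := fun c => ‖Φ c‖) (fun η => ?_) (fun η => ?_)
    (integrable_schwartz (μ := (volume : Measure CorrSpace)) Φ).norm (Eventually.of_forall fun c => ?_))
  · exact (Φ.continuous.mul (continuous_osc.comp (h3 η))).aestronglyMeasurable
  · exact Eventually.of_forall fun c => by rw [norm_mul, norm_osc, mul_one]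
  · exact continuous_const.mul (continuous_osc.comp (h4 c))

end Kernel

/-! ### The correlation function paired with a test function -/

/-- The change of variables from the two frequencies and the two scattering points to the mean and
difference variables; its Jacobian is `η⁴`. -/
lemma integral_eq_integral_diff_variables {F : (ℝ × ℝ) × (Plane × Plane) → ℂ} (hF : StronglyMeasurable F)
    {η : ℝ} (hη : 0 < η) :
    ∫ z, F z = ((η ^ 4 : ℝ) : ℂ) * ∫ ζ : (ℝ × ℝ) × (Plane × Plane),
      F ((ζ.1.1, -ζ.1.1 + η ^ 2 * ζ.1.2),
        (-((-ζ.1.1 + η ^ 2 * ζ.1.2) / ζ.1.1) • ζ.2.1 + η • ζ.2.2, ζ.2.1)) := by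
  set c := ENNReal.ofReal (η ^ 2)⁻¹ with hc
  have haff : ∀ (r v : ℝ), 0 < r → Measure.map (fun x : ℝ => v + r * x) volume
      = ENNReal.ofReal r⁻¹ • volume := by
    intro r v hr
    have h1 := Measure.map_addHaar_smul (volume : Measure ℝ) hr.ne'
    rw [Module.finrank_self, pow_one, abs_of_pos (by positivity)] at h1
    have h2 := Measure.map_map (μ := (volume : Measure ℝ)) (g := fun x => v + x) (f := fun x => r • x)
      (by fun_prop) (by fun_prop)
    rw [h1, Measure.map_smul, (measurePreserving_add_left volume v).map_eq] at h2
    exact h2.symm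
  have haff' : ∀ v : Plane, Measure.map (fun x : Plane => v + η • x) volume = c • volume := by
    intro v
    have h1 := Measure.map_addHaar_smul (volume : Measure Plane) hη.ne'
    rw [finrank_euclideanSpace_fin, abs_of_pos (by positivity)] at h1
    have h2 := Measure.map_map (μ := (volume : Measure Plane)) (g := fun x => v + x) (f := fun x => η • x)
      (by fun_prop) (by fun_prop)
    rw [h1, Measure.map_smul, (measurePreserving_add_left volume v).map_eq] at h2
    exact h2.symm
  have hf : MeasurePreserving (fun q : ℝ × ℝ => (q.1, -q.1 + η ^ 2 * q.2)) (volume.prod volume)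
      (volume.prod (c • volume)) :=
    (MeasurePreserving.id volume).skew_product (by simp only [Function.uncurry_def]; fun_prop)
      (Eventually.of_forall fun ω => haff _ _ (by positivity))
  have hg : ∀ κ : ℝ, MeasurePreserving (fun q : Plane × Plane => (κ • q.1 + η • q.2, q.1)) (volume.prod volume)
      ((c • volume).prod volume) := fun κ =>
    Measure.measurePreserving_swap.comp ((MeasurePreserving.id volume).skew_product
      (g := fun X Y => κ • X + η • Y) (by simp only [Function.uncurry_def]; fun_prop)
      (Eventually.of_forall fun X => haff' _))
  have hS := hf.skew_product (μc := (volume : Measure Plane).prod (volume : Measure Plane))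
    (g := fun (q : ℝ × ℝ) (r : Plane × Plane) => (-((-q.1 + η ^ 2 * q.2) / q.1) • r.1 + η • r.2, r.1))
    (by simp only [Function.uncurry_def]; fun_prop) (Eventually.of_forall fun q => (hg _).map_eq)
  have hmap := hS.map_eq
  rw [Measure.prod_smul_right, Measure.prod_smul_left, Measure.prod_smul_left, Measure.prod_smul_right] at hmap
  have hint := integral_map (μ := ((volume : Measure ℝ).prod volume).prod ((volume : Measure Plane).prod volume))
    hS.measurable.aemeasurable (f := F) hF.aestronglyMeasurable
  rw [hmap, integral_smul_measure, integral_smul_measure, smul_smul] at hint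
  have hcr : c.toReal * c.toReal = (η ^ 4)⁻¹ := by
    rw [hc, ENNReal.toReal_ofReal (by positivity)]; field_simp
  rw [hcr] at hint
  have h4 : (((η ^ 4 : ℝ) : ℂ)) * (((η ^ 4)⁻¹ : ℝ) : ℂ) = 1 := by
    rw [← Complex.ofReal_mul, mul_inv_cancel₀ (by positivity), Complex.ofReal_one]
  refine Eq.trans ?_ (congrArg (fun x => ((η ^ 4 : ℝ) : ℂ) * x) hint)
  change _ = ((η ^ 4 : ℝ) : ℂ) * (((η ^ 4)⁻¹ : ℝ) • ∫ z, F z)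
  rw [Complex.real_smul, ← mul_assoc, h4, one_mul]

/-- The phase of a wave component of frequency `ω` scattered at `X`, at time `s` and position `Y`. -/
noncomputable def wavePhase (b : OrthonormalBasis (Fin 2) ℝ Plane) (l : Fin 2 → ℝ) (θ : Plane → ℝ)
    (ω : ℝ) (X : Plane) (s : ℝ) (Y : Plane) : ℝ :=
  -(ω * s) + (ω * θ X + ω * inner ℝ (Y - X) (diagOp b l⁻¹ (Y - X)) / 2)

section Pairing

variable (b : OrthonormalBasis (Fin 2) ℝ Plane) {l : Fin 2 → ℝ} {w : ℝ → Plane → ℂ} {a β M : ℝ} {G : Plane → ℝ}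
  (hw : IsWavePacket w a β M G) {θ : Plane → ℝ} (hθ : Continuous θ)

lemma waveField_eq_wavePhase (s : ℝ) (Y : Plane) :
    waveField b l w θ s Y = ∫ ω : ℝ, ∫ X, w ω X * osc (wavePhase b l θ ω X s Y) := by
  unfold waveField wavePhase
  congr 1; ext ω
  rw [← integral_const_mul]
  congr 1; ext X
  rw [osc_add (-(ω * s))]; ring

include hw

lemma integrable_packet_mul_packet :
    Integrable fun z : (ℝ × ℝ) × (Plane × Plane) => w z.1.1 z.2.1 * w z.1.2 z.2.2 := by
  have hI : Integrable ((Set.Icc (-β) β).indicator fun _ => (1 : ℝ)) :=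
    (integrableOn_const (measure_Icc_lt_top).ne).integrable_indicator measurableSet_Icc
  refine ((hI.mul_prod hI).mul_prod (hw.int.mul_prod hw.int)).mono' ?_ (Eventually.of_forall fun z => ?_)
  · exact ((hw.cont.comp (by fun_prop : Continuous fun z : (ℝ × ℝ) × (Plane × Plane) => (z.1.1, z.2.1))).mul
      (hw.cont.comp (by fun_prop : Continuous fun z : (ℝ × ℝ) × (Plane × Plane) => (z.1.2, z.2.2)))).aestronglyMeasurable
  · have h1 := hw.norm_le_indicator z.1.1 z.2.1
    have h2 := hw.norm_le_indicator z.1.2 z.2.2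
    rw [norm_mul]
    refine (mul_le_mul h1 h2 (norm_nonneg _) ((norm_nonneg _).trans h1)).trans_eq ?_
    ring

include hθ

lemma continuous_waveField : Continuous fun p : ℝ × Plane => waveField b l w θ p.1 p.2 := by
  have h : ∀ p : ℝ × Plane, waveField b l w θ p.1 p.2
      = ∫ q : ℝ × Plane, w q.1 q.2 * osc (wavePhase b l θ q.1 q.2 p.1 p.2) := by
    intro p
    rw [waveField_eq_wavePhase]
    have hI : Integrable fun q : ℝ × Plane => w q.1 q.2 * osc (wavePhase b l θ q.1 q.2 p.1 p.2) :=
      integrable_mul_osc hw.integrable (by unfold wavePhase; fun_prop)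
    exact (integral_prod _ hI).symm
  simp_rw [h]
  refine continuous_of_dominated (bound := fun q => ‖w q.1 q.2‖) (fun p => ?_) (fun p => ?_)
    hw.integrable.norm ?_
  · exact (integrable_mul_osc hw.integrable (by unfold wavePhase; fun_prop)).aestronglyMeasurable
  · exact Eventually.of_forall fun q => by rw [norm_mul, norm_osc, mul_one]
  · exact Eventually.of_forall fun q => by unfold wavePhase; fun_prop

omit hθ in
lemma norm_waveField_le (s : ℝ) (Y : Plane) : ‖waveField b l w θ s Y‖ ≤ ∫ q : ℝ × Plane, ‖w q.1 q.2‖ := by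
  rw [waveField_eq_wavePhase]
  refine LE.le.trans_eq ?_ (integral_prod _ hw.integrable.norm).symm
  refine norm_integral_le_of_norm_le hw.integrable.norm.integral_prod_left (Eventually.of_forall fun ω => ?_)
  exact norm_integral_mul_osc_le _ _

lemma waveField_mul_waveField (s₁ s₂ : ℝ) (Y₁ Y₂ : Plane) :
    waveField b l w θ s₁ Y₁ * waveField b l w θ s₂ Y₂ = ∫ z : (ℝ × ℝ) × (Plane × Plane),
      (w z.1.1 z.2.1 * w z.1.2 z.2.2) * osc (wavePhase b l θ z.1.1 z.2.1 s₁ Y₁ + wavePhase b l θ z.1.2 z.2.2 s₂ Y₂) := by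
  rw [waveField_eq_wavePhase, waveField_eq_wavePhase, ← integral_prod_mul]
  have hI : Integrable fun z : (ℝ × ℝ) × (Plane × Plane) =>
      (w z.1.1 z.2.1 * w z.1.2 z.2.2) * osc (wavePhase b l θ z.1.1 z.2.1 s₁ Y₁ + wavePhase b l θ z.1.2 z.2.2 s₂ Y₂) :=
    integrable_mul_osc (integrable_packet_mul_packet hw) (by unfold wavePhase; fun_prop)
  refine Eq.trans ?_ (integral_prod _ hI).symm
  change _ = ∫ q : ℝ × ℝ, _ ∂(volume.prod volume)
  congr 1; ext q
  rw [← integral_prod_mul]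
  change _ = ∫ q : Plane × Plane, _ ∂(volume.prod volume)
  congr 1; ext r
  rw [osc_add]; ring

lemma integrable_waveField_mul (Φ : 𝓢(CorrSpace, ℂ)) (η : ℝ) :
    Integrable fun c : CorrSpace =>
      (waveField b l w θ (η⁻¹ ^ 2 * c.1.1 + c.2.1.1) (η⁻¹ • c.1.2.1 + c.1.2.2 + η • c.2.1.2) *
        waveField b l w θ (η⁻¹ ^ 2 * c.1.1 + c.2.2.1) (η⁻¹ • c.1.2.1 + c.1.2.2 + η • c.2.2.2)) * Φ c := by
  have hc := continuous_waveField b (l := l) hw hθ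
  have h1 : Continuous fun c : CorrSpace =>
      waveField b l w θ (η⁻¹ ^ 2 * c.1.1 + c.2.1.1) (η⁻¹ • c.1.2.1 + c.1.2.2 + η • c.2.1.2) :=
    hc.comp (by fun_prop : Continuous fun c : CorrSpace =>
      (η⁻¹ ^ 2 * c.1.1 + c.2.1.1, η⁻¹ • c.1.2.1 + c.1.2.2 + η • c.2.1.2))
  have h2 : Continuous fun c : CorrSpace =>
      waveField b l w θ (η⁻¹ ^ 2 * c.1.1 + c.2.2.1) (η⁻¹ • c.1.2.1 + c.1.2.2 + η • c.2.2.2) :=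
    hc.comp (by fun_prop : Continuous fun c : CorrSpace =>
      (η⁻¹ ^ 2 * c.1.1 + c.2.2.1, η⁻¹ • c.1.2.1 + c.1.2.2 + η • c.2.2.2))
  set K := ∫ q : ℝ × Plane, ‖w q.1 q.2‖
  refine (integrable_schwartz (μ := (volume : Measure CorrSpace)) Φ).bdd_mul (c := K * K)
    (h1.mul h2).aestronglyMeasurable (Eventually.of_forall fun c => ?_)
  rw [norm_mul]
  have hn := norm_waveField_le b (l := l) hw (θ := θ)
  exact mul_le_mul (hn _ _) (hn _ _) (norm_nonneg _) ((norm_nonneg _).trans (hn 0 0))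

/-- The correlation function of the rescaled wave, paired with a test function, is the average of a
deterministic kernel against the phase increments at the interface. -/
lemma integral_waveField_mul_waveField (Φ : 𝓢(CorrSpace, ℂ)) {η : ℝ} (hη : 0 < η) :
    ∫ c : CorrSpace, (((η⁻¹ ^ 2 : ℝ) : ℂ) *
          waveField b l w θ (η⁻¹ ^ 2 * c.1.1 + c.2.1.1) (η⁻¹ • c.1.2.1 + c.1.2.2 + η • c.2.1.2)) *
        (((η⁻¹ ^ 2 : ℝ) : ℂ) *
          waveField b l w θ (η⁻¹ ^ 2 * c.1.1 + c.2.2.1) (η⁻¹ • c.1.2.1 + c.1.2.2 + η • c.2.2.2)) * Φ c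
      = ∫ ζ : (ℝ × ℝ) × (Plane × Plane), corrKernel b l w Φ η ζ *
        osc (ζ.1.1 * θ (-((-ζ.1.1 + η ^ 2 * ζ.1.2) / ζ.1.1) • ζ.2.1 + η • ζ.2.2)
          + (-ζ.1.1 + η ^ 2 * ζ.1.2) * θ ζ.2.1) := by
  set ψ : (ℝ × ℝ) × (Plane × Plane) → CorrSpace → ℝ := fun z c =>
    wavePhase b l θ z.1.1 z.2.1 (η⁻¹ ^ 2 * c.1.1 + c.2.1.1) (η⁻¹ • c.1.2.1 + c.1.2.2 + η • c.2.1.2)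
      + wavePhase b l θ z.1.2 z.2.2 (η⁻¹ ^ 2 * c.1.1 + c.2.2.1) (η⁻¹ • c.1.2.1 + c.1.2.2 + η • c.2.2.2) with hψ
  have hψm : Measurable fun q : CorrSpace × ((ℝ × ℝ) × (Plane × Plane)) => ψ q.2 q.1 := by
    simp only [hψ, wavePhase]; fun_prop
  have hψm' : Measurable fun q : ((ℝ × ℝ) × (Plane × Plane)) × CorrSpace => ψ q.1 q.2 := by
    simp only [hψ, wavePhase]; fun_prop
  set F : (ℝ × ℝ) × (Plane × Plane) → ℂ := fun z => (w z.1.1 z.2.1 * w z.1.2 z.2.2) * ∫ c, Φ c * osc (ψ z c) with hF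
  have hFm : StronglyMeasurable F := by
    have h1 : Measurable fun z : (ℝ × ℝ) × (Plane × Plane) => w z.1.1 z.2.1 * w z.1.2 z.2.2 :=
      (hw.cont.measurable.comp (by fun_prop : Measurable fun z : (ℝ × ℝ) × (Plane × Plane) => (z.1.1, z.2.1))).mul
      (hw.cont.measurable.comp (by fun_prop : Measurable fun z : (ℝ × ℝ) × (Plane × Plane) => (z.1.2, z.2.2)))
    have h2 : StronglyMeasurable fun q : ((ℝ × ℝ) × (Plane × Plane)) × CorrSpace => Φ q.2 * osc (ψ q.1 q.2) :=
      ((Φ.continuous.measurable.comp measurable_snd).mul (measurable_osc.comp hψm')).stronglyMeasurable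
    exact h1.stronglyMeasurable.mul (h2.integral_prod_right (ν := (volume : Measure CorrSpace)))
  have hswap := integral_integral_swap (μ := (volume : Measure CorrSpace))
    (ν := (volume : Measure ((ℝ × ℝ) × (Plane × Plane))))
    (f := fun c z => (Φ c * (w z.1.1 z.2.1 * w z.1.2 z.2.2)) * osc (ψ z c))
    (integrable_mul_osc ((integrable_schwartz (μ := (volume : Measure CorrSpace)) Φ).mul_prod
      (integrable_packet_mul_packet hw)) hψm)
  have hη2 : (((η⁻¹ ^ 2 : ℝ) : ℂ)) * (((η⁻¹ ^ 2 : ℝ) : ℂ)) * ((η ^ 4 : ℝ) : ℂ) = 1 := by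
    rw [← Complex.ofReal_mul, ← Complex.ofReal_mul, ← Complex.ofReal_one]
    congr 1; field_simp
  calc _ = ∫ c : CorrSpace, ((((η⁻¹ ^ 2 : ℝ) : ℂ)) * (((η⁻¹ ^ 2 : ℝ) : ℂ))) *
          ∫ z, (Φ c * (w z.1.1 z.2.1 * w z.1.2 z.2.2)) * osc (ψ z c) := by
        congr 1; ext c
        have h := waveField_mul_waveField b (l := l) hw hθ (η⁻¹ ^ 2 * c.1.1 + c.2.1.1) (η⁻¹ ^ 2 * c.1.1 + c.2.2.1)
          (η⁻¹ • c.1.2.1 + c.1.2.2 + η • c.2.1.2) (η⁻¹ • c.1.2.1 + c.1.2.2 + η • c.2.2.2)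
        have h' : ∫ z, (Φ c * (w z.1.1 z.2.1 * w z.1.2 z.2.2)) * osc (ψ z c) = Φ c *
            ∫ z : (ℝ × ℝ) × (Plane × Plane), (w z.1.1 z.2.1 * w z.1.2 z.2.2) * osc (ψ z c) := by
          rw [← integral_const_mul]; congr 1; ext z; ring
        rw [h', ← h]; ring
    _ = ((((η⁻¹ ^ 2 : ℝ) : ℂ)) * (((η⁻¹ ^ 2 : ℝ) : ℂ))) * ∫ z, F z := by
        rw [integral_const_mul, hswap]
        congr 2; ext z
        rw [hF]
        simp only
        rw [← integral_const_mul]; congr 1; ext c; ring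
    _ = _ := by
        rw [integral_eq_integral_diff_variables hFm hη, ← mul_assoc, hη2, one_mul]
        congr 1; ext ζ
        obtain ⟨⟨ω, ν⟩, X, Y⟩ := ζ
        simp only [hF, corrKernel]
        by_cases hω : ω = 0
        · subst hω; simp [hw.zero]
        set ω₂ := -ω + η ^ 2 * ν with hω₂
        set X₁ := -(ω₂ / ω) • X + η • Y with hX₁
        rw [mul_assoc _ (∫ c, _), ← integral_mul_const]
        congr 2; ext c
        have h := corrPhase_eq b l hη.ne' (ω₁ := ω) (ω₂ := ω₂) (ν := ν) (X₁ := X₁) (X₂ := X) (Y := Y)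
          (by rw [hω₂]; ring) (by
            rw [hX₁, smul_add, smul_smul, smul_smul, add_right_comm, ← add_smul]
            have : ω * -(ω₂ / ω) + ω₂ = 0 := by field_simp; ring
            rw [this, zero_smul, zero_add]) c
        rw [h, mul_assoc, ← osc_add]
        congr 2
        simp only [hψ, wavePhase]
        ring

end Pairing

/-! ### Covariance inequalities for mixing fields -/

section Covariance

variable {Ω : Type*} {m₀ : MeasurableSpace Ω} {P : Measure Ω} [IsProbabilityMeasure P]

lemma integrable_of_abs_le_one {f : Ω → ℝ} (hf : Measurable f) (h1 : ∀ o, |f o| ≤ 1) : Integrable f P :=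
  (integrable_const (1 : ℝ)).mono' hf.aestronglyMeasurable (Eventually.of_forall fun o => by simpa using h1 o)

/-- If the integrals of `h` over the sets of a sub-σ-algebra are at most `α`, then its integrals against
functions that are measurable for this σ-algebra and bounded by one are at most `2α`: replace `h` by its
conditional expectation, and integrate the latter over the set where it is nonnegative and over the
complement. -/
lemma abs_integral_mul_le_of_abs_setIntegral_le {m : MeasurableSpace Ω} (hm : m ≤ m₀) {h f : Ω → ℝ}
    (hh : Integrable h P) (hf : Measurable[m] f) (hf1 : ∀ o, |f o| ≤ 1) {α : ℝ}
    (hα : ∀ A, MeasurableSet[m] A → |∫ o in A, h o ∂P| ≤ α) : |∫ o, f o * h o ∂P| ≤ 2 * α := by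
  set k := P[h | m] with hk
  have hki : Integrable k P := integrable_condExp
  have hfk : Integrable (fun o => f o * k o) P :=
    hki.bdd_mul (c := 1) (hf.mono hm le_rfl).aestronglyMeasurable
      (Eventually.of_forall fun o => by simpa using hf1 o)
  have h1 : ∫ o, f o * h o ∂P = ∫ o, f o * k o ∂P := by
    have := condExp_stronglyMeasurable_mul_of_bound hm hf.stronglyMeasurable hh 1
      (Eventually.of_forall fun o => by simpa using hf1 o)
    have e := integral_condExp (μ := P) (f := f * h) hm
    rw [integral_congr_ae this] at e
    exact e.symm
  have hs : MeasurableSet[m] {o | 0 ≤ k o} := stronglyMeasurable_condExp.measurable measurableSet_Ici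
  have hs' := hm _ hs
  rw [h1]
  calc |∫ o, f o * k o ∂P| ≤ ∫ o, |f o * k o| ∂P := abs_integral_le_integral_abs
    _ ≤ ∫ o, |k o| ∂P := by
        refine integral_mono hfk.abs hki.abs fun o => ?_
        simp only [abs_mul]
        exact mul_le_of_le_one_left (abs_nonneg _) (hf1 o)
    _ = ∫ o in {o | 0 ≤ k o}, |k o| ∂P + ∫ o in {o | 0 ≤ k o}ᶜ, |k o| ∂P := (integral_add_compl hs' hki.abs).symm
    _ = ∫ o in {o | 0 ≤ k o}, h o ∂P - ∫ o in {o | 0 ≤ k o}ᶜ, h o ∂P := by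
        rw [← setIntegral_condExp hm hh hs, ← setIntegral_condExp hm hh hs.compl, sub_eq_add_neg, ← integral_neg]
        congr 1
        · exact setIntegral_congr_fun hs' fun o ho => abs_of_nonneg ho
        · exact setIntegral_congr_fun hs'.compl fun o ho => abs_of_neg (not_le.1 ho)
    _ ≤ 2 * α := by
        have := abs_le.1 (hα _ hs)
        have := abs_le.1 (hα _ hs.compl)
        linarith

lemma osc_eq_cos_add_sin (r : ℝ) : osc r = (Real.cos r : ℂ) + (Real.sin r : ℂ) * Complex.I := by
  rw [osc, mul_comm, Complex.exp_mul_I]; push_cast; rfl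

lemma integral_osc_eq_cos_add_sin {φ : Ω → ℝ} (hφ : Measurable φ) :
    ∫ o, osc (φ o) ∂P = ((∫ o, Real.cos (φ o) ∂P : ℝ) : ℂ) + ((∫ o, Real.sin (φ o) ∂P : ℝ) : ℂ) * Complex.I := by
  have hc := (integrable_of_abs_le_one (P := P) (Real.measurable_cos.comp hφ) fun o => Real.abs_cos_le_one _).ofReal (𝕜 := ℂ)
  have hs := (integrable_of_abs_le_one (P := P) (Real.measurable_sin.comp hφ) fun o => Real.abs_sin_le_one _).ofReal (𝕜 := ℂ)
  simp_rw [osc_eq_cos_add_sin]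
  refine (integral_add hc (hs.mul_const _)).trans ?_
  rw [integral_mul_const, ← integral_complex_ofReal, ← integral_complex_ofReal]
  rfl

variable {m₁ m₂ : MeasurableSpace Ω} (h₁ : m₁ ≤ m₀) (h₂ : m₂ ≤ m₀) {α : ℝ}
  (hα : ∀ A B, MeasurableSet[m₁] A → MeasurableSet[m₂] B → |P.real (A ∩ B) - P.real A * P.real B| ≤ α)
include h₁ h₂ hα

/-- Covariance inequality for bounded functions, obtained by replacing the two functions one after the other
by indicators. -/
lemma abs_covariance_le_of_mixing {f g : Ω → ℝ} (hf : Measurable[m₁] f) (hg : Measurable[m₂] g)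
    (hf1 : ∀ o, |f o| ≤ 1) (hg1 : ∀ o, |g o| ≤ 1) :
    |∫ o, f o * g o ∂P - (∫ o, f o ∂P) * ∫ o, g o ∂P| ≤ 4 * α := by
  have hfi := integrable_of_abs_le_one (P := P) (hf.mono h₁ le_rfl) hf1
  have hgi := integrable_of_abs_le_one (P := P) (hg.mono h₂ le_rfl) hg1
  set κ := ∫ o, f o ∂P with hκ
  have key := abs_integral_mul_le_of_abs_setIntegral_le h₂ (h := fun o => f o - κ) (hfi.sub (integrable_const κ)) hg hg1 (α := 2 * α) ?_
  · refine (le_of_eq ?_).trans (key.trans (by linarith))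
    have e : ∀ o, g o * (f o - κ) = f o * g o - κ * g o := fun o => by ring
    simp_rw [e]
    rw [integral_sub (hgi.bdd_mul (c := 1) hfi.aestronglyMeasurable (Eventually.of_forall fun o => by simpa using hf1 o))
      (hgi.const_mul κ), integral_const_mul]
  · intro B hB
    have hB' := h₂ _ hB
    have hBi : Integrable (B.indicator fun _ => (1 : ℝ)) P := (integrable_const 1).indicator hB'
    have key2 := abs_integral_mul_le_of_abs_setIntegral_le h₁
      (h := fun o => B.indicator (fun _ => (1 : ℝ)) o - P.real B) (hBi.sub (integrable_const (P.real B))) hf hf1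
      (α := α) ?_
    · refine (le_of_eq ?_).trans key2
      have e : ∀ o, f o * (B.indicator (fun _ => (1 : ℝ)) o - P.real B)
          = B.indicator f o - P.real B * f o := fun o => by
        by_cases ho : o ∈ B <;> simp [ho, mul_sub, mul_comm]
      simp_rw [e]
      rw [integral_sub (hfi.indicator hB') (hfi.const_mul _), integral_const_mul, integral_indicator hB']
      rw [integral_sub hfi.integrableOn (integrable_const κ).integrableOn, setIntegral_const, smul_eq_mul]
    · intro A hA
      have hA' := h₁ _ hA
      refine (le_of_eq ?_).trans (hα A B hA hB)
      rw [integral_sub hBi.integrableOn (integrable_const _).integrableOn, setIntegral_const, smul_eq_mul,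
        setIntegral_indicator hB', setIntegral_const, smul_eq_mul, mul_one]

lemma norm_covariance_osc_le_of_mixing {φ ψ : Ω → ℝ} (hφ : Measurable[m₁] φ) (hψ : Measurable[m₂] ψ) :
    ‖∫ o, osc (φ o + ψ o) ∂P - (∫ o, osc (φ o) ∂P) * ∫ o, osc (ψ o) ∂P‖ ≤ 16 * α := by
  have hφ' := hφ.mono h₁ le_rfl
  have hψ' := hψ.mono h₂ le_rfl
  have c1 := Real.measurable_cos.comp hφ
  have s1 := Real.measurable_sin.comp hφ
  have c2 := Real.measurable_cos.comp hψ
  have s2 := Real.measurable_sin.comp hψ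
  have bc : ∀ (χ : Ω → ℝ) o, |(Real.cos ∘ χ) o| ≤ 1 := fun χ o => Real.abs_cos_le_one _
  have bs : ∀ (χ : Ω → ℝ) o, |(Real.sin ∘ χ) o| ≤ 1 := fun χ o => Real.abs_sin_le_one _
  have hcc := abs_covariance_le_of_mixing h₁ h₂ hα c1 c2 (bc _) (bc _)
  have hcs := abs_covariance_le_of_mixing h₁ h₂ hα c1 s2 (bc _) (bs _)
  have hsc := abs_covariance_le_of_mixing h₁ h₂ hα s1 c2 (bs _) (bc _)
  have hss := abs_covariance_le_of_mixing h₁ h₂ hα s1 s2 (bs _) (bs _)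
  have hi : ∀ {f g : Ω → ℝ}, Measurable[m₁] f → Measurable[m₂] g → (∀ o, |f o| ≤ 1) → (∀ o, |g o| ≤ 1) →
      Integrable (fun o => f o * g o) P := fun hf hg hf1 hg1 =>
    integrable_of_abs_le_one ((hf.mono h₁ le_rfl).mul (hg.mono h₂ le_rfl)) fun o => by
      rw [abs_mul]; exact mul_le_one₀ (hf1 o) (abs_nonneg _) (hg1 o)
  have icc := hi c1 c2 (bc _) (bc _)
  have ics := hi c1 s2 (bc _) (bs _)
  have isc := hi s1 c2 (bs _) (bc _)
  have iss := hi s1 s2 (bs _) (bs _)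
  rw [integral_osc_eq_cos_add_sin hφ', integral_osc_eq_cos_add_sin hψ', integral_osc_eq_cos_add_sin (φ := fun o => φ o + ψ o) (hφ'.add hψ')]
  have ec : ∫ o, Real.cos ((φ + ψ) o) ∂P = ∫ o, (Real.cos ∘ φ) o * (Real.cos ∘ ψ) o ∂P
      - ∫ o, (Real.sin ∘ φ) o * (Real.sin ∘ ψ) o ∂P := by
    rw [← integral_sub icc iss]; congr 1; ext o; exact Real.cos_add _ _
  have es : ∫ o, Real.sin ((φ + ψ) o) ∂P = ∫ o, (Real.sin ∘ φ) o * (Real.cos ∘ ψ) o ∂P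
      + ∫ o, (Real.cos ∘ φ) o * (Real.sin ∘ ψ) o ∂P := by
    rw [← integral_add isc ics]; congr 1; ext o; exact Real.sin_add _ _
  have ec' : ∫ o, Real.cos (φ o + ψ o) ∂P = _ := ec
  have es' : ∫ o, Real.sin (φ o + ψ o) ∂P = _ := es
  rw [ec', es']
  set Ecc := ∫ o, (Real.cos ∘ φ) o * (Real.cos ∘ ψ) o ∂P
  set Ess := ∫ o, (Real.sin ∘ φ) o * (Real.sin ∘ ψ) o ∂P
  set Esc := ∫ o, (Real.sin ∘ φ) o * (Real.cos ∘ ψ) o ∂P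
  set Ecs := ∫ o, (Real.cos ∘ φ) o * (Real.sin ∘ ψ) o ∂P
  change |Ecc - (∫ o, Real.cos (φ o) ∂P) * ∫ o, Real.cos (ψ o) ∂P| ≤ _ at hcc
  change |Ecs - (∫ o, Real.cos (φ o) ∂P) * ∫ o, Real.sin (ψ o) ∂P| ≤ _ at hcs
  change |Esc - (∫ o, Real.sin (φ o) ∂P) * ∫ o, Real.cos (ψ o) ∂P| ≤ _ at hsc
  change |Ess - (∫ o, Real.sin (φ o) ∂P) * ∫ o, Real.sin (ψ o) ∂P| ≤ _ at hss
  generalize (∫ o, Real.cos (φ o) ∂P) = C1 at *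
  generalize (∫ o, Real.sin (φ o) ∂P) = S1 at *
  generalize (∫ o, Real.cos (ψ o) ∂P) = C2 at *
  generalize (∫ o, Real.sin (ψ o) ∂P) = S2 at *
  have e : ((Ecc - Ess : ℝ) : ℂ) + ((Esc + Ecs : ℝ) : ℂ) * Complex.I
      - ((C1 : ℂ) + (S1 : ℂ) * Complex.I) * ((C2 : ℂ) + (S2 : ℂ) * Complex.I)
      = (((Ecc - C1 * C2) - (Ess - S1 * S2) : ℝ) : ℂ)
        + (((Esc - S1 * C2) + (Ecs - C1 * S2) : ℝ) : ℂ) * Complex.I := by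
    push_cast
    linear_combination (-(S1 : ℂ) * S2) * Complex.I_mul_I
  rw [e]
  refine (norm_add_le _ _).trans ?_
  rw [norm_mul, Complex.norm_I, mul_one, Complex.norm_real, Complex.norm_real, Real.norm_eq_abs, Real.norm_eq_abs]
  have := abs_sub (Ecc - C1 * C2) (Ess - S1 * S2)
  have := abs_add_le (Esc - S1 * C2) (Ecs - C1 * S2)
  linarith

end Covariance

section Field

variable {Ω : Type*} [MeasurableSpace Ω] {P : Measure Ω} [IsProbabilityMeasure P] {V : Plane → Ω → ℝ}

omit [MeasurableSpace Ω] in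
lemma measurable_fieldSigma {S : Set Plane} {x : Plane} (hx : x ∈ S) : Measurable[fieldSigma V S] (V x) := by
  rw [measurable_iff_comap_le]
  exact le_iSup₂ (f := fun x (_ : x ∈ S) => MeasurableSpace.comap (V x) inferInstance) x hx

lemma fieldSigma_le (hV : ∀ x, Measurable (V x)) (S : Set Plane) : fieldSigma V S ≤ ‹MeasurableSpace Ω› :=
  iSup₂_le fun x _ => (hV x).comap_le

lemma abs_sub_mul_le_alphaCoeff {S S' : Set Plane} (hS : S.Nonempty) (hS' : S'.Nonempty) {r : ℝ}
    (hr : ENNReal.ofReal r < setDist S S') {A B : Set Ω} (hA : MeasurableSet[fieldSigma V S] A)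
    (hB : MeasurableSet[fieldSigma V S'] B) :
    |P.real (A ∩ B) - P.real A * P.real B| ≤ alphaCoeff P V r := by
  refine le_csSup ⟨1, ?_⟩ ⟨S, S', hS, hS', hr, A, B, hA, hB, rfl⟩
  rintro a ⟨-, -, -, -, -, A, B, -, -, rfl⟩
  have h1 : P.real (A ∩ B) ≤ 1 := measureReal_le_one
  have h2 : P.real A * P.real B ≤ 1 := mul_le_one₀ measureReal_le_one measureReal_nonneg measureReal_le_one
  have h3 : 0 ≤ P.real (A ∩ B) := measureReal_nonneg
  have h4 : 0 ≤ P.real A * P.real B := mul_nonneg measureReal_nonneg measureReal_nonneg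
  rw [abs_le]; constructor <;> linarith

lemma ofReal_lt_setDist_pair {p Y p' Y' : Plane} {r : ℝ} (hr0 : 0 ≤ r) (hr : r + ‖Y‖ + ‖Y'‖ + 1 ≤ ‖p - p'‖) :
    ENNReal.ofReal r < setDist {p + Y, p} {p' + Y', p'} := by
  have h0 := norm_nonneg Y
  have h0' := norm_nonneg Y'
  have key : ∀ u v : Plane, ‖u‖ ≤ ‖Y‖ → ‖v‖ ≤ ‖Y'‖ → r + 1 ≤ dist (p + u) (p' + v) := by
    intro u v hu hv
    rw [dist_eq_norm]
    have e : p - p' = ((p + u) - (p' + v)) + (v - u) := by abel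
    have h1 : ‖p - p'‖ ≤ ‖(p + u) - (p' + v)‖ + (‖v‖ + ‖u‖) := by
      rw [e]; exact (norm_add_le _ _).trans (by gcongr; exact norm_sub_le _ _)
    linarith
  have hle : ENNReal.ofReal (r + 1) ≤ setDist {p + Y, p} {p' + Y', p'} := by
    refine le_iInf₂ fun s hs => le_iInf₂ fun s' hs' => ?_
    rw [edist_dist]
    refine ENNReal.ofReal_le_ofReal ?_
    rcases hs with rfl | rfl <;> rcases hs' with rfl | rfl
    · exact key _ _ le_rfl le_rfl
    · simpa using key Y 0 le_rfl (by simp)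
    · simpa using key 0 Y' (by simp) le_rfl
    · simpa using key 0 0 (by simp) (by simp)
  exact lt_of_lt_of_le ((ENNReal.ofReal_lt_ofReal_iff (by linarith)).2 (by linarith)) hle

/-- Increments of a mixing field based at remote points are almost uncorrelated. -/
lemma norm_covariance_osc_increment_le (hV : ∀ x, Measurable (V x)) {p Y p' Y' : Plane} {r : ℝ} (hr0 : 0 ≤ r)
    (hr : r + ‖Y‖ + ‖Y'‖ + 1 ≤ ‖p - p'‖) (κ κ' : ℝ) :
    ‖∫ o, osc (κ * (V (p + Y) o - V p o) + κ' * (V (p' + Y') o - V p' o)) ∂P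
      - (∫ o, osc (κ * (V (p + Y) o - V p o)) ∂P) * ∫ o, osc (κ' * (V (p' + Y') o - V p' o)) ∂P‖
      ≤ 16 * alphaCoeff P V r := by
  refine norm_covariance_osc_le_of_mixing (fieldSigma_le hV {p + Y, p}) (fieldSigma_le hV {p' + Y', p'})
    (fun A B hA hB => abs_sub_mul_le_alphaCoeff (Set.insert_nonempty _ _) (Set.insert_nonempty _ _)
      (ofReal_lt_setDist_pair hr0 hr) hA hB) ?_ ?_
  · exact ((measurable_fieldSigma (by simp)).sub (measurable_fieldSigma (by simp))).const_mul κ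
  · exact ((measurable_fieldSigma (by simp)).sub (measurable_fieldSigma (by simp))).const_mul κ'

omit [IsProbabilityMeasure P] in
/-- Translation invariance of expectations of functions of finitely many values of a stationary field. -/
lemma IsStationaryField.integral_comp_add {F : Type*} [NormedAddCommGroup F] [NormedSpace ℝ F]
    (hV : ∀ x, Measurable (V x)) (hs : IsStationaryField P V) {n : ℕ} (x : Fin n → Plane) (h : Plane)
    {g : (Fin n → ℝ) → F} (hg : StronglyMeasurable g) :
    ∫ o, g (fun i => V (x i + h) o) ∂P = ∫ o, g (fun i => V (x i) o) ∂P := by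
  have hm : ∀ y : Fin n → Plane, AEMeasurable (fun o i => V (y i) o) P := fun y =>
    (measurable_pi_lambda _ fun i => hV (y i)).aemeasurable
  rw [← integral_map (hm x) hg.aestronglyMeasurable,
    ← integral_map (hm fun i => x i + h) hg.aestronglyMeasurable, hs n x h]

omit [IsProbabilityMeasure P] in
lemma IsStationaryField.integral_osc_increment (hV : ∀ x, Measurable (V x)) (hs : IsStationaryField P V)
    (κ : ℝ) (p Y : Plane) :
    ∫ o, osc (κ * (V (p + Y) o - V p o)) ∂P = ∫ o, osc (κ * (V Y o - V 0 o)) ∂P := by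
  have h := hs.integral_comp_add hV ![Y, 0] p (g := fun v => osc (κ * (v 0 - v 1)))
    (by fun_prop : Measurable _).stronglyMeasurable
  simpa [add_comm] using h

end Field

/-! ### Self-averaging of integrals of asymptotically uncorrelated families -/

section SelfAveraging

variable {Ω : Type*} [MeasurableSpace Ω] {P : Measure Ω} [IsProbabilityMeasure P]
  {X : Type*} [MeasurableSpace X] {μ : Measure X} [SFinite μ]

omit [SFinite μ] in
lemma integrable_mul_of_norm_le {F : X → ℂ} (hF : Integrable F μ) {U : X → Ω → ℂ} {K : ℝ}
    (hU : StronglyMeasurable fun q : X × Ω => U q.1 q.2) (hK : ∀ ζ o, ‖U ζ o‖ ≤ K) :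
    Integrable (fun q : X × Ω => F q.1 * U q.1 q.2) (μ.prod P) :=
  (hF.comp_fst P).mul_bdd (c := K) hU.aestronglyMeasurable (Eventually.of_forall fun _ => hK _ _)

/-- The second moment of a weighted integral of a random family is controlled by its covariances. -/
lemma integral_norm_sq_integral_le {F : X → ℂ} (hF : Integrable F μ) {U : X → Ω → ℂ} {K : ℝ}
    (hU : StronglyMeasurable fun q : X × Ω => U q.1 q.2) (hK : ∀ ζ o, ‖U ζ o‖ ≤ K) :
    ∫ o, ‖∫ ζ, F ζ * U ζ o ∂μ‖ ^ 2 ∂P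
      ≤ ∫ q : X × X, ‖F q.1‖ * ‖F q.2‖ * ‖∫ o, U q.1 o * (starRingEnd ℂ) (U q.2 o) ∂P‖ ∂(μ.prod μ) := by
  have hFF : Integrable (fun q : X × X => F q.1 * (starRingEnd ℂ) (F q.2)) (μ.prod μ) := by
    refine hF.mul_prod (hF.norm.mono' ?_ (Eventually.of_forall fun x => (RCLike.norm_conj _).le))
    exact Complex.continuous_conj.comp_aestronglyMeasurable hF.aestronglyMeasurable
  have hUU : StronglyMeasurable fun q : (X × X) × Ω => U q.1.1 q.2 * (starRingEnd ℂ) (U q.1.2 q.2) := by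
    have h1 : StronglyMeasurable fun q : (X × X) × Ω => U q.1.1 q.2 :=
      hU.comp_measurable (g := fun q : (X × X) × Ω => (q.1.1, q.2)) (by fun_prop)
    have h2 : StronglyMeasurable fun q : (X × X) × Ω => U q.1.2 q.2 :=
      hU.comp_measurable (g := fun q : (X × X) × Ω => (q.1.2, q.2)) (by fun_prop)
    exact h1.mul (Complex.continuous_conj.comp_stronglyMeasurable h2)
  have hUUb : ∀ (q : X × X) o, ‖U q.1 o * (starRingEnd ℂ) (U q.2 o)‖ ≤ K * K := fun q o => by
    rw [norm_mul, RCLike.norm_conj]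
    exact mul_le_mul (hK _ _) (hK _ _) (norm_nonneg _) ((norm_nonneg _).trans (hK q.1 o))
  have hI := integrable_mul_of_norm_le (P := P) hFF (U := fun q o => U q.1 o * (starRingEnd ℂ) (U q.2 o)) hUU hUUb
  have e : ∀ o, ((‖∫ ζ, F ζ * U ζ o ∂μ‖ ^ 2 : ℝ) : ℂ) = ∫ q : X × X, (F q.1 * (starRingEnd ℂ) (F q.2)) *
      (U q.1 o * (starRingEnd ℂ) (U q.2 o)) ∂(μ.prod μ) := by
    intro o
    rw [Complex.ofReal_pow, ← Complex.mul_conj', ← integral_conj, ← integral_prod_mul]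
    congr 1; ext q
    rw [map_mul]; ring
  have hswap := integral_integral_swap (f := fun (q : X × X) o => (F q.1 * (starRingEnd ℂ) (F q.2)) *
      (U q.1 o * (starRingEnd ℂ) (U q.2 o))) hI
  have e2 : ((∫ o, ‖∫ ζ, F ζ * U ζ o ∂μ‖ ^ 2 ∂P : ℝ) : ℂ) = ∫ q : X × X, (F q.1 * (starRingEnd ℂ) (F q.2)) *
      ∫ o, U q.1 o * (starRingEnd ℂ) (U q.2 o) ∂P ∂(μ.prod μ) := by
    rw [← integral_complex_ofReal]
    simp_rw [e]
    rw [← hswap]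
    congr 1; ext q; rw [integral_const_mul]
  have h0 : 0 ≤ ∫ o, ‖∫ ζ, F ζ * U ζ o ∂μ‖ ^ 2 ∂P := integral_nonneg fun o => sq_nonneg _
  rw [← abs_of_nonneg h0, ← Real.norm_eq_abs, ← Complex.norm_real, e2]
  refine (norm_integral_le_integral_norm _).trans_eq ?_
  congr 1; ext q
  rw [norm_mul, norm_mul, RCLike.norm_conj]

/-- A family of complex random variables `A + B` with `E|A| → 0` and `E|B|² → 0` tends to zero in
probability. -/
lemma tendstoInMeasure_of_tendsto_integral {ι : Type*} {l : Filter ι} {A B f : ι → Ω → ℂ} {f₀ : ℂ}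
    (hf : ∀ᶠ i in l, ∀ o, f i o - f₀ = A i o + B i o)
    (hA : ∀ᶠ i in l, Integrable (A i) P) (hB : ∀ᶠ i in l, Integrable (fun o => ‖B i o‖ ^ 2) P)
    (hA0 : Tendsto (fun i => ∫ o, ‖A i o‖ ∂P) l (𝓝 0)) (hB0 : Tendsto (fun i => ∫ o, ‖B i o‖ ^ 2 ∂P) l (𝓝 0)) :
    TendstoInMeasure P f l fun _ => f₀ := by
  rw [tendstoInMeasure_iff_norm]
  intro δ hδ
  set c := min (δ / 2) ((δ / 2) ^ 2) with hc
  have hc0 : 0 < c := lt_min (by positivity) (by positivity)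
  have hlim : Tendsto (fun i => ENNReal.ofReal ((∫ o, ‖A i o‖ ∂P + ∫ o, ‖B i o‖ ^ 2 ∂P) / c)) l (𝓝 0) := by
    have h := ENNReal.tendsto_ofReal ((hA0.add hB0).div_const c)
    simpa using h
  refine tendsto_of_tendsto_of_tendsto_of_le_of_le' tendsto_const_nhds hlim (Eventually.of_forall fun i => zero_le) ?_
  filter_upwards [hf, hA, hB] with i hfi hAi hBi
  have hsub : {o | δ ≤ ‖f i o - f₀‖} ⊆ {o | c ≤ ‖A i o‖ + ‖B i o‖ ^ 2} := by
    intro o ho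
    simp only [Set.mem_ofPred_eq, hfi] at ho ⊢
    have h1 := ho.trans (norm_add_le _ _)
    by_cases h : δ / 2 ≤ ‖A i o‖
    · exact (min_le_left _ _).trans (h.trans (le_add_of_nonneg_right (sq_nonneg _)))
    · have h2 : δ / 2 ≤ ‖B i o‖ := by linarith
      exact (min_le_right _ _).trans ((pow_le_pow_left₀ (by positivity) h2 2).trans
        (le_add_of_nonneg_left (norm_nonneg _)))
  refine (measure_mono hsub).trans ?_
  have hm := mul_meas_ge_le_integral_of_nonneg (μ := P) (f := fun o => ‖A i o‖ + ‖B i o‖ ^ 2)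
    (Eventually.of_forall fun o => add_nonneg (norm_nonneg _) (sq_nonneg _)) (hAi.norm.add hBi) c
  rw [integral_add hAi.norm hBi] at hm
  rw [← ofReal_measureReal]
  refine ENNReal.ofReal_le_ofReal ?_
  rw [le_div_iff₀ hc0, mul_comm]
  exact hm

/-- If the kernels `k i` converge, under domination, and the random families `Z i` are close to families
`Z' i` whose fluctuations around `z` are asymptotically uncorrelated, then `∫ k i Z i` converges in
probability to the deterministic limit `∫ k₀ z`. -/
lemma tendstoInMeasure_integral_mul {ι : Type*} {l : Filter ι} [l.IsCountablyGenerated]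
    {k : ι → X → ℂ} {k₀ : X → ℂ} {H : X → ℝ} (hH : Integrable H μ)
    (hk : ∀ i, StronglyMeasurable (k i)) (hkH : ∀ᶠ i in l, ∀ ζ, ‖k i ζ‖ ≤ H ζ)
    (hk₀ : StronglyMeasurable k₀) (hk₀H : ∀ ζ, ‖k₀ ζ‖ ≤ H ζ) (hlim : ∀ ζ, Tendsto (fun i => k i ζ) l (𝓝 (k₀ ζ)))
    {Z Z' : ι → X → Ω → ℂ} {z : X → ℂ} (hZ : ∀ i, StronglyMeasurable fun q : X × Ω => Z i q.1 q.2)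
    (hZ1 : ∀ i ζ o, ‖Z i ζ o‖ ≤ 1) (hZ' : ∀ i, StronglyMeasurable fun q : X × Ω => Z' i q.1 q.2)
    (hZ1' : ∀ i ζ o, ‖Z' i ζ o‖ ≤ 1) (hz : StronglyMeasurable z) (hz1 : ∀ ζ, ‖z ζ‖ ≤ 1)
    (h1 : ∀ ζ, Tendsto (fun i => ∫ o, ‖Z i ζ o - Z' i ζ o‖ ∂P) l (𝓝 0))
    (h2 : ∀ᵐ q ∂(μ.prod μ), Tendsto (fun i =>
      ∫ o, (Z' i q.1 o - z q.1) * (starRingEnd ℂ) (Z' i q.2 o - z q.2) ∂P) l (𝓝 0)) :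
    TendstoInMeasure P (fun i o => ∫ ζ, k i ζ * Z i ζ o ∂μ) l (fun _ => ∫ ζ, k₀ ζ * z ζ ∂μ) := by
  have hk₀i : Integrable k₀ μ := hH.mono' hk₀.aestronglyMeasurable (Eventually.of_forall hk₀H)
  have hH0 : ∀ ζ, 0 ≤ H ζ := fun ζ => (norm_nonneg _).trans (hk₀H ζ)
  have hZo : ∀ i o, StronglyMeasurable fun ζ => Z i ζ o := fun i o =>
    (hZ i).comp_measurable (g := fun ζ => (ζ, o)) (by fun_prop)
  have hZo' : ∀ i o, StronglyMeasurable fun ζ => Z' i ζ o := fun i o =>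
    (hZ' i).comp_measurable (g := fun ζ => (ζ, o)) (by fun_prop)
  have hZz : ∀ i ζ, StronglyMeasurable fun o => Z i ζ o := fun i ζ =>
    (hZ i).comp_measurable (g := fun o => (ζ, o)) (by fun_prop)
  have hZz' : ∀ i ζ, StronglyMeasurable fun o => Z' i ζ o := fun i ζ =>
    (hZ' i).comp_measurable (g := fun o => (ζ, o)) (by fun_prop)
  set U : ι → X → Ω → ℂ := fun i ζ o => Z' i ζ o - z ζ with hUdef
  have hU : ∀ i, StronglyMeasurable fun q : X × Ω => U i q.1 q.2 := fun i =>
    (hZ' i).sub (hz.comp_measurable measurable_fst)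
  have hU2 : ∀ i ζ o, ‖U i ζ o‖ ≤ 2 := fun i ζ o => by
    refine (norm_sub_le _ _).trans ?_
    linarith [hZ1' i ζ o, hz1 ζ]
  -- the two contributions to the error
  set A : ι → Ω → ℂ := fun i o => ∫ ζ, (k i ζ * Z i ζ o - k₀ ζ * Z' i ζ o) ∂μ with hAdef
  set B : ι → Ω → ℂ := fun i o => ∫ ζ, k₀ ζ * U i ζ o ∂μ with hBdef
  have hAint : ∀ᶠ i in l, Integrable (fun q : X × Ω => k i q.1 * Z i q.1 q.2 - k₀ q.1 * Z' i q.1 q.2) (μ.prod P) := by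
    filter_upwards [hkH] with i hi
    have hki : Integrable (k i) μ := hH.mono' (hk i).aestronglyMeasurable (Eventually.of_forall hi)
    exact (integrable_mul_of_norm_le hki (hZ i) (hZ1 i)).sub (integrable_mul_of_norm_le hk₀i (hZ' i) (hZ1' i))
  have hBint : ∀ i, Integrable (fun q : X × Ω => k₀ q.1 * U i q.1 q.2) (μ.prod P) := fun i =>
    integrable_mul_of_norm_le hk₀i (hU i) (hU2 i)
  refine tendstoInMeasure_of_tendsto_integral (A := A) (B := B) ?_ ?_ ?_ ?_ ?_
  · filter_upwards [hkH] with i hi o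
    have hki : Integrable (k i) μ := hH.mono' (hk i).aestronglyMeasurable (Eventually.of_forall hi)
    have i1 : Integrable (fun ζ => k i ζ * Z i ζ o) μ := hki.mul_bdd (c := 1) (hZo i o).aestronglyMeasurable
      (Eventually.of_forall fun ζ => hZ1 i ζ o)
    have i2 : Integrable (fun ζ => k₀ ζ * Z' i ζ o) μ := hk₀i.mul_bdd (c := 1) (hZo' i o).aestronglyMeasurable
      (Eventually.of_forall fun ζ => hZ1' i ζ o)
    have i3 : Integrable (fun ζ => k₀ ζ * z ζ) μ := hk₀i.mul_bdd (c := 1) hz.aestronglyMeasurable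
      (Eventually.of_forall hz1)
    simp only [hAdef, hBdef, hUdef, mul_sub]
    rw [integral_sub i1 i2, integral_sub i2 i3]
    ring
  · filter_upwards [hAint] with i hi
    exact hi.integral_prod_right
  · refine Eventually.of_forall fun i => ?_
    have hBi : Integrable (B i) P := (hBint i).integral_prod_right
    refine (integrable_const ((∫ ζ, ‖k₀ ζ‖ * 2 ∂μ) ^ 2)).mono' (hBi.aestronglyMeasurable.norm.pow 2)
      (Eventually.of_forall fun o => ?_)
    rw [Real.norm_eq_abs, abs_of_nonneg (sq_nonneg _)]
    refine pow_le_pow_left₀ (norm_nonneg _) (norm_integral_le_of_norm_le (hk₀i.norm.mul_const 2)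
      (Eventually.of_forall fun ζ => ?_)) 2
    rw [norm_mul]
    exact mul_le_mul_of_nonneg_left (hU2 i ζ o) (norm_nonneg _)
  · have hE : ∀ i ζ, ∫ o, ‖Z i ζ o - Z' i ζ o‖ ∂P ≤ 2 := fun i ζ => by
      have h := integral_mono_of_nonneg (μ := P) (f := fun o => ‖Z i ζ o - Z' i ζ o‖) (g := fun _ => (2 : ℝ))
        (Eventually.of_forall fun o => norm_nonneg _) (integrable_const _) (Eventually.of_forall fun o =>
          (norm_sub_le _ _).trans (by linarith [hZ1 i ζ o, hZ1' i ζ o]))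
      simpa using h
    have hE0 : ∀ i ζ, 0 ≤ ∫ o, ‖Z i ζ o - Z' i ζ o‖ ∂P := fun i ζ => integral_nonneg fun o => norm_nonneg _
    have hD : Tendsto (fun i => ∫ ζ, (‖k i ζ - k₀ ζ‖ + ‖k₀ ζ‖ * ∫ o, ‖Z i ζ o - Z' i ζ o‖ ∂P) ∂μ) l (𝓝 0) := by
      have h := tendsto_integral_filter_of_dominated_convergence (μ := μ) (l := l)
        (F := fun i ζ => ‖k i ζ - k₀ ζ‖ + ‖k₀ ζ‖ * ∫ o, ‖Z i ζ o - Z' i ζ o‖ ∂P) (f := fun _ => 0)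
        (fun ζ => 4 * H ζ) ?_ ?_ (hH.const_mul 4) ?_
      · simpa using h
      · refine Eventually.of_forall fun i => ?_
        have hd : StronglyMeasurable fun q : X × Ω => ‖Z i q.1 q.2 - Z' i q.1 q.2‖ := ((hZ i).sub (hZ' i)).norm
        exact (((hk i).sub hk₀).norm.add (hk₀.norm.mul (hd.integral_prod_right (ν := P)))).aestronglyMeasurable
      · filter_upwards [hkH] with i hi
        refine Eventually.of_forall fun ζ => ?_
        rw [Real.norm_eq_abs, abs_of_nonneg (add_nonneg (norm_nonneg _) (mul_nonneg (norm_nonneg _) (hE0 i ζ)))]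
        have := norm_sub_le (k i ζ) (k₀ ζ)
        have := hi ζ
        have := hk₀H ζ
        have := mul_le_mul (hk₀H ζ) (hE i ζ) (hE0 i ζ) (hH0 ζ)
        linarith
      · refine Eventually.of_forall fun ζ => ?_
        have ha := (tendsto_iff_norm_sub_tendsto_zero.1 (hlim ζ))
        have hb := (h1 ζ).const_mul ‖k₀ ζ‖
        simpa using ha.add hb
    refine tendsto_of_tendsto_of_tendsto_of_le_of_le' tendsto_const_nhds hD
      (Eventually.of_forall fun i => integral_nonneg fun o => norm_nonneg _) ?_
    filter_upwards [hAint, hkH] with i hi hkHi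
    have hki : Integrable (k i) μ := hH.mono' (hk i).aestronglyMeasurable (Eventually.of_forall hkHi)
    calc ∫ o, ‖A i o‖ ∂P ≤ ∫ o, ∫ ζ, ‖k i ζ * Z i ζ o - k₀ ζ * Z' i ζ o‖ ∂μ ∂P :=
          integral_mono hi.integral_prod_right.norm hi.norm.integral_prod_right
            fun o => norm_integral_le_integral_norm _
      _ = ∫ ζ, ∫ o, ‖k i ζ * Z i ζ o - k₀ ζ * Z' i ζ o‖ ∂P ∂μ := (integral_integral_swap (μ := μ) (ν := P)
            (f := fun ζ o => ‖k i ζ * Z i ζ o - k₀ ζ * Z' i ζ o‖) hi.norm).symm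
      _ ≤ _ := by
          have hdm : ∀ ζ, Integrable (fun o => ‖Z i ζ o - Z' i ζ o‖) P := fun ζ =>
            (integrable_const (2 : ℝ)).mono' ((hZz i ζ).sub (hZz' i ζ)).norm.aestronglyMeasurable
              (Eventually.of_forall fun o => by
                rw [norm_norm]
                exact (norm_sub_le _ _).trans (by linarith [hZ1 i ζ o, hZ1' i ζ o]))
          refine integral_mono_of_nonneg (Eventually.of_forall fun ζ => integral_nonneg fun o => norm_nonneg _) ?_
            (Eventually.of_forall fun ζ => ?_)
          · refine (hki.sub hk₀i).norm.add ?_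
            have hd : StronglyMeasurable fun q : X × Ω => ‖Z i q.1 q.2 - Z' i q.1 q.2‖ := ((hZ i).sub (hZ' i)).norm
            exact hk₀i.norm.mul_bdd (c := 2) (hd.integral_prod_right (ν := P)).aestronglyMeasurable
              (Eventually.of_forall fun ζ => by rw [Real.norm_eq_abs, abs_of_nonneg (hE0 i ζ)]; exact hE i ζ)
          · have hle : ∀ o, ‖k i ζ * Z i ζ o - k₀ ζ * Z' i ζ o‖
                ≤ ‖k i ζ - k₀ ζ‖ + ‖k₀ ζ‖ * ‖Z i ζ o - Z' i ζ o‖ := fun o => by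
              have e : k i ζ * Z i ζ o - k₀ ζ * Z' i ζ o
                  = (k i ζ - k₀ ζ) * Z i ζ o + k₀ ζ * (Z i ζ o - Z' i ζ o) := by ring
              rw [e]
              refine (norm_add_le _ _).trans ?_
              rw [norm_mul, norm_mul]
              gcongr
              exact mul_le_of_le_one_right (norm_nonneg _) (hZ1 i ζ o)
            have h := integral_mono_of_nonneg (μ := P) (Eventually.of_forall fun o => norm_nonneg _)
              ((integrable_const ‖k i ζ - k₀ ζ‖).add ((hdm ζ).const_mul ‖k₀ ζ‖)) (Eventually.of_forall hle)
            refine h.trans_eq ?_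
            refine (integral_add (integrable_const _) ((hdm ζ).const_mul _)).trans ?_
            rw [integral_const_mul]
            simp
  · have hD : Tendsto (fun i => ∫ q : X × X, ‖k₀ q.1‖ * ‖k₀ q.2‖ *
        ‖∫ o, U i q.1 o * (starRingEnd ℂ) (U i q.2 o) ∂P‖ ∂(μ.prod μ)) l (𝓝 0) := by
      have hkk : Integrable (fun q : X × X => ‖k₀ q.1‖ * ‖k₀ q.2‖) (μ.prod μ) := hk₀i.norm.mul_prod hk₀i.norm
      have h := tendsto_integral_filter_of_dominated_convergence (μ := μ.prod μ) (l := l)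
        (F := fun i (q : X × X) => ‖k₀ q.1‖ * ‖k₀ q.2‖ * ‖∫ o, U i q.1 o * (starRingEnd ℂ) (U i q.2 o) ∂P‖)
        (f := fun _ => 0) (fun q => (‖k₀ q.1‖ * ‖k₀ q.2‖) * 4) ?_ ?_ (hkk.mul_const 4) ?_
      · simpa using h
      · refine Eventually.of_forall fun i => ?_
        have hu1 : StronglyMeasurable fun q : (X × X) × Ω => U i q.1.1 q.2 :=
          (hU i).comp_measurable (g := fun q : (X × X) × Ω => (q.1.1, q.2)) (by fun_prop)
        have hu2 : StronglyMeasurable fun q : (X × X) × Ω => U i q.1.2 q.2 :=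
          (hU i).comp_measurable (g := fun q : (X × X) × Ω => (q.1.2, q.2)) (by fun_prop)
        have hu := hu1.mul (Complex.continuous_conj.comp_stronglyMeasurable hu2)
        exact hkk.aestronglyMeasurable.mul (hu.integral_prod_right (ν := P)).norm.aestronglyMeasurable
      · refine Eventually.of_forall fun i => Eventually.of_forall fun q => ?_
        rw [norm_mul, norm_norm, Real.norm_eq_abs, abs_of_nonneg (mul_nonneg (norm_nonneg _) (norm_nonneg _))]
        gcongr
        have h := norm_integral_le_of_norm_le (μ := P) (f := fun o => U i q.1 o * (starRingEnd ℂ) (U i q.2 o))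
          (integrable_const (4 : ℝ)) (Eventually.of_forall fun o => by
            rw [norm_mul, RCLike.norm_conj]
            have := mul_le_mul (hU2 i q.1 o) (hU2 i q.2 o) (norm_nonneg _) zero_le_two
            linarith)
        simpa using h
      · filter_upwards [h2] with q hq
        have hq' := hq.norm.const_mul (‖k₀ q.1‖ * ‖k₀ q.2‖)
        rw [norm_zero, mul_zero] at hq'
        exact hq'
    exact tendsto_of_tendsto_of_tendsto_of_le_of_le' tendsto_const_nhds hD
      (Eventually.of_forall fun i => integral_nonneg fun o => sq_nonneg _)
      (Eventually.of_forall fun i => integral_norm_sq_integral_le hk₀i (hU i) (hU2 i))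

end SelfAveraging

/-! ### Convergence in probability of the correlation function -/

/-- The expectation `E[exp(iκ(V(Y) - V(0)))]`. -/
noncomputable def incrementCharFun {Ω : Type*} [MeasurableSpace Ω] (P : Measure Ω) (V : Plane → Ω → ℝ)
    (κ : ℝ) (Y : Plane) : ℂ :=
  ∫ o, osc (κ * (V Y o - V 0 o)) ∂P

section Limit

variable {Ω : Type*} [MeasurableSpace Ω] {P : Measure Ω} [IsProbabilityMeasure P] {V : Plane → Ω → ℝ}
  (hV : ∀ x, Measurable (V x)) (hVc : ∀ o, Continuous fun x => V x o)

lemma norm_incrementCharFun_le (κ : ℝ) (Y : Plane) : ‖incrementCharFun P V κ Y‖ ≤ 1 := by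
  have h := norm_integral_le_of_norm_le (μ := P) (f := fun o => osc (κ * (V Y o - V 0 o)))
    (integrable_const (1 : ℝ)) (Eventually.of_forall fun o => (norm_osc _).le)
  simpa [incrementCharFun] using h

include hV hVc

omit [IsProbabilityMeasure P] in
lemma measurable_field_apply {T : Type*} [MeasurableSpace T] {f : T → Plane} {g : T → Ω}
    (hf : Measurable f) (hg : Measurable g) : Measurable fun t => V (f t) (g t) :=
  (measurable_uncurry_of_continuous_of_measurable (u := V) hVc hV).comp (hf.prodMk hg)

lemma stronglyMeasurable_incrementCharFun (τ : ℝ) :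
    StronglyMeasurable fun ζ : (ℝ × ℝ) × (Plane × Plane) => incrementCharFun P V (ζ.1.1 * τ) ζ.2.2 := by
  have h1 := measurable_field_apply hV hVc (f := fun q : ((ℝ × ℝ) × (Plane × Plane)) × Ω => q.1.2.2)
    (g := fun q => q.2) (by fun_prop) (by fun_prop)
  have h2 := measurable_field_apply hV hVc (f := fun _ : ((ℝ × ℝ) × (Plane × Plane)) × Ω => 0)
    (g := fun q => q.2) (by fun_prop) (by fun_prop)
  have h : StronglyMeasurable fun q : ((ℝ × ℝ) × (Plane × Plane)) × Ω =>
      osc (q.1.1.1 * τ * (V q.1.2.2 q.2 - V 0 q.2)) :=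
    (measurable_osc.comp ((by fun_prop : Measurable fun q : ((ℝ × ℝ) × (Plane × Plane)) × Ω => q.1.1.1 * τ).mul
      (h1.sub h2))).stronglyMeasurable
  exact h.integral_prod_right (ν := P)

/-- A phase perturbed by a small displacement and a small weight is close in mean to the unperturbed one;
by stationarity this is uniform in the base point. -/
lemma tendsto_integral_norm_osc_sub (hs : IsStationaryField P V) {ι : Type*} {l : Filter ι}
    [l.IsCountablyGenerated] {κ : ℝ} {κ₂ : ι → ℝ} {Y : Plane} {Y₁ p : ι → Plane}
    (hκ : Tendsto κ₂ l (𝓝 (-κ))) (hY : Tendsto Y₁ l (𝓝 Y)) :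
    Tendsto (fun i => ∫ o, ‖osc (κ * V (p i + Y₁ i) o + κ₂ i * V (p i) o)
      - osc (κ * (V (p i + Y) o - V (p i) o))‖ ∂P) l (𝓝 0) := by
  have e : ∀ i, ∫ o, ‖osc (κ * V (p i + Y₁ i) o + κ₂ i * V (p i) o) - osc (κ * (V (p i + Y) o - V (p i) o))‖ ∂P
      = ∫ o, ‖osc (κ * V (Y₁ i) o + κ₂ i * V 0 o) - osc (κ * (V Y o - V 0 o))‖ ∂P := by
    intro i
    have h := hs.integral_comp_add hV ![Y₁ i, Y, 0] (p i)
      (g := fun v => ‖osc (κ * v 0 + κ₂ i * v 2) - osc (κ * (v 1 - v 2))‖)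
      (by fun_prop : Measurable _).stronglyMeasurable
    simpa [add_comm] using h
  simp_rw [e]
  have h := tendsto_integral_filter_of_dominated_convergence (μ := P) (l := l)
    (F := fun i o => ‖osc (κ * V (Y₁ i) o + κ₂ i * V 0 o) - osc (κ * (V Y o - V 0 o))‖)
    (f := fun _ => 0) (fun _ => 2) ?_ ?_ (integrable_const _) ?_
  · simpa using h
  · refine Eventually.of_forall fun i => ?_
    have h1 := hV (Y₁ i)
    have h2 := hV Y
    have h3 := hV 0
    exact (by fun_prop : Measurable _).aestronglyMeasurable
  · refine Eventually.of_forall fun i => Eventually.of_forall fun o => ?_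
    rw [norm_norm]
    refine (norm_sub_le _ _).trans ?_
    rw [norm_osc, norm_osc]; norm_num
  · refine Eventually.of_forall fun o => ?_
    have h1 : Tendsto (fun i => κ * V (Y₁ i) o + κ₂ i * V 0 o) l (𝓝 (κ * V Y o + -κ * V 0 o)) :=
      ((((hVc o).tendsto Y).comp hY).const_mul κ).add (hκ.mul_const _)
    have h2 := ((continuous_osc.tendsto _).comp h1)
    have h3 : κ * V Y o + -κ * V 0 o = κ * (V Y o - V 0 o) := by ring
    rw [h3] at h2
    exact tendsto_iff_norm_sub_tendsto_zero.1 h2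

omit hVc in
/-- The fluctuations of the phase increments of a mixing field at two base points whose distance tends to
infinity are asymptotically uncorrelated. -/
lemma tendsto_covariance_osc_increment (hs : IsStationaryField P V) (hm : IsAlphaMixing P V)
    {ι : Type*} {l : Filter ι} {κ κ' : ℝ} {Y Y' : Plane} {p p' : ι → Plane}
    (hp : Tendsto (fun i => ‖p i - p' i‖) l atTop) :
    Tendsto (fun i => ∫ o, (osc (κ * (V (p i + Y) o - V (p i) o)) - incrementCharFun P V κ Y)
      * (starRingEnd ℂ) (osc (κ' * (V (p' i + Y') o - V (p' i) o)) - incrementCharFun P V κ' Y') ∂P) l (𝓝 0) := by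
  have hmeas : ∀ (p Y : Plane) (κ : ℝ), Integrable (fun o => osc (κ * (V (p + Y) o - V p o))) P := fun p Y κ => by
    have h1 := hV (p + Y)
    have h2 := hV p
    exact (integrable_const (1 : ℝ)).mono' (by fun_prop : Measurable _).aestronglyMeasurable
      (Eventually.of_forall fun o => (norm_osc _).le)
  have hconj : ∀ κ Y, (starRingEnd ℂ) (incrementCharFun P V κ Y) = incrementCharFun P V (-κ) Y := fun κ Y => by
    rw [incrementCharFun, incrementCharFun, ← integral_conj]
    congr 1; ext o
    rw [conj_osc, neg_mul]
  have hstat : ∀ κ p Y, ∫ o, osc (κ * (V (p + Y) o - V p o)) ∂P = incrementCharFun P V κ Y := fun κ p Y =>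
    hs.integral_osc_increment hV κ p Y
  have e : ∀ i, ∫ o, (osc (κ * (V (p i + Y) o - V (p i) o)) - incrementCharFun P V κ Y)
      * (starRingEnd ℂ) (osc (κ' * (V (p' i + Y') o - V (p' i) o)) - incrementCharFun P V κ' Y') ∂P
      = ∫ o, osc (κ * (V (p i + Y) o - V (p i) o) + -κ' * (V (p' i + Y') o - V (p' i) o)) ∂P
      - (∫ o, osc (κ * (V (p i + Y) o - V (p i) o)) ∂P) *
        ∫ o, osc (-κ' * (V (p' i + Y') o - V (p' i) o)) ∂P := by
    intro i
    set c := incrementCharFun P V κ Y with hc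
    set c' := incrementCharFun P V (-κ') Y' with hc'
    have h1 := hmeas (p i) Y κ
    have h2 := hmeas (p' i) Y' (-κ')
    have h12 : Integrable (fun o => osc (κ * (V (p i + Y) o - V (p i) o) + -κ' * (V (p' i + Y') o - V (p' i) o))) P := by
      simp_rw [osc_add]
      exact h1.mul_bdd (c := 1) h2.aestronglyMeasurable (Eventually.of_forall fun o => (norm_osc _).le)
    rw [hstat, hstat, ← hc, ← hc']
    have e1 : ∀ o, (osc (κ * (V (p i + Y) o - V (p i) o)) - c)
        * (starRingEnd ℂ) (osc (κ' * (V (p' i + Y') o - V (p' i) o)) - incrementCharFun P V κ' Y')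
        = osc (κ * (V (p i + Y) o - V (p i) o) + -κ' * (V (p' i + Y') o - V (p' i) o))
          - osc (κ * (V (p i + Y) o - V (p i) o)) * c'
          - (c * osc (-κ' * (V (p' i + Y') o - V (p' i) o)) - c * c') := by
      intro o
      rw [map_sub, hconj, ← hc', conj_osc, ← neg_mul, osc_add]; ring
    simp_rw [e1]
    refine (integral_sub (h12.sub (h1.mul_const c')) ((h2.const_mul c).sub (integrable_const _))).trans ?_
    have a1 := integral_sub h12 (h1.mul_const c')
    have a2 := integral_sub (h2.const_mul c) (integrable_const (μ := P) (c * c'))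
    rw [integral_mul_const, hstat, ← hc] at a1
    rw [integral_const_mul, hstat, ← hc', integral_const, probReal_univ, one_smul, sub_self] at a2
    refine (congrArg₂ _ a1 a2).trans ?_
    rw [sub_zero]
  simp_rw [e]
  set r : ι → ℝ := fun i => ‖p i - p' i‖ - ‖Y‖ - ‖Y'‖ - 1 with hr
  have hrt : Tendsto r l atTop := by
    have : r = fun i => ‖p i - p' i‖ + (-‖Y‖ - ‖Y'‖ - 1) := by ext i; simp only [hr]; ring
    rw [this]; exact tendsto_atTop_add_const_right _ _ hp
  rw [tendsto_zero_iff_norm_tendsto_zero]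
  have hα : Tendsto (fun i => 16 * alphaCoeff P V (r i)) l (𝓝 0) := by
    simpa using (Tendsto.comp hm hrt).const_mul 16
  refine tendsto_of_tendsto_of_tendsto_of_le_of_le' tendsto_const_nhds hα (Eventually.of_forall fun i => norm_nonneg _) ?_
  filter_upwards [hrt.eventually_ge_atTop 0] with i hi
  exact norm_covariance_osc_increment_le hV hi (by simp only [hr]; linarith) _ _

variable (b : OrthonormalBasis (Fin 2) ℝ Plane) {l : Fin 2 → ℝ} {w : ℝ → Plane → ℂ} {a β M : ℝ} {G : Plane → ℝ}

/-- The correlation functional converges in probability as the scale `η` tends to zero. -/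
lemma tendstoInMeasure_corrKernel (hs : IsStationaryField P V) (hm : IsAlphaMixing P V)
    (hw : IsWavePacket w a β M G) (hl : ∀ i, 0 < l i) (Φ : 𝓢(CorrSpace, ℂ)) (τ : ℝ)
    {ι : Type*} {L : Filter ι} [L.IsCountablyGenerated] {η : ι → ℝ} (hη : Tendsto η L (𝓝[>] 0)) (c : ι → Plane) :
    TendstoInMeasure P (fun i o => ∫ ζ : (ℝ × ℝ) × (Plane × Plane), corrKernel b l w Φ (η i) ζ *
        osc (ζ.1.1 * (τ * V (c i + (η i)⁻¹ • (-((-ζ.1.1 + η i ^ 2 * ζ.1.2) / ζ.1.1) • ζ.2.1 + η i • ζ.2.2)) o)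
          + (-ζ.1.1 + η i ^ 2 * ζ.1.2) * (τ * V (c i + (η i)⁻¹ • ζ.2.1) o))) L
      (fun _ => ∫ ζ : (ℝ × ℝ) × (Plane × Plane),
        corrKernel b l w Φ 0 ζ * incrementCharFun P V (ζ.1.1 * τ) ζ.2.2) := by
  obtain ⟨p, -, H, hHi, hH0, hH⟩ := exists_corrKernel_bound b hw hl
  have hpos : ∀ᶠ i in L, 0 < η i := hη.eventually self_mem_nhdsWithin
  have hη0 : Tendsto η L (𝓝 0) := hη.mono_right nhdsWithin_le_nhds
  have hle : ∀ᶠ i in L, η i ≤ 1 := (hη0.eventually (ge_mem_nhds one_pos : ∀ᶠ x in 𝓝 (0 : ℝ), x ≤ 1))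
  refine tendstoInMeasure_integral_mul (μ := (volume : Measure ((ℝ × ℝ) × (Plane × Plane)))) (H := fun ζ => p Φ * H ζ)
    (k := fun i => corrKernel b l w Φ (η i)) (k₀ := corrKernel b l w Φ 0)
    (Z := fun i ζ o => osc (ζ.1.1 * (τ * V (c i + (η i)⁻¹ •
        (-((-ζ.1.1 + η i ^ 2 * ζ.1.2) / ζ.1.1) • ζ.2.1 + η i • ζ.2.2)) o)
          + (-ζ.1.1 + η i ^ 2 * ζ.1.2) * (τ * V (c i + (η i)⁻¹ • ζ.2.1) o)))
    (Z' := fun i ζ o => osc (ζ.1.1 * τ * (V (c i + (η i)⁻¹ • ζ.2.1 + ζ.2.2) o - V (c i + (η i)⁻¹ • ζ.2.1) o)))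
    (z := fun ζ => incrementCharFun P V (ζ.1.1 * τ) ζ.2.2)
    (hHi.const_mul _) (fun i => measurable_corrKernel b hw Φ (η i)) ?_ (measurable_corrKernel b hw Φ 0)
    (hH Φ 0 le_rfl zero_le_one) (fun ζ => ((continuous_corrKernel b hw Φ ζ).tendsto 0).comp hη0)
    (fun i => ?_) (fun _ _ _ => (norm_osc _).le) (fun i => ?_) (fun _ _ _ => (norm_osc _).le)
    (stronglyMeasurable_incrementCharFun hV hVc τ) (fun ζ => norm_incrementCharFun_le _ _) (fun ζ => ?_) ?_
  · filter_upwards [hpos, hle] with i h0 h1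
    exact hH Φ (η i) h0.le h1
  · have h1 := measurable_field_apply hV hVc (f := fun q : ((ℝ × ℝ) × (Plane × Plane)) × Ω =>
      c i + (η i)⁻¹ • (-((-q.1.1.1 + η i ^ 2 * q.1.1.2) / q.1.1.1) • q.1.2.1 + η i • q.1.2.2))
      (g := fun q => q.2) (by fun_prop) (by fun_prop)
    have h2 := measurable_field_apply hV hVc (f := fun q : ((ℝ × ℝ) × (Plane × Plane)) × Ω =>
      c i + (η i)⁻¹ • q.1.2.1) (g := fun q => q.2) (by fun_prop) (by fun_prop)
    exact (measurable_osc.comp (((by fun_prop : Measurable fun q : ((ℝ × ℝ) × (Plane × Plane)) × Ω => q.1.1.1).mul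
      (h1.const_mul τ)).add ((by fun_prop : Measurable fun q : ((ℝ × ℝ) × (Plane × Plane)) × Ω =>
        -q.1.1.1 + η i ^ 2 * q.1.1.2).mul (h2.const_mul τ)))).stronglyMeasurable
  · have h1 := measurable_field_apply hV hVc (f := fun q : ((ℝ × ℝ) × (Plane × Plane)) × Ω =>
      c i + (η i)⁻¹ • q.1.2.1 + q.1.2.2) (g := fun q => q.2) (by fun_prop) (by fun_prop)
    have h2 := measurable_field_apply hV hVc (f := fun q : ((ℝ × ℝ) × (Plane × Plane)) × Ω =>
      c i + (η i)⁻¹ • q.1.2.1) (g := fun q => q.2) (by fun_prop) (by fun_prop)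
    exact (measurable_osc.comp ((by fun_prop : Measurable fun q : ((ℝ × ℝ) × (Plane × Plane)) × Ω => q.1.1.1 * τ).mul
      (h1.sub h2))).stronglyMeasurable
  · -- the two phases differ by a vanishing displacement and a vanishing weight
    obtain ⟨⟨ω, ν⟩, x, Y⟩ := ζ
    have h := tendsto_integral_norm_osc_sub (P := P) hV hVc hs (l := L) (κ := ω * τ)
      (κ₂ := fun i => (-ω + η i ^ 2 * ν) * τ) (Y := Y) (Y₁ := fun i => Y - (η i * ν / ω) • x)
      (p := fun i => c i + (η i)⁻¹ • x) ?_ ?_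
    · refine h.congr' ?_
      filter_upwards [hpos] with i hi
      congr 1; ext o
      congr 3
      by_cases hω : ω = 0
      · subst hω; ring
      · have e : c i + (η i)⁻¹ • x + (Y - (η i * ν / ω) • x)
            = c i + (η i)⁻¹ • (-((-ω + η i ^ 2 * ν) / ω) • x + η i • Y) := by
          rw [smul_add, smul_smul, smul_smul, inv_mul_cancel₀ hi.ne', one_smul]
          have : (η i)⁻¹ * -((-ω + η i ^ 2 * ν) / ω) = (η i)⁻¹ - η i * ν / ω := by field_simp; ring
          rw [this, sub_smul]; abel
        rw [e]; ring
    · have h1 : Tendsto (fun i => (-ω + η i ^ 2 * ν) * τ) L (𝓝 ((-ω + 0 ^ 2 * ν) * τ)) :=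
        (((hη0.pow 2).mul_const ν).const_add (-ω)).mul_const τ
      have e : (-ω + 0 ^ 2 * ν) * τ = -(ω * τ) := by ring
      rwa [e] at h1
    · have h1 : Tendsto (fun i => Y - (η i * ν / ω) • x) L (𝓝 (Y - (0 * ν / ω) • x)) :=
        (((hη0.mul_const ν).div_const ω).smul_const x).const_sub Y
      simpa using h1
  · -- the base points are remote from each other, except on a null set
    have hne : ∀ᵐ q : ((ℝ × ℝ) × (Plane × Plane)) × ((ℝ × ℝ) × (Plane × Plane)) ∂(volume.prod volume),
        q.1.2.1 - q.2.2.1 ≠ 0 := by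
      rw [Measure.ae_prod_iff_ae_ae]
      · refine Eventually.of_forall fun ζ => ?_
        have hq : Measure.QuasiMeasurePreserving (fun ζ' : (ℝ × ℝ) × (Plane × Plane) => ζ'.2.1) volume volume :=
          Measure.quasiMeasurePreserving_fst.comp Measure.quasiMeasurePreserving_snd
        have h0 : ∀ᵐ x : Plane, x ≠ ζ.2.1 := by simp [ae_iff]
        filter_upwards [hq.ae h0] with ζ' h
        exact sub_ne_zero.2 (Ne.symm h)
      · exact (measurableSet_eq_fun (by fun_prop) (by fun_prop)).compl
    filter_upwards [hne] with q hq
    refine tendsto_covariance_osc_increment hV hs hm ?_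
    have e : ∀ i, ‖c i + (η i)⁻¹ • q.1.2.1 - (c i + (η i)⁻¹ • q.2.2.1)‖ = |(η i)⁻¹| * ‖q.1.2.1 - q.2.2.1‖ := by
      intro i
      rw [add_sub_add_left_eq_sub, ← smul_sub, norm_smul, Real.norm_eq_abs]
    simp_rw [e]
    have hinv : Tendsto (fun i => (η i)⁻¹) L atTop := tendsto_inv_nhdsGT_zero.comp hη
    exact (tendsto_abs_atTop_atTop.comp hinv).atTop_mul_const (norm_pos_iff.2 hq)

end Limit

/-! ### The kernel of the limit correlation function -/

/-- The variables `(ȳ, y, (s̃₁, ỹ₁), (s̃₂, ỹ₂))`. -/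
abbrev CorrFiber : Type := Plane × Plane × (ℝ × Plane) × (ℝ × Plane)

instance isAddHaarMeasure_corrFiber : (volume : Measure CorrFiber).IsAddHaarMeasure := by
  have h3 : (volume : Measure (ℝ × Plane)).IsAddHaarMeasure := Measure.prod.instIsAddHaarMeasure _ _
  have h4 : (volume : Measure ((ℝ × Plane) × (ℝ × Plane))).IsAddHaarMeasure := Measure.prod.instIsAddHaarMeasure _ _
  have h5 : (volume : Measure (Plane × (ℝ × Plane) × (ℝ × Plane))).IsAddHaarMeasure :=
    Measure.prod.instIsAddHaarMeasure _ _
  exact Measure.prod.instIsAddHaarMeasure _ _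

instance sFinite_corrFiber : SFinite (volume : Measure CorrFiber) := by
  have h4 : SFinite (volume : Measure ((ℝ × Plane) × (ℝ × Plane))) := Measure.prod.instSFinite
  have h5 : SFinite (volume : Measure (Plane × (ℝ × Plane) × (ℝ × Plane))) := Measure.prod.instSFinite
  exact Measure.prod.instSFinite

/-- The volume-preserving change of variables `s̄ = s + h(ȳ)`. -/
lemma measurePreserving_shear {h : Plane → ℝ} (hh : Measurable h) :
    MeasurePreserving (fun u : ℝ × CorrFiber => (((u.1 + h u.2.1, u.2.1, u.2.2.1), u.2.2.2) : CorrSpace))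
      volume volume := by
  have h1 : MeasurePreserving (fun u : CorrFiber × ℝ => (u.1, u.2 + h u.1.1)) volume volume :=
    (MeasurePreserving.id (volume : Measure CorrFiber)).skew_product (g := fun e s => s + h e.1)
      (by simp only [Function.uncurry_def]; fun_prop)
      (Eventually.of_forall fun e => (measurePreserving_add_right volume (h e.1)).map_eq)
  have h2 : MeasurePreserving (Prod.swap : ℝ × CorrFiber → CorrFiber × ℝ) volume volume :=
    Measure.measurePreserving_swap
  have h3 : MeasurePreserving (Prod.swap : CorrFiber × ℝ → ℝ × CorrFiber) volume volume :=
    Measure.measurePreserving_swap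
  have h4 : MeasurePreserving (fun e : CorrFiber => ((e.1, e.2.1), e.2.2)) volume volume :=
    (measurePreserving_prodAssoc (volume : Measure Plane) (volume : Measure Plane)
      (volume : Measure ((ℝ × Plane) × (ℝ × Plane)))).symm
  have h5 : MeasurePreserving (fun u : ℝ × CorrFiber => (u.1, ((u.2.1, u.2.2.1), u.2.2.2))) volume volume :=
    (MeasurePreserving.id (volume : Measure ℝ)).prod h4
  have h6 : MeasurePreserving (fun u : ℝ × ((Plane × Plane) × (ℝ × Plane) × (ℝ × Plane)) =>
      (((u.1, u.2.1), u.2.2) : CorrSpace)) volume volume :=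
    (measurePreserving_prodAssoc (volume : Measure ℝ) (volume : Measure (Plane × Plane))
      (volume : Measure ((ℝ × Plane) × (ℝ × Plane)))).symm
  exact h6.comp (h5.comp (h3.comp (h1.comp h2)))

lemma exists_integrable_bound_fiber (Φ : 𝓢(CorrSpace, ℂ)) :
    ∃ g : CorrFiber → ℝ, Integrable g ∧ ∀ (s : ℝ) (e : CorrFiber), ‖Φ ((s, e.1, e.2.1), e.2.2)‖ ≤ g e := by
  set C := 2 ^ 11 * ((Finset.Iic (11, 0)).sup fun m : ℕ × ℕ => SchwartzMap.seminorm ℝ m.1 m.2) Φ with hC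
  refine ⟨fun e => C * (1 + ‖e‖) ^ (-11 : ℝ), Integrable.const_mul (integrable_one_add_norm
    (μ := (volume : Measure CorrFiber)) ?_) C, fun s e => ?_⟩
  · simp only [Module.finrank_prod, finrank_euclideanSpace_fin, Module.finrank_self]; norm_num
  · have h := SchwartzMap.one_add_le_sup_seminorm_apply (𝕜 := ℝ) (m := (11, 0)) (k := 11) (n := 0) le_rfl le_rfl Φ
      ((s, e.1, e.2.1), e.2.2)
    rw [norm_iteratedFDeriv_zero, ← hC] at h
    have hn : ‖e‖ ≤ ‖(((s, e.1, e.2.1), e.2.2) : CorrSpace)‖ := by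
      simp only [Prod.norm_def (x := e), Prod.norm_def (x := e.2), Prod.norm_mk]
      refine max_le ?_ (max_le ?_ ?_)
      · exact le_max_of_le_left (le_max_of_le_right (le_max_left _ _))
      · exact le_max_of_le_left (le_max_of_le_right (le_max_right _ _))
      · exact le_max_right _ _
    have h0 := norm_nonneg e
    have e1 : (1 + ‖e‖) ^ (-11 : ℝ) = ((1 + ‖e‖) ^ 11)⁻¹ := by
      rw [Real.rpow_neg (by positivity)]; norm_cast
    simp only [e1]
    rw [← div_eq_mul_inv, le_div_iff₀ (by positivity), mul_comm]
    exact (mul_le_mul_of_nonneg_right (pow_le_pow_left₀ (by positivity) (by linarith) 11) (norm_nonneg _)).trans h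

section Limit

variable (b : OrthonormalBasis (Fin 2) ℝ Plane) {l : Fin 2 → ℝ}

/-- The phase in the limit `η = 0`: the quadratic phases of the two scattering events cancel. -/
lemma corrPhase_zero (l : Fin 2 → ℝ) (ω ν : ℝ) (X Y : Plane) (c : CorrSpace) :
    corrPhase b l 0 ω (-ω) ν X X Y c = -(ν * (c.1.1 - inner ℝ c.1.2.1 (diagOp b l⁻¹ c.1.2.1) / 2))
      + (-(ω * (c.2.1.1 - c.2.2.1)) + ω * inner ℝ (c.2.1.2 - c.2.2.2 - Y) (diagOp b l⁻¹ c.1.2.1)) := by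
  simp only [corrPhase, zero_mul, zero_smul, zero_add, add_zero, inner_add_left, inner_sub_left, inner_smul_left,
    conj_trivial]
  ring

/-- The difference frequency `ν` is dual to the time `s̄`: integrating over `ν` concentrates the kernel on
the paraboloid `s̄ = ȳ·Q⁻¹ȳ/2`, which is parametrized by `ȳ = Qp`, with Jacobian `det Q = l 0 * l 1`. -/
lemma integral_corrPhase_zero (hl : ∀ i, 0 < l i) (Φ : 𝓢(CorrSpace, ℂ)) (ω : ℝ) (X Y : Plane)
    (hint : Integrable fun ν : ℝ => ∫ c, Φ c * osc (corrPhase b l 0 ω (-ω) ν X X Y c)) :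
    ∫ ν : ℝ, ∫ c, Φ c * osc (corrPhase b l 0 ω (-ω) ν X X Y c) = (2 * Real.pi : ℂ) * (((l 0 * l 1 : ℝ) : ℂ) *
      ∫ p : Plane, osc (-(ω * inner ℝ p Y)) * ∫ r : Plane × (ℝ × Plane) × (ℝ × Plane),
        osc (-(ω * (r.2.1.1 - r.2.2.1 - inner ℝ p (r.2.1.2 - r.2.2.2))))
          * Φ ((inner ℝ p (diagOp b l p) / 2, diagOp b l p, r.1), r.2.1, r.2.2)) := by
  set h : Plane → ℝ := fun yb => inner ℝ yb (diagOp b l⁻¹ yb) / 2 with hh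
  set ρ : CorrFiber → ℝ := fun e => -(ω * (e.2.2.1.1 - e.2.2.2.1))
    + ω * inner ℝ (e.2.2.1.2 - e.2.2.2.2 - Y) (diagOp b l⁻¹ e.1) with hρ
  have hhm : Measurable h := by fun_prop
  have hhc : Continuous h := by fun_prop
  have hρc : Continuous ρ := by fun_prop
  have hσ := measurePreserving_shear hhm
  have hΦi : Integrable (fun c => Φ c) (volume : Measure CorrSpace) :=
    integrable_schwartz (μ := (volume : Measure CorrSpace)) Φ
  obtain ⟨g, hg, hgb⟩ := exists_integrable_bound_fiber Φ
  -- the test function in the variables `(s, e)`, including the part of the phase that does not depend on `ν`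
  set F : ℝ × CorrFiber → ℂ := fun u =>
    Φ ((u.1 + h u.2.1, u.2.1, u.2.2.1), u.2.2.2) * osc (ρ u.2) with hF
  have hFi : Integrable F ((volume : Measure ℝ).prod (volume : Measure CorrFiber)) := by
    have h1 := (hσ.integrable_comp hΦi.aestronglyMeasurable).2 hΦi
    exact integrable_mul_osc h1 (hρc.measurable.comp measurable_snd)
  set f : ℝ → ℂ := fun s => ∫ e, F (s, e) with hf
  have hfi : Integrable f := hFi.integral_prod_left
  have hΦc := Φ.continuous
  have hfc : Continuous f := by
    refine continuous_of_dominated (bound := g) (fun s => ?_) (fun s => Eventually.of_forall fun e => ?_) hg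
      (Eventually.of_forall fun e => ?_)
    · exact ((hΦc.comp (by fun_prop : Continuous fun e : CorrFiber =>
        (((s + h e.1, e.1, e.2.1), e.2.2) : CorrSpace))).mul (continuous_osc.comp hρc)).aestronglyMeasurable
    · rw [hF, norm_mul, norm_osc, mul_one]; exact hgb _ e
    · exact (hΦc.comp (by fun_prop : Continuous fun s : ℝ =>
        (((s + h e.1, e.1, e.2.1), e.2.2) : CorrSpace))).mul (continuous_const (y := osc (ρ e)))
  have hL : ∀ ν : ℝ, ∫ c, Φ c * osc (corrPhase b l 0 ω (-ω) ν X X Y c) = ∫ s, osc (-(ν * s)) * f s := by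
    intro ν
    have hm : AEStronglyMeasurable (fun c => Φ c * osc (corrPhase b l 0 ω (-ω) ν X X Y c))
        (volume : Measure CorrSpace) :=
      (integrable_mul_osc hΦi (continuous_corrPhase_apply b l _ _ _ _ _ _ _).measurable).aestronglyMeasurable
    rw [← hσ.map_eq] at hm
    have e1 := integral_map hσ.measurable.aemeasurable hm
    rw [hσ.map_eq] at e1
    rw [e1]
    have e2 : ∀ u : ℝ × CorrFiber, Φ ((u.1 + h u.2.1, u.2.1, u.2.2.1), u.2.2.2) *
        osc (corrPhase b l 0 ω (-ω) ν X X Y ((u.1 + h u.2.1, u.2.1, u.2.2.1), u.2.2.2))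
        = F u * osc (-(ν * u.1)) := by
      intro u
      have e3 : corrPhase b l 0 ω (-ω) ν X X Y ((u.1 + h u.2.1, u.2.1, u.2.2.1), u.2.2.2)
          = ρ u.2 + -(ν * u.1) := by
        rw [corrPhase_zero]; simp only [hh, hρ]; ring
      rw [e3, osc_add, hF]; ring
    simp_rw [e2]
    have hFi' : Integrable (fun u : ℝ × CorrFiber => F u * osc (-(ν * u.1)))
        ((volume : Measure ℝ).prod (volume : Measure CorrFiber)) := integrable_mul_osc hFi (by fun_prop)
    refine (integral_prod _ hFi').trans ?_
    congr 1; ext s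
    have e4 := integral_mul_const (μ := (volume : Measure CorrFiber)) (osc (-(ν * s))) (fun e => F (s, e))
    exact e4.trans (mul_comm _ _)
  simp_rw [hL] at hint ⊢
  have hinv := integral_osc_inversion hfi hfc hint 0
  simp only [mul_zero, osc_zero, one_mul] at hinv
  rw [hinv]
  congr 1
  have hF0 : Integrable (fun e : CorrFiber => F (0, e)) ((volume : Measure Plane).prod
      (volume : Measure (Plane × (ℝ × Plane) × (ℝ × Plane)))) := by
    refine hg.mono' ?_ (Eventually.of_forall fun e => ?_)
    · exact ((hΦc.comp (by fun_prop : Continuous fun e : CorrFiber =>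
        (((0 + h e.1, e.1, e.2.1), e.2.2) : CorrSpace))).mul (continuous_osc.comp hρc)).aestronglyMeasurable
    · rw [hF, norm_mul, norm_osc, mul_one]; exact hgb _ e
  have hf0 : f 0 = ∫ yb : Plane, ∫ r : Plane × (ℝ × Plane) × (ℝ × Plane), F (0, (yb, r)) := integral_prod _ hF0
  rw [hf0, integral_comp_diagOp b hl]
  congr 1
  congr 1; ext p
  rw [← integral_const_mul]
  congr 1; ext r
  have hinvp := diagOp_inv_apply b (fun i => (hl i).ne') p
  have hQ : h (diagOp b l p) = inner ℝ p (diagOp b l p) / 2 := by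
    simp only [hh, hinvp]; rw [real_inner_comm]
  have hρp : ρ (diagOp b l p, r) = -(ω * inner ℝ p Y) + -(ω * (r.2.1.1 - r.2.2.1 - inner ℝ p (r.2.1.2 - r.2.2.2))) := by
    simp only [hρ, hinvp]
    rw [real_inner_comm, inner_sub_right p (r.2.1.2 - r.2.2.2) Y]; ring
  simp only [hF]
  rw [hρp, osc_add, hQ, zero_add]
  ring

end Limit

/-! ### The limit correlation function -/

section LimitKernel

variable (b : OrthonormalBasis (Fin 2) ℝ Plane) {l : Fin 2 → ℝ} {w : ℝ → Plane → ℂ} {a β M : ℝ} {G : Plane → ℝ}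
  (hw : IsWavePacket w a β M G) (hl : ∀ i, 0 < l i)
  {χ : ℝ → Plane → ℂ} (hχ : StronglyMeasurable fun ζ : (ℝ × ℝ) × (Plane × Plane) => χ ζ.1.1 ζ.2.2)
  (hχ1 : ∀ ω Y, ‖χ ω Y‖ ≤ 1)
include hw hl hχ hχ1

lemma integrable_corrKernel_mul (Φ : 𝓢(CorrSpace, ℂ)) :
    Integrable fun ζ : (ℝ × ℝ) × (Plane × Plane) => corrKernel b l w Φ 0 ζ * χ ζ.1.1 ζ.2.2 := by
  obtain ⟨p, -, H, hHi, -, hH⟩ := exists_corrKernel_bound b hw hl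
  refine Integrable.mul_bdd (c := 1) ((hHi.const_mul (p Φ)).mono' (measurable_corrKernel b hw Φ 0).aestronglyMeasurable
    (Eventually.of_forall (hH Φ 0 le_rfl zero_le_one))) hχ.aestronglyMeasurable (Eventually.of_forall fun ζ => hχ1 _ _)

/-- The limit functional is a tempered distribution. -/
lemma exists_temperedDistribution_corrKernel : ∃ T : 𝓢'(CorrSpace, ℂ), ∀ Φ : 𝓢(CorrSpace, ℂ),
    T Φ = ∫ ζ : (ℝ × ℝ) × (Plane × Plane), corrKernel b l w Φ 0 ζ * χ ζ.1.1 ζ.2.2 := by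
  obtain ⟨p, hp, H, hHi, hH0, hH⟩ := exists_corrKernel_bound b hw hl
  have hi : ∀ (Φ : 𝓢(CorrSpace, ℂ)) (ζ : (ℝ × ℝ) × (Plane × Plane)), Integrable (fun c => Φ c *
      osc (corrPhase b l 0 ζ.1.1 (-ζ.1.1 + 0 ^ 2 * ζ.1.2) ζ.1.2
        (-((-ζ.1.1 + 0 ^ 2 * ζ.1.2) / ζ.1.1) • ζ.2.1 + (0 : ℝ) • ζ.2.2) ζ.2.1 ζ.2.2 c)) (volume : Measure CorrSpace) :=
    fun Φ ζ => integrable_mul_osc (integrable_schwartz (μ := (volume : Measure CorrSpace)) Φ)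
      (continuous_corrPhase_apply b l _ _ _ _ _ _ _).measurable
  have hadd : ∀ (Φ Φ' : 𝓢(CorrSpace, ℂ)) ζ, corrKernel b l w (Φ + Φ' : 𝓢(CorrSpace, ℂ)) 0 ζ
      = corrKernel b l w Φ 0 ζ + corrKernel b l w Φ' 0 ζ := by
    intro Φ Φ' ζ
    simp only [corrKernel]
    rw [← mul_add, ← integral_add (hi Φ ζ) (hi Φ' ζ)]
    congr 2; ext c
    rw [add_apply]; ring
  have hsmul : ∀ (k : ℂ) (Φ : 𝓢(CorrSpace, ℂ)) ζ, corrKernel b l w (k • Φ : 𝓢(CorrSpace, ℂ)) 0 ζ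
      = k * corrKernel b l w Φ 0 ζ := by
    intro k Φ ζ
    have e : ∀ ψ : CorrSpace → ℝ, ∫ c, (k • Φ : 𝓢(CorrSpace, ℂ)) c * osc (ψ c) = k * ∫ c, Φ c * osc (ψ c) := by
      intro ψ
      rw [← integral_const_mul]
      congr 1; ext c
      rw [smul_apply, smul_eq_mul]; ring
    simp only [corrKernel]
    rw [e]; ring
  have hI := integrable_corrKernel_mul b hw hl hχ hχ1
  let f : 𝓢(CorrSpace, ℂ) →ₗ[ℂ] ℂ :=
    { toFun := fun Φ => ∫ ζ : (ℝ × ℝ) × (Plane × Plane), corrKernel b l w Φ 0 ζ * χ ζ.1.1 ζ.2.2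
      map_add' := fun Φ Φ' => by
        rw [← integral_add (hI Φ) (hI Φ')]
        congr 1; ext ζ
        rw [hadd]; ring
      map_smul' := fun k Φ => by
        rw [RingHom.id_apply, smul_eq_mul, ← integral_const_mul]
        congr 1; ext ζ
        rw [hsmul]; ring }
  have hf : ∀ Φ, ‖f Φ‖ ≤ p Φ * ∫ ζ, H ζ := by
    intro Φ
    rw [← integral_const_mul]
    refine norm_integral_le_of_norm_le (hHi.const_mul _) (Eventually.of_forall fun ζ => ?_)
    rw [norm_mul]
    exact (mul_le_of_le_one_right (norm_nonneg _) (hχ1 _ _)).trans (hH Φ 0 le_rfl zero_le_one ζ)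
  have hfc : Continuous f := by
    refine continuous_of_continuousAt_zero f ?_
    have h0 : Tendsto (fun Φ => p Φ * ∫ ζ, H ζ) (𝓝 0) (𝓝 0) := by
      have := (hp.tendsto 0).mul_const (∫ ζ, H ζ)
      rwa [map_zero, zero_mul] at this
    rw [ContinuousAt, map_zero]
    exact squeeze_zero_norm hf h0
  exact ⟨(⟨f, hfc⟩ : 𝓢(CorrSpace, ℂ) →L[ℂ] ℂ), fun _ => rfl⟩

/-- The limit functional, after integration over the difference frequency and over the scattering point. -/
lemma integral_corrKernel_zero (Φ : 𝓢(CorrSpace, ℂ)) :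
    ∫ ζ : (ℝ × ℝ) × (Plane × Plane), corrKernel b l w Φ 0 ζ * χ ζ.1.1 ζ.2.2
      = ∫ ω : ℝ, (∫ X, w ω X * w (-ω) X) * ((2 * Real.pi : ℂ) * (((l 0 * l 1 : ℝ) : ℂ) * ∫ Y, χ ω Y *
        ∫ p : Plane, osc (-(ω * inner ℝ p Y)) * ∫ r : Plane × (ℝ × Plane) × (ℝ × Plane),
        osc (-(ω * (r.2.1.1 - r.2.2.1 - inner ℝ p (r.2.1.2 - r.2.2.2))))
          * Φ ((inner ℝ p (diagOp b l p) / 2, diagOp b l p, r.1), r.2.1, r.2.2))) := by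
  set N : ℝ → ℝ → Plane → ℂ := fun ω ν Y => ∫ c, Φ c * osc (corrPhase b l 0 ω (-ω) ν 0 0 Y c) with hN
  have hker : ∀ ω ν X Y, corrKernel b l w Φ 0 ((ω, ν), (X, Y)) = w ω X * w (-ω) X * N ω ν Y := by
    intro ω ν X Y
    by_cases hω : ω = 0
    · subst hω; simp [corrKernel, hw.zero]
    have e1 : -ω + 0 ^ 2 * ν = -ω := by ring
    have e2 : -(-ω / ω) • X + (0 : ℝ) • Y = X := by
      rw [zero_smul, add_zero, neg_div, neg_neg, div_self hω, one_smul]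
    simp only [corrKernel, e1, e2, hN, corrPhase_zero]
  have hI := integrable_corrKernel_mul b hw hl hχ hχ1 Φ
  have s1 := integral_prod _ hI
  have s2 := integral_prod _ hI.integral_prod_left
  refine s1.trans (s2.trans ?_)
  congr 1; ext ω
  have e3 : ∀ ν, ∫ q : Plane × Plane, corrKernel b l w Φ 0 ((ω, ν), q) * χ ω q.2
      = (∫ X, w ω X * w (-ω) X) * ∫ Y, N ω ν Y * χ ω Y := by
    intro ν
    rw [← integral_prod_mul]
    congr 1; ext q
    obtain ⟨X, Y⟩ := q
    rw [hker]; ring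
  refine (integral_congr_ae (Eventually.of_forall e3)).trans ?_
  rw [integral_const_mul]
  by_cases hW : ∫ X, w ω X * w (-ω) X = 0
  · rw [hW, zero_mul, zero_mul]
  congr 1
  -- only frequencies of the band contribute
  obtain ⟨X, hX⟩ : ∃ X, w ω X ≠ 0 := by
    by_contra! h
    exact hW (by simp [h])
  obtain ⟨hωa, hωβ⟩ := hw.band ω X hX
  have hω0 : 0 < |ω| := hw.pos.trans_le hωa
  obtain ⟨p, -, hp⟩ := exists_seminorm_corrPhase b hl β
  have hNb : ∀ ν Y, ‖N ω ν Y‖ ≤ (1 + ν ^ 2)⁻¹ * (p Φ * (1 + (|ω| * ‖Y‖) ^ 4)⁻¹) := by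
    intro ν Y
    have h := hp Φ 0 ω (-ω) ν 0 0 Y le_rfl zero_le_one hωβ (by rwa [abs_neg])
    have e : (1 + ν ^ 2)⁻¹ * (p Φ * (1 + (|ω| * ‖Y‖) ^ 4)⁻¹) = p Φ / ((1 + ν ^ 2) * (1 + (|ω| * ‖Y‖) ^ 4)) := by
      field_simp
    rw [e, le_div_iff₀ (by positivity), mul_comm]
    exact h
  have hNm : StronglyMeasurable fun q : ℝ × Plane => N ω q.1 q.2 := by
    have h3 : Measurable fun q : (ℝ × Plane) × CorrSpace => corrPhase b l 0 ω (-ω) q.1.1 0 0 q.1.2 q.2 := by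
      unfold corrPhase; fun_prop
    have h4 : StronglyMeasurable fun q : (ℝ × Plane) × CorrSpace =>
        Φ q.2 * osc (corrPhase b l 0 ω (-ω) q.1.1 0 0 q.1.2 q.2) :=
      ((Φ.continuous.measurable.comp measurable_snd).mul (measurable_osc.comp h3)).stronglyMeasurable
    exact h4.integral_prod_right (ν := (volume : Measure CorrSpace))
  have hdec : Integrable fun Y : Plane => p Φ * (1 + (|ω| * ‖Y‖) ^ 4)⁻¹ := by
    refine Integrable.const_mul ?_ _
    have h := (integrable_one_add_norm_plane.comp_smul hω0.ne').const_mul 8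
    refine h.mono' (by fun_prop) (Eventually.of_forall fun Y => ?_)
    rw [norm_smul, Real.norm_eq_abs, Real.norm_eq_abs, abs_abs, rpow_neg_four (by positivity),
      abs_of_nonneg (by positivity), ← div_eq_mul_inv, le_div_iff₀ (by positivity), inv_mul_le_iff₀ (by positivity)]
    linarith [one_add_pow_four_le (|ω| * ‖Y‖)]
  have hχω : StronglyMeasurable (χ ω) :=
    hχ.comp_measurable (g := fun Y : Plane => (((ω, 0), (0, Y)) : (ℝ × ℝ) × (Plane × Plane))) (by fun_prop)
  have hNi : Integrable (fun q : ℝ × Plane => N ω q.1 q.2 * χ ω q.2) (volume.prod volume) := by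
    refine (integrable_inv_one_add_sq.mul_prod hdec).mono'
      (hNm.mul (hχω.comp_measurable measurable_snd)).aestronglyMeasurable (Eventually.of_forall fun q => ?_)
    rw [norm_mul]
    exact (mul_le_of_le_one_right (norm_nonneg _) (hχ1 _ _)).trans (hNb _ _)
  rw [integral_integral_swap hNi]
  have e5 : ∀ Y, ∫ ν, N ω ν Y * χ ω Y = (2 * Real.pi : ℂ) * (((l 0 * l 1 : ℝ) : ℂ) * (χ ω Y *
        ∫ p : Plane, osc (-(ω * inner ℝ p Y)) * ∫ r : Plane × (ℝ × Plane) × (ℝ × Plane),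
        osc (-(ω * (r.2.1.1 - r.2.2.1 - inner ℝ p (r.2.1.2 - r.2.2.2))))
          * Φ ((inner ℝ p (diagOp b l p) / 2, diagOp b l p, r.1), r.2.1, r.2.2))) := by
    intro Y
    rw [integral_mul_const, integral_corrPhase_zero b hl Φ ω 0 Y]
    · ring
    · exact (integrable_inv_one_add_sq.mul_const _).mono'
        (hNm.comp_measurable (g := fun ν : ℝ => (ν, Y)) (by fun_prop)).aestronglyMeasurable
        (Eventually.of_forall fun ν => hNb ν Y)
  simp_rw [e5]
  rw [integral_const_mul, integral_const_mul]

end LimitKernel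

namespace Config

variable (D : Config) {Ψ : ℝ → Plane → ℝ} (b₀ b : OrthonormalBasis (Fin 2) ℝ Plane) {l₀ l : Fin 2 → ℝ}

/-- Plancherel identity for the wave at the interface. -/
lemma integral_packet_mul_packet_neg (hr : 0 ≤ D.s₀ / D.s₁) (hl : ∀ i, 0 < l i)
    (hΨ : Integrable (fun z : ℝ × Plane => Ψ z.1 z.2)) (hband : HasBandLimitedSpectrum Ψ) (ω : ℝ) :
    ∫ X, D.packet b₀ l₀ l Ψ ω X * D.packet b₀ l₀ l Ψ (-ω) X =
      (((D.transCoeff ^ 2 * D.s₀ / (4 * D.s₁ * (2 * Real.pi) ^ 3)) * (sourceEnergy Ψ ω * ω ^ 2)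
        / (2 * Real.pi * (l 0 * l 1)) : ℝ) : ℂ) := by
  have hpi := Real.pi_pos
  by_cases hω : ω = 0
  · subst hω; simp [packet]
  set C : ℝ := D.transCoeff / (2 * (2 * Real.pi) ^ 3) * √(D.s₀ / D.s₁) with hC
  have hd : 0 < l 0 * l 1 := mul_pos (hl 0) (hl 1)
  have hsq : (√(l 0 * l 1)) ^ 2 = l 0 * l 1 := Real.sq_sqrt hd.le
  have hs0 : √(l 0 * l 1) ≠ 0 := (Real.sqrt_pos.2 hd).ne'
  have hprod : ∀ X, D.packet b₀ l₀ l Ψ ω X * D.packet b₀ l₀ l Ψ (-ω) X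
      = (((C ^ 2 * ω ^ 6 / ((2 * Real.pi) ^ 2 * (l 0 * l 1))) * ‖incProfile b₀ l₀ Ψ ω X‖ ^ 2 : ℝ) : ℂ) := by
    intro X
    have h1 := Complex.mul_conj' (incProfile b₀ l₀ Ψ ω X)
    rw [conj_incProfile] at h1
    have h2 : ((√(l 0 * l 1) : ℝ) : ℂ) ≠ 0 := Complex.ofReal_ne_zero.2 hs0
    have h3 : ((l 0 * l 1 : ℝ) : ℂ) = ((√(l 0 * l 1) : ℝ) : ℂ) ^ 2 := by rw [← hsq]; push_cast; rw [hsq]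
    have hpc : (Real.pi : ℂ) ≠ 0 := Complex.ofReal_ne_zero.2 hpi.ne'
    have hI := Complex.I_ne_zero
    rw [Complex.ofReal_mul, Complex.ofReal_pow ‖_‖, ← h1, Complex.ofReal_div, Complex.ofReal_mul (_ ^ 2) (l 0 * l 1), h3]
    simp only [packet, ← hC]
    push_cast
    field_simp
    rw [Complex.I_sq]
    ring
  obtain ⟨a, β, M, G, hinc⟩ := exists_isWavePacket_incProfile b₀ (l₀ := l₀) hΨ hband
  obtain ⟨a', β', R', ha', hb'⟩ := hband
  have hpl := integral_norm_sq_integral_osc (integrable_incSpectrum b₀ l₀ hb' hΨ ω)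
    ((continuous_incSpectrum b₀ l₀ hΨ).comp (by fun_prop : Continuous fun q : Plane => (ω, q))) hω
    (hinc.integrable_apply ω)
  have hpl' : ∫ X, ‖incProfile b₀ l₀ Ψ ω X‖ ^ 2 = (2 * Real.pi / |ω|) ^ 2 * ∫ q, ‖sourceFT Ψ ω q‖ ^ 2 := by
    rw [finrank_euclideanSpace_fin] at hpl
    refine hpl.trans ?_
    congr 2; ext q
    exact congrArg (· ^ 2) (norm_incSpectrum b₀ l₀ ω q)
  simp_rw [hprod]
  rw [integral_complex_ofReal, integral_const_mul, hpl', sourceEnergy, div_pow, sq_abs]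
  congr 1
  have hC2 : C ^ 2 = D.transCoeff ^ 2 / (2 * (2 * Real.pi) ^ 3) ^ 2 * (D.s₀ / D.s₁) := by
    rw [hC, mul_pow, div_pow, Real.sq_sqrt hr]
  rw [hC2]
  field_simp
  ring

/-- The limit functional is the pairing with the explicit limit correlation function. -/
lemma integral_corrKernel_eq_limitPairing {Ω : Type*} [MeasurableSpace Ω] {P : Measure Ω} [IsProbabilityMeasure P]
    {V : Plane → Ω → ℝ} (hV : ∀ x, Measurable (V x)) (hVc : ∀ o, Continuous fun x => V x o)
    (hr : 0 ≤ D.s₀ / D.s₁) (hQ : ∀ p, D.yTr p = diagOp b l p) (hl : ∀ i, 0 < l i)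
    (hΨ : Integrable (fun z : ℝ × Plane => Ψ z.1 z.2)) (hband : HasBandLimitedSpectrum Ψ) (Φ : 𝓢(CorrSpace, ℂ)) :
    ∫ ζ : (ℝ × ℝ) × (Plane × Plane), corrKernel b l (D.packet b₀ l₀ l Ψ) Φ 0 ζ *
        incrementCharFun P V (ζ.1.1 * (D.s₀ - D.s₁)) ζ.2.2 = D.limitPairing P V Ψ Φ := by
  obtain ⟨a, β, M, G, hw⟩ := D.exists_isWavePacket_packet b₀ (l₀ := l₀) (l := l) hΨ hband
  have h := integral_corrKernel_zero b hw hl (χ := fun ω Y => incrementCharFun P V (ω * (D.s₀ - D.s₁)) Y)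
    (stronglyMeasurable_incrementCharFun hV hVc _) (fun ω Y => norm_incrementCharFun_le _ _) Φ
  refine h.trans ?_
  rw [limitPairing, ← integral_const_mul]
  congr 1; ext ω
  have hs : ∀ p, D.sTr p = inner ℝ p (diagOp b l p) / 2 := fun p => by
    rw [← hQ, yTr, inner_smul_right, sTr]
  rw [D.integral_packet_mul_packet_neg b₀ hr hl hΨ hband]
  simp only [scatteringDist, exp_neg_I_mul, exp_I_mul, hs, hQ, incrementCharFun]
  have hd : ((l 0 * l 1 : ℝ) : ℂ) ≠ 0 := Complex.ofReal_ne_zero.2 (mul_pos (hl 0) (hl 1)).ne'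
  have hpc : (Real.pi : ℂ) ≠ 0 := Complex.ofReal_ne_zero.2 Real.pi_ne_zero
  have aux : ∀ A c d K E J : ℂ, A * (c * d) = K * E → A * (c * (d * J)) = K * (E * J) := fun A c d K E J h => by
    linear_combination J * h
  refine aux _ _ _ _ _ _ ?_
  rw [Complex.ofReal_div, Complex.ofReal_mul (2 * Real.pi) (l 0 * l 1), Complex.ofReal_mul (_ / _),
    Complex.ofReal_mul 2, Complex.ofReal_ofNat]
  exact div_mul_cancel₀ _ (mul_ne_zero (mul_ne_zero two_ne_zero hpc) hd)

end Config

/-! ### Convergence of the transmitted correlation function -/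

/-- The scale `η = ε^(γ - 1/2)`, the ratio of the correlation length of the interface to the width of the
pulse, tends to zero. -/
lemma tendsto_rpow_sub_half {γ : ℝ} (hγ : 1 / 2 < γ) :
    Tendsto (fun ε : ℝ => ε ^ (γ - 1 / 2)) (𝓝[>] 0) (𝓝[>] 0) := by
  have hpos : 0 < γ - 1 / 2 := by linarith
  refine tendsto_nhdsWithin_iff.2 ⟨?_, ?_⟩
  · have h := (Real.continuousAt_rpow_const 0 (γ - 1 / 2) (Or.inr hpos.le)).tendsto
    rw [Real.zero_rpow hpos.ne'] at h
    exact h.mono_left nhdsWithin_le_nhds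
  · filter_upwards [self_mem_nhdsWithin] with ε hε
    exact Real.rpow_pos_of_pos hε _

end RoughInterface

theorem mainTheorem9 {Ω : Type*} [MeasurableSpace Ω] (P : Measure Ω) [IsProbabilityMeasure P]
    (V : Plane → Ω → ℝ) (hV_meas : ∀ x, Measurable (V x)) (hV_cont : ∀ o, Continuous fun x => V x o)
    (hV_stat : IsStationaryField P V) (hV_mix : IsAlphaMixing P V)
    (Ψ : ℝ → Plane → ℝ) (hΨ : Integrable (fun z : ℝ × Plane => Ψ z.1 z.2))
    (hΨ_band : HasBandLimitedSpectrum Ψ)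
    (D : Config) (hc₁ : 0 < D.c₁) (hc : D.c₁ < D.c₀) (hk₀ : ‖D.k₀‖ < 1 / D.c₀)
    (hzInt : 0 < D.zInt) (hzTr : D.zInt < D.zTr)
    (γ : ℝ) (hγ : γ ∈ Set.Ioc (1 / 2 : ℝ) 2) :
    -- the oscillatory integral defining the transmitted wave converges
    (∀ ε > 0, ∀ (o : Ω) (t : ℝ) (x : Plane),
      Tendsto (D.transmittedReg Ψ γ ε (fun x' => V x' o) t x) (𝓝[>] 0)
        (𝓝 (D.transmitted Ψ γ ε (fun x' => V x' o) t x))) ∧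
    -- the correlation function can be integrated against every test function
    (∀ ε > 0, ∀ (o : Ω) (Φ : 𝓢(CorrSpace, ℂ)),
      Integrable fun w => D.correlation Ψ γ ε (fun x' => V x' o) w * Φ w) ∧
    -- the limit is a tempered distribution, and convergence holds in probability
    (∃ Ctr : 𝓢'(CorrSpace, ℂ),
      (∀ Φ : 𝓢(CorrSpace, ℂ), Ctr Φ = D.limitPairing P V Ψ Φ) ∧
      ∀ Φ : 𝓢(CorrSpace, ℂ),
        TendstoInMeasure P
          (fun (ε : ℝ) (o : Ω) => ∫ w, D.correlation Ψ γ ε (fun x' => V x' o) w * Φ w)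
          (𝓝[>] 0) (fun _ => Ctr Φ)) ∧
    -- the speckle time lags are nonnegative
    (∀ p, 0 ≤ D.sTr p) ∧
    -- the generalized Snell law of refraction, oblique incidence
    (D.k₀ ≠ 0 → ∀ ε > 0, ∀ p,
      Real.tan (D.thetaTr γ ε p) / Real.tan D.thetaSpec
          = ‖D.xObs - D.xInt + (ε ^ (1 - γ)) • D.yTr p‖ / ‖D.xObs - D.xInt‖ ∧
      Real.tan (D.thetaTr γ ε p) / Real.tan D.thetaSpec = √(D.bigXi γ ε p) ∧
      Real.sin (D.thetaTr γ ε p) / D.c₁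
          = Real.sin D.thetaInc / D.c₀ + ‖D.k₀‖ *
            (√(D.bigXi γ ε p / (1 + Real.sin D.thetaSpec ^ 2 * (D.bigXi γ ε p - 1))) - 1)) ∧
    -- the generalized Snell law of refraction, normal incidence
    (D.k₀ = 0 → ∀ ε > 0, ∀ p, D.thetaTr γ ε p = Real.arctan (ε ^ (1 - γ) * D.c₁ * ‖p‖)) := by
  have hc₀ : 0 < D.c₀ := hc₁.trans hc
  have hγ1 : 1 / 2 < γ := hγ.1
  -- diagonalize the quadratic forms of the propagation down to the interface and below it
  obtain ⟨b₀, l₀, -, hQ₀⟩ := exists_dispersion_eq_diagOp hc₀ hk₀ (mul_pos hzInt hc₀)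
  obtain ⟨b, l, hl, hQ⟩ := exists_dispersion_eq_diagOp hc₁ (Config.norm_k₀_lt hc₁ hc hk₀)
    (mul_pos (sub_pos.2 hzTr) hc₁)
  have hQ' : ∀ p, D.yTr p = diagOp b l p := hQ
  have hr : 0 ≤ D.s₀ / D.s₁ := (div_pos (Config.s₀_pos hc₁ hc hk₀) (Config.s₁_pos hc₁ hc hk₀)).le
  obtain ⟨a, β, M, G, hw⟩ := D.exists_isWavePacket_packet b₀ (l₀ := l₀) (l := l) hΨ hΨ_band
  have hθ : ∀ (o : Ω) (ε : ℝ), Continuous fun X : Plane =>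
      (D.s₀ - D.s₁) * V ((ε ^ γ)⁻¹ • D.xInt + (ε ^ (γ - 1 / 2))⁻¹ • X) o := fun o ε =>
    continuous_const.mul ((hV_cont o).comp (by fun_prop))
  -- the two speckle profiles as rescaled waves with `η = ε^(γ - 1/2)`
  have hcorr : ∀ ε > 0, ∀ (o : Ω) (c : CorrSpace), D.correlation Ψ γ ε (fun x' => V x' o) c = _ :=
    fun ε hε o c => congrArg₂ (· * ·)
      (D.speckle_eq b₀ b hc₁ hc hk₀ hQ₀ hQ' hl hΨ hΨ_band hε γ (hV_cont o) c.1.1 c.1.2.1 c.1.2.2 c.2.1.1 c.2.1.2 rfl)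
      (D.speckle_eq b₀ b hc₁ hc hk₀ hQ₀ hQ' hl hΨ hΨ_band hε γ (hV_cont o) c.1.1 c.1.2.1 c.1.2.2 c.2.2.1 c.2.2.2 rfl)
  refine ⟨fun ε hε o t x => ?_, fun ε hε o Φ => ?_, ?_, Config.sTr_nonneg hc₁ hc hk₀ hzTr, fun hk ε _ p => ?_,
    fun hk ε hε p => Config.thetaTr_of_normal hc₁ hc hk₀ hzTr hk hε p⟩
  · exact tendsto_nhds_limUnder
      ⟨_, D.tendsto_transmittedReg b₀ b hQ₀ hQ' hl hΨ hΨ_band hε γ (hV_cont o) t x⟩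
  · have h := (integrable_waveField_mul b (l := l) hw (hθ o ε) Φ (ε ^ (γ - 1 / 2))).const_mul
      ((((ε ^ (γ - 1 / 2))⁻¹ ^ 2 : ℝ) : ℂ) * (((ε ^ (γ - 1 / 2))⁻¹ ^ 2 : ℝ) : ℂ))
    refine h.congr (Eventually.of_forall fun c => ?_)
    simp only [hcorr ε hε o c]
    ring
  · obtain ⟨T, hT⟩ := exists_temperedDistribution_corrKernel b hw hl
      (χ := fun ω Y => incrementCharFun P V (ω * (D.s₀ - D.s₁)) Y)
      (stronglyMeasurable_incrementCharFun hV_meas hV_cont _) (fun ω Y => norm_incrementCharFun_le _ _)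
    refine ⟨T, fun Φ => ?_, fun Φ => ?_⟩
    · rw [hT, D.integral_corrKernel_eq_limitPairing b₀ b hV_meas hV_cont hr hQ' hl hΨ hΨ_band]
    · have h := tendstoInMeasure_corrKernel (P := P) hV_meas hV_cont b hV_stat hV_mix hw hl Φ (D.s₀ - D.s₁)
        (tendsto_rpow_sub_half hγ1) (fun ε => (ε ^ γ)⁻¹ • D.xInt)
      rw [hT]
      refine h.congr' ?_ EventuallyEq.rfl
      filter_upwards [self_mem_nhdsWithin] with ε hε
      refine Eventually.of_forall fun o => ?_
      have hη : 0 < ε ^ (γ - 1 / 2) := Real.rpow_pos_of_pos hε _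
      simp_rw [hcorr ε hε o]
      exact (integral_waveField_mul_waveField b (l := l) hw (hθ o ε) Φ hη).symm
  · obtain ⟨h1, h2⟩ := Config.tan_thetaTr_div hc₁ hc hk₀ hzTr hk γ ε p
    exact ⟨h1, h2, Config.sin_thetaTr_div hc₁ hc hk₀ hzTr hk γ ε p⟩
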